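/- Let $\Pi$ be a projector (Hermitian idempotent) of rank $2$ on $\mathbb C^2\otimes\mathbb C^2$ which is not of the form $P\otimes I$ or $I\otimes P$ for a single-qubit projector $P$. For $n\ge 2$ let $H_n(\Pi)=\sum_{j=1}^{n-1}\Pi_{j,j+1}$ act on $(\mathbb C^2)^{\otimes n}$, where $\Pi_{j,j+1}$ is $\Pi$ applied to the qubits $j,j+1$, and let $\mathcal G_n$ be the null space of $H_n(\Pi)$. Call $H_n(\Pi)$ frustration-free if its smallest eigenvalue is $0$ and every vector of $\mathcal G_n$ is annihilated by each $\Pi_{j,j+1}$, and frustrated otherwise. Let $\gamma(\Pi,n)$ be the spectral gap, i.e. the difference of the two smallest distinct eigenvalues of $H_n(\Pi)$ (the smallest non-zero eigenvalue in the frustration-free case). The chain is gapped if $\gamma(\Pi,n)\ge c$ for all $n\ge2$ with some constant $c>0$ independent of $n$, and gapless otherwise. Then $\dim\mathcal G_n=\dim\mathcal G_4\in\{0,1,2\}$ for all $n\ge 4$. Moreover, exactly one of the following holds: 1. $\mathcal G_4=\mathrm{span}\{|\alpha\alpha\alpha\alpha\rangle\}$ for some single-qubit state $\alpha$. 2. $\mathcal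 G_4=\mathrm{span}\{|\alpha\alpha\alpha\alpha\rangle,|\beta\beta\beta\beta\rangle\}$ for some linearly independent single-qubit states $\alpha,\beta$. 3. $\mathcal G_4=\mathrm{span}\{|\alpha\beta\alpha\beta\rangle,|\beta\alpha\beta\alpha\rangle\}$ for some linearly independent single-qubit states $\alpha,\beta$. 4. $\mathcal G_4=\mathrm{span}\{|\alpha\alpha\alpha\alpha\rangle,\ |\alpha^\perp\alpha\alpha\alpha\rangle+f|\alpha\alpha^\perp\alpha\alpha\rangle+f^2|\alpha\alpha\alpha^\perp\alpha\rangle+f^3|\alpha\alpha\alpha\alpha^\perp\rangle\}$ for some orthonormal single-qubit states $\alpha,\alpha^\perp$ and some non-zero $f\in\mathbb C$. 5. $\mathcal G_4=\{0\}$. In cases 1, 2, 3 and 4 the Hamiltonian $H_n(\Pi)$ is frustration-free for all $n\ge2$, whereas in case 5 it is frustrated for all $n\ge4$. The chain is gapped in cases 1, 2 and 3, and it is gapped in case 4 if $|f|\ne1$. If $|f|=1$ in case 4, then the chain is gapless, with $\gamma(\Pi,n)\le 1-\cos(\pi/n)$ for all $n\ge2$. -/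

import Mathlib

open scoped Matrix Kronecker

namespace QubitChain

/-- State vectors of a single qubit, by their coordinates in the standard basis. -/
abbrev Qubit : Type := Fin 2 → ℂ

/-- Vectors of the `n`-qubit space `(ℂ²)^{⊗ n}`, by their coordinates in the standard product
basis, which is indexed by the bit strings `Fin n → Fin 2`. -/
abbrev Vec (n : ℕ) : Type := (Fin n → Fin 2) → ℂ

/-- Operators on the `n`-qubit space, as matrices in the standard product basis. -/
abbrev Op (n : ℕ) : Type := Matrix (Fin n → Fin 2) (Fin n → Fin 2) ℂ

/-- Operators on `ℂ² ⊗ ℂ²`, as matrices in the standard product basis. -/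
abbrev TwoQubitOp : Type := Matrix (Fin 2 × Fin 2) (Fin 2 × Fin 2) ℂ

/-- A single-qubit state: a vector of norm one. -/
def IsState (a : Qubit) : Prop := star a ⬝ᵥ a = 1

/-- A two-qubit operator is `1`-local (among projectors) if it is `Q ⊗ I` or `I ⊗ Q` for some
single-qubit projector `Q`. -/
def IsOneLocal (P : TwoQubitOp) : Prop :=
  ∃ Q : Matrix (Fin 2) (Fin 2) ℂ, IsStarProjection Q ∧
    (P = Q ⊗ₖ (1 : Matrix (Fin 2) (Fin 2) ℂ) ∨ P = (1 : Matrix (Fin 2) (Fin 2) ℂ) ⊗ₖ Q)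

/-- The operator `P_{a,b}` on `n` qubits: `P` acts on the qubits `a`, `b` (in this order) and the
identity acts on all other qubits. -/
def onPair {n : ℕ} (P : TwoQubitOp) (a b : Fin n) : Op n :=
  Matrix.of fun x y =>
    if ∀ k : Fin n, k ≠ a → k ≠ b → x k = y k then P (x a, x b) (y a, y b) else 0

/-- The interaction term acting on the `j`-th pair of consecutive qubits. -/
def localTerm (P : TwoQubitOp) (n : ℕ) (j : Fin (n - 1)) : Op n :=
  onPair P ⟨j, by omega⟩ ⟨j + 1, by omega⟩

/-- The open-boundary Hamiltonian `H_n(P) = ∑_{j=1}^{n-1} P_{j,j+1}`. -/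
def hamiltonian (P : TwoQubitOp) (n : ℕ) : Op n :=
  ∑ j : Fin (n - 1), localTerm P n j

/-- The null space `𝒢_n` of `H_n(P)`. -/
def nullSpace (P : TwoQubitOp) (n : ℕ) : Submodule ℂ (Vec n) :=
  LinearMap.ker (Matrix.toLin' (hamiltonian P n))

/-- The (real) eigenvalues, that is the energies, of `H_n(P)`. -/
def energies (P : TwoQubitOp) (n : ℕ) : Set ℝ :=
  {E : ℝ | Module.End.HasEigenvalue (Matrix.toLin' (hamiltonian P n)) (E : ℂ)}

/-- `H_n(P)` is frustration-free: its ground energy is zero and its ground states are zero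
eigenvectors of each individual term. -/
def FrustrationFree (P : TwoQubitOp) (n : ℕ) : Prop :=
  IsLeast (energies P n) 0 ∧
    ∀ v ∈ nullSpace P n, ∀ j : Fin (n - 1), localTerm P n j *ᵥ v = 0

/-- `g` is the spectral gap of `H_n(P)`: the difference between the smallest energy above the
ground energy and the ground energy.  When the ground energy is zero this says that `g` is the
smallest non-zero eigenvalue. -/
def IsSpectralGap (P : TwoQubitOp) (n : ℕ) (g : ℝ) : Prop :=
  ∃ E₀ E₁ : ℝ, IsLeast (energies P n) E₀ ∧ IsLeast {E | E ∈ energies P n ∧ E₀ < E} E₁ ∧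
    g = E₁ - E₀

/-- The chain is gapped: its spectral gap is bounded below by a positive constant that does not
depend on the number of qubits. -/
def Gapped (P : TwoQubitOp) : Prop :=
  ∃ c : ℝ, 0 < c ∧ ∀ n : ℕ, 2 ≤ n → ∃ g : ℝ, IsSpectralGap P n g ∧ c ≤ g

/-- The product state `v₁ ⊗ v₂ ⊗ ⋯ ⊗ v_n`. -/
def prodState {n : ℕ} (v : Fin n → Qubit) : Vec n := fun x => ∏ i, v i (x i)

/-- `𝒢₄ = span {|αααα⟩}`. -/
def Case1 (P : TwoQubitOp) : Prop :=
  ∃ a : Qubit, IsState a ∧ nullSpace P 4 = Submodule.span ℂ {prodState ![a, a, a, a]}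

/-- `𝒢₄ = span {|αααα⟩, |ββββ⟩}`. -/
def Case2 (P : TwoQubitOp) : Prop :=
  ∃ a b : Qubit, IsState a ∧ IsState b ∧ LinearIndependent ℂ ![a, b] ∧
    nullSpace P 4 = Submodule.span ℂ {prodState ![a, a, a, a], prodState ![b, b, b, b]}

/-- `𝒢₄ = span {|αβαβ⟩, |βαβα⟩}`. -/
def Case3 (P : TwoQubitOp) : Prop :=
  ∃ a b : Qubit, IsState a ∧ IsState b ∧ LinearIndependent ℂ ![a, b] ∧
    nullSpace P 4 = Submodule.span ℂ {prodState ![a, b, a, b], prodState ![b, a, b, a]}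

/-- `𝒢₄ = span {|αααα⟩, |α'ααα⟩ + f |αα'αα⟩ + f² |ααα'α⟩ + f³ |αααα'⟩}` with `α`, `α'`
orthonormal and `f ≠ 0`. -/
def Case4 (P : TwoQubitOp) (f : ℂ) : Prop :=
  f ≠ 0 ∧ ∃ a a' : Qubit, IsState a ∧ IsState a' ∧ star a ⬝ᵥ a' = 0 ∧
    nullSpace P 4 = Submodule.span ℂ {prodState ![a, a, a, a],
      prodState ![a', a, a, a] + f • prodState ![a, a', a, a]
        + f ^ 2 • prodState ![a, a, a', a] + f ^ 3 • prodState ![a, a, a, a']}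

/-- `𝒢₄` contains no state, that is no non-zero vector. -/
def Case5 (P : TwoQubitOp) : Prop := nullSpace P 4 = ⊥

end QubitChain

set_option linter.unusedSectionVars false

/-! The kernel of `P` is a line in the projective space of two-qubit vectors, and the product
vectors form a quadric there. Over ℂ the line meets the quadric; lines inside the quadric are the
kernels of one-local projectors. So the line either meets the quadric in two points `a ⊗ b`, `c ⊗ d`
with `a, c` and `b, d` independent, or it is tangent, spanned by `a ⊗ b` and `a ⊗ x + y ⊗ b`
(`kernel_form`).

Classification. Zero energy means being annihilated by every bond (`mem_nullSpace_iff`). The outer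
bonds of four qubits confine a ground state to `ker P ⊗ ker P`, and the middle bond imposes
coincidences among the directions `a, b, c, d` (`nullSpace_four_of_two_point`,
`nullSpace_four_of_tangent`). This yields the normal forms `OneProduct`, `TwoProducts`,
`AlternatingProducts`, `SingleExcitation`, phrased through `P` alone, or else `Case5`.

Dimension. Some functional `θ` on one qubit is injective on `ker P` when applied to the second
factor (`exists_separating`). Contracting the last qubit with `θ` embeds `𝒢_{n+1}` into `𝒢_n`, so
all dimensions are at most `dim 𝒢₁ = 2` and do not increase with `n`. Explicit product or
single-excitation states supply the lower bounds.

Gap. The chain is covered by overlapping blocks, and `K` is the sum of the projections onto the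
complements of the block ground spaces. If neighbouring block ground spaces are nearly orthogonal
modulo the common ground space (`AngleBound`), then `K² ≥ (1 - 2δ) K`
(`two_projections_anticommutator`, `sq_sum_projections`), while the Hamiltonian dominates a multiple
of `K`. Hence the gap is uniform (`gapped_of_angleBound`). The explicit ground states give the angle
bound: the relevant overlaps vanish or decay exponentially with the overlap region. In the
single-excitation case this needs `‖f‖ < 1`; reflection of the chain replaces `f` by `f⁻¹` and
covers `‖f‖ > 1`.

Gaplessness. For `‖f‖ = 1` the Hamiltonian acts on the states with one excitation as half the
Laplacian of a path, whose lowest non-constant mode has energy `1 - cos (π / n)`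
(`one_sub_cos_mem_energies`). -/

namespace QubitChain

/-! ### Operators acting on some of the qubits -/

section Embedding

variable {ι κ μ : Type*} [Fintype ι] [DecidableEq ι] [Fintype κ] [DecidableEq κ]
  [Fintype μ] [DecidableEq μ]

/-- The slice of `ψ` along the sites `e`, the other sites being frozen to the values in `x`. -/
noncomputable def slice (e : κ → ι) (ψ : (ι → Fin 2) → ℂ) (x : ι → Fin 2) : (κ → Fin 2) → ℂ :=
  fun w => ψ (Function.extend e w x)

/-- The operator acting as `M` on the sites `e` and as the identity elsewhere. -/
def embed (e : κ → ι) (M : Matrix (κ → Fin 2) (κ → Fin 2) ℂ) :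
    Matrix (ι → Fin 2) (ι → Fin 2) ℂ :=
  Matrix.of fun x y => if ∀ i, (∀ k, e k ≠ i) → x i = y i then M (x ∘ e) (y ∘ e) else 0

theorem extend_comp_self {e : κ → ι} (he : Function.Injective e) (w : κ → Fin 2)
    (x : ι → Fin 2) : Function.extend e w x ∘ e = w :=
  funext fun k => he.extend_apply w x k

theorem extend_extend {e : κ → ι} (he : Function.Injective e) (w w' : κ → Fin 2)
    (x : ι → Fin 2) :
    Function.extend e w (Function.extend e w' x) = Function.extend e w x := by
  funext i
  by_cases h : ∃ k, e k = i
  · obtain ⟨k, rfl⟩ := h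
    rw [he.extend_apply, he.extend_apply]
  · rw [Function.extend_apply' _ _ _ h, Function.extend_apply' _ _ _ h,
      Function.extend_apply' _ _ _ h]

theorem extend_self_comp {e : κ → ι} (he : Function.Injective e) (x : ι → Fin 2) :
    Function.extend e (x ∘ e) x = x := by
  funext i
  by_cases h : ∃ k, e k = i
  · obtain ⟨k, rfl⟩ := h
    rw [he.extend_apply]; rfl
  · rw [Function.extend_apply' _ _ _ h]

theorem extend_eq_of_agree {e : κ → ι} (he : Function.Injective e) {x y : ι → Fin 2}
    (h : ∀ i, (∀ k, e k ≠ i) → x i = y i) : Function.extend e (y ∘ e) x = y := by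
  funext i
  by_cases h' : ∃ k, e k = i
  · obtain ⟨k, rfl⟩ := h'
    rw [he.extend_apply]; rfl
  · rw [Function.extend_apply' _ _ _ h']
    exact h i (by simpa using h')

/-- The configurations that agree with `x` off the range of `e` are parametrized by their values on
that range. This turns a row of `embed e M` into a row of `M`. -/
theorem sum_ite_agree {e : κ → ι} (he : Function.Injective e) (x : ι → Fin 2)
    (F : (ι → Fin 2) → ℂ) :
    (∑ y, if ∀ i, (∀ k, e k ≠ i) → x i = y i then F y else 0)
      = ∑ w : κ → Fin 2, F (Function.extend e w x) := by
  rw [← Finset.sum_filter]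
  symm
  refine Finset.sum_bij' (fun w _ => Function.extend e w x) (fun y _ => y ∘ e) ?_ ?_ ?_ ?_ ?_
  · intro w _
    simp only [Finset.mem_filter, Finset.mem_univ, true_and]
    intro i hi
    rw [Function.extend_apply']
    simpa using hi
  · intro y _; exact Finset.mem_univ _
  · intro w _; exact extend_comp_self he w x
  · intro y hy
    simp only [Finset.mem_filter, Finset.mem_univ, true_and] at hy
    exact extend_eq_of_agree he hy
  · intro w _; rfl

theorem embed_mulVec {e : κ → ι} (he : Function.Injective e)
    (M : Matrix (κ → Fin 2) (κ → Fin 2) ℂ) (ψ : (ι → Fin 2) → ℂ) (x : ι → Fin 2) :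
    (embed e M *ᵥ ψ) x = (M *ᵥ slice e ψ x) (x ∘ e) := by
  simp only [Matrix.mulVec, dotProduct, embed, Matrix.of_apply, ite_mul, zero_mul]
  rw [sum_ite_agree he x (fun y => M (x ∘ e) (y ∘ e) * ψ y)]
  simp only [extend_comp_self he, slice]

theorem slice_extend {e : κ → ι} (he : Function.Injective e) (ψ : (ι → Fin 2) → ℂ)
    (w : κ → Fin 2) (x : ι → Fin 2) :
    slice e ψ (Function.extend e w x) = slice e ψ x := by
  funext w'
  simp only [slice, extend_extend he]

/-- Slicing intertwines `embed e M` with `M`; multiplicativity, kernels and positivity of embedded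
operators all rest on this. -/
theorem slice_embed_mulVec {e : κ → ι} (he : Function.Injective e)
    (M : Matrix (κ → Fin 2) (κ → Fin 2) ℂ) (ψ : (ι → Fin 2) → ℂ) (x : ι → Fin 2) :
    slice e (embed e M *ᵥ ψ) x = M *ᵥ slice e ψ x := by
  funext w
  rw [slice, embed_mulVec he, slice_extend he, extend_comp_self he]

theorem embed_mulVec_eq_zero_iff {e : κ → ι} (he : Function.Injective e)
    (M : Matrix (κ → Fin 2) (κ → Fin 2) ℂ) (ψ : (ι → Fin 2) → ℂ) :
    embed e M *ᵥ ψ = 0 ↔ ∀ x, M *ᵥ slice e ψ x = 0 := by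
  constructor
  · intro h x
    rw [← slice_embed_mulVec he, h]; rfl
  · intro h
    funext x
    rw [embed_mulVec he, h]; rfl

theorem embed_mul {e : κ → ι} (he : Function.Injective e)
    (M N : Matrix (κ → Fin 2) (κ → Fin 2) ℂ) : embed e (M * N) = embed e M * embed e N := by
  rw [Matrix.ext_iff_mulVec]
  intro ψ
  funext x
  rw [← Matrix.mulVec_mulVec, embed_mulVec he, embed_mulVec he, slice_embed_mulVec he,
    Matrix.mulVec_mulVec]

theorem embed_add (e : κ → ι) (M N : Matrix (κ → Fin 2) (κ → Fin 2) ℂ) :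
    embed e (M + N) = embed e M + embed e N := by
  ext x y
  simp only [embed, Matrix.of_apply, Matrix.add_apply]
  split_ifs <;> simp

theorem embed_sub (e : κ → ι) (M N : Matrix (κ → Fin 2) (κ → Fin 2) ℂ) :
    embed e (M - N) = embed e M - embed e N := by
  ext x y
  simp only [embed, Matrix.of_apply, Matrix.sub_apply]
  split_ifs <;> simp

theorem embed_smul (e : κ → ι) (c : ℝ) (M : Matrix (κ → Fin 2) (κ → Fin 2) ℂ) :
    embed e (c • M) = c • embed e M := by
  ext x y
  simp only [embed, Matrix.of_apply, Matrix.smul_apply]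
  split_ifs <;> simp

theorem embed_sum {α : Type*} (s : Finset α) (e : κ → ι)
    (M : α → Matrix (κ → Fin 2) (κ → Fin 2) ℂ) :
    embed e (∑ a ∈ s, M a) = ∑ a ∈ s, embed e (M a) := by
  classical
  induction s using Finset.induction_on with
  | empty => ext x y; simp [embed]
  | insert a s ha ih => rw [Finset.sum_insert ha, Finset.sum_insert ha, embed_add, ih]

theorem embed_conjTranspose (e : κ → ι) (M : Matrix (κ → Fin 2) (κ → Fin 2) ℂ) :
    embed e Mᴴ = (embed e M)ᴴ := by
  ext x y
  simp only [embed, Matrix.of_apply, Matrix.conjTranspose_apply]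
  have : (∀ i, (∀ k, e k ≠ i) → x i = y i) ↔ (∀ i, (∀ k, e k ≠ i) → y i = x i) :=
    forall_congr' fun i => forall_congr' fun _ => eq_comm
  simp only [this]
  split_ifs <;> simp

theorem embed_isStarProjection {e : κ → ι} (he : Function.Injective e)
    {M : Matrix (κ → Fin 2) (κ → Fin 2) ℂ} (hM : IsStarProjection M) :
    IsStarProjection (embed e M) where
  isIdempotentElem := by
    rw [IsIdempotentElem, ← embed_mul he, hM.isIdempotentElem.eq]
  isSelfAdjoint := by
    rw [IsSelfAdjoint, Matrix.star_eq_conjTranspose, ← embed_conjTranspose,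
      ← Matrix.star_eq_conjTranspose, hM.isSelfAdjoint.star_eq]

theorem embed_embed (e : κ → ι) (he : Function.Injective e) (e' : μ → κ)
    (M : Matrix (μ → Fin 2) (μ → Fin 2) ℂ) :
    embed e (embed e' M) = embed (e ∘ e') M := by
  ext x y
  simp only [embed, Matrix.of_apply, Function.comp_apply]
  rw [← ite_and]
  refine if_congr ?_ rfl rfl
  constructor
  · rintro ⟨h1, h2⟩ i hi
    by_cases h : ∃ k, e k = i
    · obtain ⟨k, rfl⟩ := h
      exact h2 k fun j hj => hi j (by rw [hj])
    · exact h1 i (by simpa using h)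
  · intro h
    exact ⟨fun i hi => h i fun k => hi _, fun k hk => h _ fun j hj => hk j (he hj)⟩

theorem embed_commute {e : κ → ι} (he : Function.Injective e) {e' : μ → ι}
    (he' : Function.Injective e') (hd : ∀ k j, e k ≠ e' j)
    (M : Matrix (κ → Fin 2) (κ → Fin 2) ℂ) (N : Matrix (μ → Fin 2) (μ → Fin 2) ℂ) :
    embed e M * embed e' N = embed e' N * embed e M := by
  have hext : ∀ (w : κ → Fin 2) (w' : μ → Fin 2) (x : ι → Fin 2),
      Function.extend e w (Function.extend e' w' x)
        = Function.extend e' w' (Function.extend e w x) := by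
    intro w w' x
    funext i
    by_cases h : ∃ k, e k = i
    · obtain ⟨k, rfl⟩ := h
      rw [he.extend_apply, Function.extend_apply' _ _ _ (by rintro ⟨j, hj⟩; exact hd k j hj.symm),
        he.extend_apply]
    · rw [Function.extend_apply' _ _ _ h]
      by_cases h' : ∃ k, e' k = i
      · obtain ⟨k, rfl⟩ := h'
        rw [he'.extend_apply, he'.extend_apply]
      · rw [Function.extend_apply' _ _ _ h', Function.extend_apply' _ _ _ h',
          Function.extend_apply' _ _ _ h]
  have h1 : ∀ (w : κ → Fin 2) (x : ι → Fin 2), Function.extend e w x ∘ e' = x ∘ e' := by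
    intro w x
    funext j
    exact Function.extend_apply' _ _ _ (by rintro ⟨k, hk⟩; exact hd k j hk)
  have h2 : ∀ (w : μ → Fin 2) (x : ι → Fin 2), Function.extend e' w x ∘ e = x ∘ e := by
    intro w x
    funext j
    exact Function.extend_apply' _ _ _ (by rintro ⟨k, hk⟩; exact hd j k hk.symm)
  rw [Matrix.ext_iff_mulVec]
  intro ψ
  funext x
  simp only [← Matrix.mulVec_mulVec]
  rw [embed_mulVec he, embed_mulVec he']
  have a1 : ∀ w, slice e (embed e' N *ᵥ ψ) x w
      = ∑ w', N (x ∘ e') w' * ψ (Function.extend e' w' (Function.extend e w x)) := by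
    intro w
    rw [slice, embed_mulVec he', h1]
    rfl
  have a2 : ∀ w, slice e' (embed e M *ᵥ ψ) x w
      = ∑ w', M (x ∘ e) w' * ψ (Function.extend e w' (Function.extend e' w x)) := by
    intro w
    rw [slice, embed_mulVec he, h2]
    rfl
  simp only [Matrix.mulVec, dotProduct] at a1 a2 ⊢
  simp only [a1, a2, Finset.mul_sum, hext]
  rw [Finset.sum_comm]
  exact Finset.sum_congr rfl fun _ _ => Finset.sum_congr rfl fun _ _ => by ring

/-- The map `(z, w) ↦ (extend e w z, z ∘ e)` exchanges the values of `z` along `e` with `w`. It is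
an involution, so each configuration is counted equally often. -/
theorem sum_sum_extend {e : κ → ι} (he : Function.Injective e) (F : (ι → Fin 2) → ℂ) :
    ∑ z : ι → Fin 2, ∑ w : κ → Fin 2, F (Function.extend e w z)
      = Fintype.card (κ → Fin 2) * ∑ x, F x := by
  have : ∑ p : (ι → Fin 2) × (κ → Fin 2), F (Function.extend e p.2 p.1)
      = ∑ p : (ι → Fin 2) × (κ → Fin 2), F p.1 := by
    refine Finset.sum_nbij' (fun p => (Function.extend e p.2 p.1, p.1 ∘ e))
      (fun p => (Function.extend e p.2 p.1, p.1 ∘ e)) (by simp) (by simp) ?_ ?_ (by simp)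
    · rintro ⟨z, w⟩ _
      simp [extend_comp_self he, extend_extend he, extend_self_comp he]
    · rintro ⟨z, w⟩ _
      simp [extend_comp_self he, extend_extend he, extend_self_comp he]
  rw [Fintype.sum_prod_type, Fintype.sum_prod_type] at this
  rw [this]
  simp [Finset.mul_sum]

/-- The real quadratic form of a matrix. -/
noncomputable def qf {X : Type*} [Fintype X] (A : Matrix X X ℂ) (ψ : X → ℂ) : ℝ := (star ψ ⬝ᵥ A *ᵥ ψ).re

/-- Up to the multiplicity from `sum_sum_extend`, the form of `embed e M` at `ψ` is the sum of the
forms of `M` at the slices of `ψ`. -/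
theorem qf_embed_nonneg {e : κ → ι} (he : Function.Injective e)
    {M : Matrix (κ → Fin 2) (κ → Fin 2) ℂ} (hM : ∀ φ, 0 ≤ qf M φ) (ψ : (ι → Fin 2) → ℂ) :
    0 ≤ qf (embed e M) ψ := by
  have h := sum_sum_extend he (fun x => star (ψ x) * (embed e M *ᵥ ψ) x)
  have h2 : ∀ z, ∑ w : κ → Fin 2, star (ψ (Function.extend e w z)) *
      (embed e M *ᵥ ψ) (Function.extend e w z)
      = star (slice e ψ z) ⬝ᵥ M *ᵥ slice e ψ z := by
    intro z
    refine Finset.sum_congr rfl fun w _ => ?_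
    rw [embed_mulVec he, slice_extend he, extend_comp_self he]
    rfl
  simp only [h2] at h
  have h3 : (∑ z, star (slice e ψ z) ⬝ᵥ M *ᵥ slice e ψ z).re
      = (Fintype.card (κ → Fin 2) : ℝ) * qf (embed e M) ψ := by
    rw [h, ← Complex.ofReal_natCast, Complex.re_ofReal_mul]
    rfl
  rw [Complex.re_sum] at h3
  have h4 : 0 ≤ (Fintype.card (κ → Fin 2) : ℝ) * qf (embed e M) ψ := by
    rw [← h3]; exact Finset.sum_nonneg fun z _ => hM _
  exact nonneg_of_mul_nonneg_right h4 (by exact_mod_cast Fintype.card_pos)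

end Embedding

theorem embed_onPair {m n : ℕ} (e : Fin m → Fin n) (he : Function.Injective e) (P : TwoQubitOp)
    (a b : Fin m) : embed e (onPair P a b) = onPair P (e a) (e b) := by
  ext x y
  have key : ((∀ i, (∀ k, e k ≠ i) → x i = y i) ∧
      ∀ k, k ≠ a → k ≠ b → x (e k) = y (e k)) ↔ ∀ k, k ≠ e a → k ≠ e b → x k = y k := by
    constructor
    · rintro ⟨h1, h2⟩ i hia hib
      by_cases h : ∃ k, e k = i
      · obtain ⟨k, rfl⟩ := h
        exact h2 k (fun h => hia (by rw [h])) (fun h => hib (by rw [h]))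
      · exact h1 i (by simpa using h)
    · intro h
      exact ⟨fun i hi => h i (fun h => hi a h.symm) (fun h => hi b h.symm),
        fun k hk hk' => h _ (fun h => hk (he h)) (fun h => hk' (he h))⟩
  simp only [embed, onPair, Matrix.of_apply, Function.comp_apply]
  by_cases h : ∀ k, k ≠ e a → k ≠ e b → x k = y k
  · rw [if_pos h, if_pos (key.2 h).1, if_pos (key.2 h).2]
  · rw [if_neg h]
    by_cases h1 : ∀ i, (∀ k, e k ≠ i) → x i = y i
    · rw [if_pos h1, if_neg fun h2 => h (key.1 ⟨h1, h2⟩)]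
    · rw [if_neg h1]

/-! ### Quadratic forms, orthogonal projections and spectral comparison -/

section Hilbert

variable {X : Type*} [Fintype X]

/-- The standard inner product of coordinate vectors. -/
def ip (φ χ : X → ℂ) : ℂ := star φ ⬝ᵥ χ

/-- The Euclidean norm of a coordinate vector. -/
noncomputable def nrm (φ : X → ℂ) : ℝ := ‖WithLp.toLp 2 φ‖

theorem ip_eq_inner (φ χ : X → ℂ) : ip φ χ = inner ℂ (WithLp.toLp 2 φ) (WithLp.toLp 2 χ) := by
  rw [EuclideanSpace.inner_toLp_toLp, ip, dotProduct_comm]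

theorem nrm_nonneg (φ : X → ℂ) : 0 ≤ nrm φ := norm_nonneg _

theorem ip_self (φ : X → ℂ) : ip φ φ = ((nrm φ ^ 2 : ℝ) : ℂ) := by
  rw [ip_eq_inner, inner_self_eq_norm_sq_to_K]; simp [nrm]

theorem norm_ip_le (φ χ : X → ℂ) : ‖ip φ χ‖ ≤ nrm φ * nrm χ := by
  rw [ip_eq_inner]; exact norm_inner_le_norm _ _

theorem star_ip (φ χ : X → ℂ) : star (ip φ χ) = ip χ φ := by
  rw [ip_eq_inner, ip_eq_inner]; exact inner_conj_symm _ _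

theorem ip_add_right (φ χ χ' : X → ℂ) : ip φ (χ + χ') = ip φ χ + ip φ χ' := dotProduct_add _ _ _

theorem ip_add_left (φ φ' χ : X → ℂ) : ip (φ + φ') χ = ip φ χ + ip φ' χ := by
  simp [ip, add_dotProduct]

theorem ip_sub_right (φ χ χ' : X → ℂ) : ip φ (χ - χ') = ip φ χ - ip φ χ' := dotProduct_sub _ _ _

theorem ip_sub_left (φ φ' χ : X → ℂ) : ip (φ - φ') χ = ip φ χ - ip φ' χ := by
  simp [ip, sub_dotProduct]

theorem ip_smul_right (c : ℂ) (φ χ : X → ℂ) : ip φ (c • χ) = c * ip φ χ := by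
  simp [ip, dotProduct_smul]

theorem ip_smul_left (c : ℂ) (φ χ : X → ℂ) : ip (c • φ) χ = star c * ip φ χ := by
  simp [ip, smul_dotProduct]

theorem ip_zero_left (φ : X → ℂ) : ip 0 φ = 0 := by simp [ip]

theorem ip_zero_right (φ : X → ℂ) : ip φ 0 = 0 := by simp [ip]

theorem nrm_eq_zero {φ : X → ℂ} : nrm φ = 0 ↔ φ = 0 := by
  rw [nrm, norm_eq_zero]; exact WithLp.toLp_eq_zero 2

theorem ip_mulVec_right (A : Matrix X X ℂ) (φ χ : X → ℂ) : ip φ (A *ᵥ χ) = ip (Aᴴ *ᵥ φ) χ := by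
  rw [ip, ip, Matrix.star_mulVec, Matrix.conjTranspose_conjTranspose, Matrix.dotProduct_mulVec]

theorem qf_eq (A : Matrix X X ℂ) (φ : X → ℂ) : qf A φ = (ip φ (A *ᵥ φ)).re := rfl

theorem qf_add (A B : Matrix X X ℂ) (φ : X → ℂ) : qf (A + B) φ = qf A φ + qf B φ := by
  simp only [qf_eq, Matrix.add_mulVec, ip_add_right, Complex.add_re]

theorem qf_sub (A B : Matrix X X ℂ) (φ : X → ℂ) : qf (A - B) φ = qf A φ - qf B φ := by
  simp only [qf_eq, Matrix.sub_mulVec, ip_sub_right, Complex.sub_re]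

theorem qf_smul (c : ℝ) (A : Matrix X X ℂ) (φ : X → ℂ) : qf (c • A) φ = c * qf A φ := by
  have : c • A = (c : ℂ) • A := by ext; simp
  rw [this, qf_eq, Matrix.smul_mulVec, ip_smul_right, Complex.re_ofReal_mul, qf_eq]

theorem qf_zero (φ : X → ℂ) : qf (0 : Matrix X X ℂ) φ = 0 := by
  simp [qf_eq, ip_zero_right]

theorem qf_sum {α : Type*} (s : Finset α) (A : α → Matrix X X ℂ) (φ : X → ℂ) :
    qf (∑ a ∈ s, A a) φ = ∑ a ∈ s, qf (A a) φ := by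
  classical
  induction s using Finset.induction_on with
  | empty => simp [qf_zero]
  | insert a s ha ih => rw [Finset.sum_insert ha, Finset.sum_insert ha, qf_add, ih]

theorem proj_conjTranspose {Q : Matrix X X ℂ} (hQ : IsStarProjection Q) : Qᴴ = Q :=
  hQ.isSelfAdjoint

theorem proj_mulVec_mulVec {Q : Matrix X X ℂ} (hQ : IsStarProjection Q) (φ : X → ℂ) :
    Q *ᵥ (Q *ᵥ φ) = Q *ᵥ φ := by
  rw [Matrix.mulVec_mulVec, hQ.isIdempotentElem.eq]

theorem qf_proj {Q : Matrix X X ℂ} (hQ : IsStarProjection Q) (φ : X → ℂ) :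
    qf Q φ = nrm (Q *ᵥ φ) ^ 2 := by
  have : ip φ (Q *ᵥ φ) = ip (Q *ᵥ φ) (Q *ᵥ φ) := by
    rw [ip_mulVec_right Q (Q *ᵥ φ), proj_conjTranspose hQ, proj_mulVec_mulVec hQ,
      ip_mulVec_right, proj_conjTranspose hQ]
  rw [qf_eq, this, ip_self, Complex.ofReal_re]

theorem qf_mul_of_isHermitian {A : Matrix X X ℂ} (hA : A.IsHermitian) (B : Matrix X X ℂ)
    (φ : X → ℂ) : qf (A * B) φ = (ip (A *ᵥ φ) (B *ᵥ φ)).re := by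
  rw [qf_eq, ← Matrix.mulVec_mulVec, ip_mulVec_right, hA]

theorem re_ip_comm (φ χ : X → ℂ) : (ip φ χ).re = (ip χ φ).re := by
  rw [← star_ip χ φ]; simp

theorem nrm_sq_eq_re (φ : X → ℂ) : nrm φ ^ 2 = (ip φ φ).re := by rw [ip_self, Complex.ofReal_re]

variable [DecidableEq X]

/-- Every subspace is the kernel of an orthogonal projection. -/
theorem exists_isStarProjection_ker (N : Submodule ℂ (X → ℂ)) :
    ∃ Q : Matrix X X ℂ, IsStarProjection Q ∧ ∀ v, Q *ᵥ v = 0 ↔ v ∈ N := by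
  let N' : Submodule ℂ (EuclideanSpace ℂ X) := N.comap (WithLp.linearEquiv 2 ℂ (X → ℂ)).toLinearMap
  let T := (Matrix.toEuclideanCLM (n := X) (𝕜 := ℂ))
  have hp : IsStarProjection (1 - N'.starProjection) := isStarProjection_starProjection.one_sub
  refine ⟨T.symm (1 - N'.starProjection), ⟨?_, ?_⟩, fun v => ?_⟩
  · rw [IsIdempotentElem, ← map_mul, hp.isIdempotentElem.eq]
  · rw [IsSelfAdjoint]
    refine (T.symm.map_star' _).symm.trans ?_
    change T.symm (star _) = _
    rw [hp.isSelfAdjoint.star_eq]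
  have h1 : WithLp.toLp 2 (T.symm (1 - N'.starProjection) *ᵥ v)
      = (1 - N'.starProjection) (WithLp.toLp 2 v) := by
    rw [← Matrix.toEuclideanCLM_toLp (𝕜 := ℂ)]
    change T (T.symm _) _ = _
    rw [StarAlgEquiv.apply_symm_apply]
  rw [← WithLp.toLp_eq_zero 2, h1]
  have : (1 - N'.starProjection) (WithLp.toLp 2 v)
      = WithLp.toLp 2 v - N'.starProjection (WithLp.toLp 2 v) := rfl
  rw [this, sub_eq_zero, eq_comm, Submodule.starProjection_eq_self_iff]
  rfl

theorem qf_eq_sum_eigenvalues {A : Matrix X X ℂ} (hA : A.IsHermitian) (ψ : X → ℂ) :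
    qf A ψ = ∑ i, hA.eigenvalues i * ‖ip (hA.eigenvectorBasis i).ofLp ψ‖ ^ 2 := by
  have h := hA.eigenvectorBasis.sum_inner_mul_inner (WithLp.toLp 2 ψ) (WithLp.toLp 2 (A *ᵥ ψ))
  rw [qf_eq, ip_eq_inner, ← h, Complex.re_sum]
  refine Finset.sum_congr rfl fun i _ => ?_
  have h1 : inner ℂ (hA.eigenvectorBasis i) (WithLp.toLp 2 (A *ᵥ ψ))
      = hA.eigenvalues i * ip (hA.eigenvectorBasis i).ofLp ψ := by
    change inner ℂ (WithLp.toLp 2 (hA.eigenvectorBasis i).ofLp) _ = _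
    rw [← ip_eq_inner, ip_mulVec_right, hA, hA.mulVec_eigenvectorBasis]
    change ip ((hA.eigenvalues i : ℝ) • _) _ = _
    have : (hA.eigenvalues i : ℝ) • (hA.eigenvectorBasis i).ofLp
      = (hA.eigenvalues i : ℂ) • (hA.eigenvectorBasis i).ofLp := by ext; simp
    rw [this, ip_smul_left]; simp
  have h2 : inner ℂ (WithLp.toLp 2 ψ) (hA.eigenvectorBasis i)
      = star (ip (hA.eigenvectorBasis i).ofLp ψ) := by
    rw [star_ip, ip_eq_inner]
  rw [h1, h2, mul_left_comm, Complex.re_ofReal_mul]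
  congr 1
  rw [Complex.star_def, ← Complex.normSq_eq_conj_mul_self, Complex.normSq_eq_norm_sq,
    Complex.ofReal_re]

theorem nrm_sq_eq_sum {A : Matrix X X ℂ} (hA : A.IsHermitian) (ψ : X → ℂ) :
    nrm ψ ^ 2 = ∑ i, ‖ip (hA.eigenvectorBasis i).ofLp ψ‖ ^ 2 := by
  rw [nrm, ← hA.eigenvectorBasis.sum_sq_norm_inner_right]
  exact Finset.sum_congr rfl fun i _ => by rw [ip_eq_inner]

theorem nrm_eigenvectorBasis {A : Matrix X X ℂ} (hA : A.IsHermitian) (i : X) :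
    nrm (hA.eigenvectorBasis i).ofLp = 1 := by
  simp [nrm]

theorem mulVec_eigenvectorBasis' {A : Matrix X X ℂ} (hA : A.IsHermitian) (i : X) :
    A *ᵥ (hA.eigenvectorBasis i).ofLp
      = (hA.eigenvalues i : ℂ) • (hA.eigenvectorBasis i).ofLp := by
  rw [hA.mulVec_eigenvectorBasis]; ext; simp

theorem qf_of_eigen {A : Matrix X X ℂ} {ψ : X → ℂ} {E : ℝ} (h : A *ᵥ ψ = (E : ℂ) • ψ) :
    qf A ψ = E * nrm ψ ^ 2 := by
  rw [qf_eq, h, ip_smul_right, ip_self, Complex.re_ofReal_mul, Complex.ofReal_re]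

/-- A positive operator is bounded below by a multiple of the projection onto the orthogonal
complement of its kernel. -/
theorem exists_pos_mul_le_qf {A Q : Matrix X X ℂ} (hA : A.IsHermitian)
    (hpos : ∀ φ, 0 ≤ qf A φ) (hQ : IsStarProjection Q)
    (hker : ∀ v, Q *ᵥ v = 0 ↔ A *ᵥ v = 0) :
    ∃ γ : ℝ, 0 < γ ∧ ∀ φ, γ * nrm (Q *ᵥ φ) ^ 2 ≤ qf A φ := by
  have hv := mulVec_eigenvectorBasis' hA
  have hnn : ∀ i, 0 ≤ hA.eigenvalues i := by
    intro i
    have := hpos (hA.eigenvectorBasis i).ofLp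
    rwa [qf_of_eigen (hv i), nrm_eigenvectorBasis, one_pow, mul_one] at this
  obtain ⟨γ, hγ, hle⟩ : ∃ γ : ℝ, 0 < γ ∧ ∀ i, hA.eigenvalues i ≠ 0 → γ ≤ hA.eigenvalues i := by
    by_cases hne : (Finset.univ.filter fun i => hA.eigenvalues i ≠ 0).Nonempty
    · obtain ⟨i, hi, hmin⟩ := Finset.exists_min_image _ hA.eigenvalues hne
      refine ⟨hA.eigenvalues i, lt_of_le_of_ne (hnn i) (Ne.symm (by simpa using hi)), ?_⟩
      intro j hj
      exact hmin j (by simpa using hj)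
    · refine ⟨1, one_pos, fun i hi => (hne ⟨i, by simpa using hi⟩).elim⟩
  refine ⟨γ, hγ, fun φ => ?_⟩
  -- Since `φ - Q φ` lies in the kernel of `A`, the form may be evaluated at `Q φ`, which has no
  -- component along eigenvectors of eigenvalue `0`.
  have hAQ : A *ᵥ (φ - Q *ᵥ φ) = 0 := by
    rw [← hker, Matrix.mulVec_sub, proj_mulVec_mulVec hQ, sub_self]
  have hAQ' : A *ᵥ φ = A *ᵥ (Q *ᵥ φ) := by
    rwa [Matrix.mulVec_sub, sub_eq_zero] at hAQ
  have hqf : qf A φ = qf A (Q *ᵥ φ) := by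
    rw [qf_eq, qf_eq, hAQ', ip_mulVec_right, hA, hAQ', ip_mulVec_right A (Q *ᵥ φ), hA]
  rw [hqf, qf_eq_sum_eigenvalues hA, nrm_sq_eq_sum hA, Finset.mul_sum]
  refine Finset.sum_le_sum fun i _ => ?_
  by_cases hi : hA.eigenvalues i = 0
  · have h0 : Q *ᵥ (hA.eigenvectorBasis i).ofLp = 0 := by
      rw [hker, hv, hi]; simp
    rw [ip_mulVec_right, proj_conjTranspose hQ, h0, ip_zero_left]
    simp
  · exact mul_le_mul_of_nonneg_right (hle i hi) (by positivity)

/-- Spectral gap of `H` from `K² ≥ c K` and `H ≥ γ K`. -/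
theorem le_eigenvalue_of_comparison {H K : Matrix X X ℂ} (hH : H.IsHermitian)
    (hK : K.IsHermitian) {c γ : ℝ} (hγ : 0 ≤ γ)
    (hpos : ∀ φ, 0 ≤ qf K φ) (hsq : ∀ φ, c * qf K φ ≤ nrm (K *ᵥ φ) ^ 2)
    (hle : ∀ φ, γ * qf K φ ≤ qf H φ) (hker : ∀ v, K *ᵥ v = 0 → H *ᵥ v = 0)
    {ψ : X → ℂ} (hψ : ψ ≠ 0) {E : ℝ} (hE : E ≠ 0) (hev : H *ᵥ ψ = (E : ℂ) • ψ) :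
    γ * c ≤ E := by
  have hv := mulVec_eigenvectorBasis' hK
  -- An eigenvector of `H` with `E ≠ 0` is orthogonal to the kernel of `H`, hence to that of `K`.
  -- Off its kernel the eigenvalues `k` of `K` satisfy `k² ≥ c k`, that is `k ≥ c`.
  have hperp : ∀ v, K *ᵥ v = 0 → ip v ψ = 0 := by
    intro v hvk
    have h1 : ip v (H *ᵥ ψ) = 0 := by
      rw [ip_mulVec_right, hH, hker v hvk, ip_zero_left]
    rw [hev, ip_smul_right] at h1
    exact (mul_eq_zero.1 h1).resolve_left (by exact_mod_cast hE)
  have key : c * nrm ψ ^ 2 ≤ qf K ψ := by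
    rw [qf_eq_sum_eigenvalues hK, nrm_sq_eq_sum hK, Finset.mul_sum]
    refine Finset.sum_le_sum fun i _ => ?_
    by_cases hi : hK.eigenvalues i = 0
    · rw [hperp _ (by rw [hv, hi]; simp)]
      simp
    · refine mul_le_mul_of_nonneg_right ?_ (by positivity)
      have h0 := hpos (hK.eigenvectorBasis i).ofLp
      have h1 := hsq (hK.eigenvectorBasis i).ofLp
      have h2 : nrm (K *ᵥ (hK.eigenvectorBasis i).ofLp) ^ 2 = hK.eigenvalues i ^ 2 := by
        have : ip (K *ᵥ (hK.eigenvectorBasis i).ofLp) (K *ᵥ (hK.eigenvectorBasis i).ofLp)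
            = ((hK.eigenvalues i ^ 2 : ℝ) : ℂ) := by
          rw [hv, ip_smul_left, ip_smul_right, ip_self, nrm_eigenvectorBasis]
          simp [sq]
        rw [ip_self] at this
        exact_mod_cast this
      rw [qf_of_eigen (hv i), nrm_eigenvectorBasis] at h0 h1
      rw [h2] at h1
      have hlt : 0 < hK.eigenvalues i := lt_of_le_of_ne (by linarith) (Ne.symm hi)
      nlinarith
  have h3 := hle ψ
  rw [qf_of_eigen hev] at h3
  have h4 : 0 < nrm ψ ^ 2 :=
    pow_pos (lt_of_le_of_ne (nrm_nonneg _) (fun h => hψ (nrm_eq_zero.1 h.symm))) 2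
  have h5 : γ * (c * nrm ψ ^ 2) ≤ E * nrm ψ ^ 2 :=
    (mul_le_mul_of_nonneg_left key hγ).trans h3
  exact le_of_mul_le_mul_right (by linarith) h4

/-- Two projections whose kernels meet at a large angle almost have a positive anticommutator. -/
theorem two_projections_anticommutator {Q₁ Q₂ : Matrix X X ℂ} (h₁ : IsStarProjection Q₁)
    (h₂ : IsStarProjection Q₂) {δ : ℝ} (hδ0 : 0 ≤ δ) (hδ1 : δ < 1)
    (hang : ∀ φ χ : X → ℂ, Q₁ *ᵥ φ = 0 → Q₂ *ᵥ χ = 0 →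
      (∀ g, Q₁ *ᵥ g = 0 → Q₂ *ᵥ g = 0 → ip g φ = 0) →
      (∀ g, Q₁ *ᵥ g = 0 → Q₂ *ᵥ g = 0 → ip g χ = 0) → ‖ip φ χ‖ ≤ δ * (nrm φ * nrm χ))
    (ψ : X → ℂ) : 0 ≤ qf (Q₁ * Q₂ + Q₂ * Q₁ + δ • (Q₁ + Q₂)) ψ := by
  obtain ⟨Q, hQ, hQker⟩ := exists_isStarProjection_ker
    (LinearMap.ker (Matrix.toLin' Q₁) ⊓ LinearMap.ker (Matrix.toLin' Q₂))
  simp only [Submodule.mem_inf, LinearMap.mem_ker, Matrix.toLin'_apply] at hQker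
  -- Removing the component in the common kernel changes neither `Q₁ ψ` nor `Q₂ ψ`. The projections
  -- `φ`, `χ` of the rest `η` onto the two kernels are then subject to the angle bound.
  set η := Q *ᵥ ψ with hη
  have hg : Q *ᵥ (ψ - η) = 0 := by
    rw [Matrix.mulVec_sub, hη, proj_mulVec_mulVec hQ, sub_self]
  have e₁ : Q₁ *ᵥ ψ = Q₁ *ᵥ η := by
    have := ((hQker _).1 hg).1; rwa [Matrix.mulVec_sub, sub_eq_zero] at this
  have e₂ : Q₂ *ᵥ ψ = Q₂ *ᵥ η := by
    have := ((hQker _).1 hg).2; rwa [Matrix.mulVec_sub, sub_eq_zero] at this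
  have hperp : ∀ g, Q₁ *ᵥ g = 0 → Q₂ *ᵥ g = 0 → ip g η = 0 := by
    intro g g1 g2
    rw [hη, ip_mulVec_right, proj_conjTranspose hQ, (hQker g).2 ⟨g1, g2⟩, ip_zero_left]
  set φ := η - Q₁ *ᵥ η with hφ
  set χ := η - Q₂ *ᵥ η with hχ
  have hφ0 : Q₁ *ᵥ φ = 0 := by rw [hφ, Matrix.mulVec_sub, proj_mulVec_mulVec h₁, sub_self]
  have hχ0 : Q₂ *ᵥ χ = 0 := by rw [hχ, Matrix.mulVec_sub, proj_mulVec_mulVec h₂, sub_self]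
  have hc := hang φ χ hφ0 hχ0
    (fun g g1 g2 => by
      rw [hφ, ip_sub_right, hperp g g1 g2, ip_mulVec_right, proj_conjTranspose h₁, g1,
        ip_zero_left, sub_zero])
    (fun g g1 g2 => by
      rw [hχ, ip_sub_right, hperp g g1 g2, ip_mulVec_right, proj_conjTranspose h₂, g2,
        ip_zero_left, sub_zero])
  have hηφ : (ip η φ).re = nrm φ ^ 2 := by
    have : ip (Q₁ *ᵥ η) φ = 0 := by
      rw [← proj_conjTranspose h₁, ← ip_mulVec_right, hφ0, ip_zero_right]
    rw [nrm_sq_eq_re]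
    conv_rhs => rw [hφ, ip_sub_left, ← hφ, this, sub_zero]
  have hηχ : (ip η χ).re = nrm χ ^ 2 := by
    have : ip (Q₂ *ᵥ η) χ = 0 := by
      rw [← proj_conjTranspose h₂, ← ip_mulVec_right, hχ0, ip_zero_right]
    rw [nrm_sq_eq_re]
    conv_rhs => rw [hχ, ip_sub_left, ← hχ, this, sub_zero]
  have hre : |(ip φ χ).re| ≤ δ * (nrm φ * nrm χ) := (Complex.abs_re_le_norm _).trans hc
  set N := nrm η ^ 2
  set x := nrm φ
  set y := nrm χ
  set c := (ip φ χ).re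
  have i1 : nrm (Q₁ *ᵥ η) ^ 2 = N - x ^ 2 := by
    have : Q₁ *ᵥ η = η - φ := by rw [hφ]; abel
    rw [nrm_sq_eq_re, this]
    simp only [ip_sub_left, ip_sub_right, Complex.sub_re]
    rw [re_ip_comm φ η, hηφ, ← nrm_sq_eq_re, ← nrm_sq_eq_re]; ring
  have i2 : nrm (Q₂ *ᵥ η) ^ 2 = N - y ^ 2 := by
    have : Q₂ *ᵥ η = η - χ := by rw [hχ]; abel
    rw [nrm_sq_eq_re, this]
    simp only [ip_sub_left, ip_sub_right, Complex.sub_re]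
    rw [re_ip_comm χ η, hηχ, ← nrm_sq_eq_re, ← nrm_sq_eq_re]; ring
  have i3 : (ip (Q₁ *ᵥ η) (Q₂ *ᵥ η)).re = N - x ^ 2 - y ^ 2 + c := by
    have t1 : Q₁ *ᵥ η = η - φ := by rw [hφ]; abel
    have t2 : Q₂ *ᵥ η = η - χ := by rw [hχ]; abel
    rw [t1, t2]
    simp only [ip_sub_left, ip_sub_right, Complex.sub_re]
    rw [re_ip_comm φ η, hηφ, hηχ, ← nrm_sq_eq_re]; ring
  have i4 : ∀ t : ℝ, 0 ≤ N - 2 * t * (x ^ 2 + y ^ 2) + t ^ 2 * (x ^ 2 + y ^ 2 + 2 * c) := by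
    intro t
    have h0 : 0 ≤ nrm (η - (t : ℂ) • (φ + χ)) ^ 2 := sq_nonneg _
    rw [nrm_sq_eq_re] at h0
    simp only [ip_sub_left, ip_sub_right, Complex.sub_re, ip_smul_left, ip_smul_right,
      ip_add_left, ip_add_right, Complex.star_def, Complex.conj_ofReal, Complex.re_ofReal_mul,
      Complex.add_re] at h0
    rw [re_ip_comm φ η, re_ip_comm χ η, re_ip_comm χ φ, hηφ, hηχ, ← nrm_sq_eq_re,
      ← nrm_sq_eq_re, ← nrm_sq_eq_re] at h0
    change 0 ≤ N - t * (x ^ 2 + y ^ 2) - t * (x ^ 2 - t * (x ^ 2 + c) +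
      (y ^ 2 - t * (c + y ^ 2))) at h0
    linarith
  have i5 : qf (Q₁ * Q₂ + Q₂ * Q₁ + δ • (Q₁ + Q₂)) ψ
      = 2 * (N - x ^ 2 - y ^ 2 + c) + δ * ((N - x ^ 2) + (N - y ^ 2)) := by
    rw [qf_add, qf_add, qf_smul, qf_add, qf_mul_of_isHermitian (proj_conjTranspose h₁),
      qf_mul_of_isHermitian (proj_conjTranspose h₂), qf_proj h₁, qf_proj h₂, e₁, e₂,
      re_ip_comm (Q₂ *ᵥ η), i1, i2, i3]
    ring
  rw [i5]
  -- With this `t`, the form in question times `1 + δ` (see `h8`) is exactly twice the right side of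
  -- `h5` plus that of `h7`.
  have h4 := i4 (1 / (1 + δ))
  have hd : 0 < 1 + δ := by linarith
  have h5 : 0 ≤ (1 + δ) ^ 2 * N - 2 * (1 + δ) * (x ^ 2 + y ^ 2) + (x ^ 2 + y ^ 2 + 2 * c) := by
    have := mul_nonneg (sq_nonneg (1 + δ)) h4
    have e : (1 + δ) ^ 2 * (N - 2 * (1 / (1 + δ)) * (x ^ 2 + y ^ 2)
        + (1 / (1 + δ)) ^ 2 * (x ^ 2 + y ^ 2 + 2 * c))
        = (1 + δ) ^ 2 * N - 2 * (1 + δ) * (x ^ 2 + y ^ 2) + (x ^ 2 + y ^ 2 + 2 * c) := by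
      field_simp
    rwa [e] at this
  have h6 : 2 * c ≤ δ * (x ^ 2 + y ^ 2) := by
    have := (abs_le.1 hre).2
    nlinarith [mul_nonneg hδ0 (sq_nonneg (x - y))]
  have h7 : 0 ≤ (1 - δ) * (δ * (x ^ 2 + y ^ 2) - 2 * c) :=
    mul_nonneg (by linarith) (by linarith)
  have h8 : 0 ≤ (1 + δ) * (2 * (N - x ^ 2 - y ^ 2 + c) + δ * ((N - x ^ 2) + (N - y ^ 2))) := by
    nlinarith
  exact nonneg_of_mul_nonneg_right h8 hd

end Hilbert

/-! ### Two-site terms, zero-energy states and energies of the chain -/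

theorem pair_injective {n : ℕ} {a b : Fin n} (hab : a ≠ b) : Function.Injective ![a, b] := by
  intro i j h
  fin_cases i <;> fin_cases j <;> simp_all [eq_comm]

theorem onPair_zero_one (P : TwoQubitOp) : onPair P (0 : Fin 2) 1
    = P.submatrix (finTwoArrowEquiv (Fin 2)) (finTwoArrowEquiv (Fin 2)) := by
  ext x y
  simp only [onPair, Matrix.of_apply, Matrix.submatrix_apply, finTwoArrowEquiv_apply]
  rw [if_pos (fun k h0 h1 => by fin_cases k <;> simp_all)]
  rfl

theorem onPair_eq_embed {n : ℕ} (P : TwoQubitOp) {a b : Fin n} (hab : a ≠ b) :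
    onPair P a b = embed ![a, b] (onPair P (0 : Fin 2) 1) := by
  rw [embed_onPair _ (pair_injective hab)]; rfl

theorem isStarProjection_onPair {n : ℕ} {P : TwoQubitOp} (hP : IsStarProjection P) {a b : Fin n}
    (hab : a ≠ b) : IsStarProjection (onPair P a b) := by
  rw [onPair_eq_embed P hab]
  refine embed_isStarProjection (pair_injective hab) ⟨?_, ?_⟩
  · rw [IsIdempotentElem, onPair_zero_one, Matrix.submatrix_mul_equiv, hP.isIdempotentElem.eq]
  · rw [IsSelfAdjoint, onPair_zero_one, Matrix.star_eq_conjTranspose,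
      Matrix.conjTranspose_submatrix, ← Matrix.star_eq_conjTranspose, hP.isSelfAdjoint.star_eq]

theorem extend_pair {n : ℕ} {a b : Fin n} (hab : a ≠ b) (w : Fin 2 → Fin 2) (x : Fin n → Fin 2) :
    Function.extend ![a, b] w x = Function.update (Function.update x a (w 0)) b (w 1) := by
  funext i
  by_cases hb : i = b
  · subst hb
    have := (pair_injective hab).extend_apply w x 1
    simpa using this
  · by_cases ha : i = a
    · subst ha
      have := (pair_injective hab).extend_apply w x 0
      simpa [hab] using this
    · rw [Function.extend_apply']
      · simp [ha, hb]
      · rintro ⟨k, hk⟩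
        fin_cases k
        · exact ha hk.symm
        · exact hb hk.symm

/-- The two-qubit vector obtained from `ψ` by freezing all qubits other than `a`, `b`. -/
def pairSlice {n : ℕ} (a b : Fin n) (ψ : Vec n) (x : Fin n → Fin 2) : Fin 2 × Fin 2 → ℂ :=
  fun s => ψ (Function.update (Function.update x a s.1) b s.2)

theorem onPair_mulVec {n : ℕ} (P : TwoQubitOp) {a b : Fin n} (hab : a ≠ b) (ψ : Vec n)
    (x : Fin n → Fin 2) : (onPair P a b *ᵥ ψ) x = (P *ᵥ pairSlice a b ψ x) (x a, x b) := by
  rw [onPair_eq_embed P hab, embed_mulVec (pair_injective hab), onPair_zero_one]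
  have h : slice ![a, b] ψ x = pairSlice a b ψ x ∘ finTwoArrowEquiv (Fin 2) := by
    funext w
    simp [slice, pairSlice, extend_pair hab]
  rw [h, Matrix.submatrix_mulVec_equiv, Function.comp_assoc, Equiv.self_comp_symm,
    Function.comp_id]
  rfl

theorem pairSlice_update {n : ℕ} {a b : Fin n} (hab : a ≠ b) (ψ : Vec n) (x : Fin n → Fin 2)
    (s t : Fin 2) :
    pairSlice a b ψ (Function.update (Function.update x a s) b t) = pairSlice a b ψ x := by
  funext r
  simp only [pairSlice]
  congr 1
  funext i
  by_cases hb : i = b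
  · subst hb; simp
  · by_cases ha : i = a
    · subst ha; simp [hb]
    · simp [ha, hb]

theorem onPair_mulVec_eq_zero_iff {n : ℕ} (P : TwoQubitOp) {a b : Fin n} (hab : a ≠ b)
    (ψ : Vec n) : onPair P a b *ᵥ ψ = 0 ↔ ∀ x, P *ᵥ pairSlice a b ψ x = 0 := by
  constructor
  · intro h x
    funext s
    have := congrFun h (Function.update (Function.update x a s.1) b s.2)
    rw [onPair_mulVec P hab, pairSlice_update hab] at this
    simpa [hab] using this
  · intro h
    funext x
    rw [onPair_mulVec P hab, h]; rfl

theorem site_ne_succ {n : ℕ} (j : Fin (n - 1)) :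
    (⟨j, by omega⟩ : Fin n) ≠ ⟨j + 1, by omega⟩ := by
  simp [Fin.ext_iff]

theorem isStarProjection_localTerm {P : TwoQubitOp} (hP : IsStarProjection P) (n : ℕ)
    (j : Fin (n - 1)) : IsStarProjection (localTerm P n j) :=
  isStarProjection_onPair hP (site_ne_succ j)

theorem localTerm_mulVec_eq_zero_iff (P : TwoQubitOp) {n : ℕ} (j : Fin (n - 1)) (ψ : Vec n) :
    localTerm P n j *ᵥ ψ = 0 ↔
      ∀ x, P *ᵥ pairSlice ⟨j, by omega⟩ ⟨j + 1, by omega⟩ ψ x = 0 :=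
  onPair_mulVec_eq_zero_iff P (site_ne_succ j) ψ

theorem isHermitian_hamiltonian {P : TwoQubitOp} (hP : IsStarProjection P) (n : ℕ) :
    (hamiltonian P n).IsHermitian := by
  rw [Matrix.IsHermitian, hamiltonian, Matrix.conjTranspose_sum]
  exact Finset.sum_congr rfl fun j _ => proj_conjTranspose (isStarProjection_localTerm hP n j)

theorem qf_hamiltonian {P : TwoQubitOp} (hP : IsStarProjection P) (n : ℕ) (ψ : Vec n) :
    qf (hamiltonian P n) ψ = ∑ j, nrm (localTerm P n j *ᵥ ψ) ^ 2 := by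
  rw [hamiltonian, qf_sum]
  exact Finset.sum_congr rfl fun j _ => qf_proj (isStarProjection_localTerm hP n j) ψ

theorem qf_hamiltonian_nonneg {P : TwoQubitOp} (hP : IsStarProjection P) (n : ℕ) (ψ : Vec n) :
    0 ≤ qf (hamiltonian P n) ψ := by
  rw [qf_hamiltonian hP]; exact Finset.sum_nonneg fun j _ => sq_nonneg _

theorem mem_nullSpace {P : TwoQubitOp} {n : ℕ} {ψ : Vec n} :
    ψ ∈ nullSpace P n ↔ hamiltonian P n *ᵥ ψ = 0 := by
  rw [nullSpace, LinearMap.mem_ker, Matrix.toLin'_apply]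

/-- The expectation of the Hamiltonian is a sum of squared norms of bond terms, so it vanishes only
if each of them does. Frustration-freeness therefore reduces to the existence of a zero-energy
state. -/
theorem mem_nullSpace_iff {P : TwoQubitOp} (hP : IsStarProjection P) {n : ℕ} {ψ : Vec n} :
    ψ ∈ nullSpace P n ↔ ∀ j, localTerm P n j *ᵥ ψ = 0 := by
  rw [mem_nullSpace]
  constructor
  · intro h j
    have h1 : qf (hamiltonian P n) ψ = 0 := by rw [qf_eq, h, ip_zero_right]; rfl
    rw [qf_hamiltonian hP, Finset.sum_eq_zero_iff_of_nonneg fun _ _ => sq_nonneg _] at h1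
    exact nrm_eq_zero.1 (pow_eq_zero_iff two_ne_zero |>.1 (h1 j (Finset.mem_univ _)))
  · intro h
    rw [hamiltonian, Matrix.sum_mulVec]
    exact Finset.sum_eq_zero fun j _ => h j

theorem mem_energies {P : TwoQubitOp} {n : ℕ} {E : ℝ} :
    E ∈ energies P n ↔ ∃ ψ : Vec n, ψ ≠ 0 ∧ hamiltonian P n *ᵥ ψ = (E : ℂ) • ψ := by
  constructor
  · intro h
    obtain ⟨ψ, h1⟩ := Module.End.HasEigenvalue.exists_hasEigenvector h
    exact ⟨ψ, h1.2, by simpa using h1.apply_eq_smul⟩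
  · rintro ⟨ψ, h0, h1⟩
    exact Module.End.hasEigenvalue_of_hasEigenvector (x := ψ)
      ⟨Module.End.mem_eigenspace_iff.2 (by simpa using h1), h0⟩

theorem nonneg_of_mem_energies {P : TwoQubitOp} (hP : IsStarProjection P) {n : ℕ} {E : ℝ}
    (hE : E ∈ energies P n) : 0 ≤ E := by
  obtain ⟨ψ, h0, h1⟩ := mem_energies.1 hE
  have h := qf_hamiltonian_nonneg hP n ψ
  rw [qf_of_eigen h1] at h
  have h4 : 0 < nrm ψ ^ 2 :=
    pow_pos (lt_of_le_of_ne (nrm_nonneg _) (fun h => h0 (nrm_eq_zero.1 h.symm))) 2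
  exact nonneg_of_mul_nonneg_left h h4

theorem zero_mem_energies_iff {P : TwoQubitOp} {n : ℕ} :
    0 ∈ energies P n ↔ nullSpace P n ≠ ⊥ := by
  rw [mem_energies, Submodule.ne_bot_iff]
  constructor
  · rintro ⟨ψ, h0, h1⟩
    exact ⟨ψ, mem_nullSpace.2 (by simpa using h1), h0⟩
  · rintro ⟨ψ, h0, h1⟩
    exact ⟨ψ, h1, by simpa using mem_nullSpace.1 h0⟩

theorem isLeast_energies_zero {P : TwoQubitOp} (hP : IsStarProjection P) {n : ℕ}
    (h : nullSpace P n ≠ ⊥) : IsLeast (energies P n) 0 :=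
  ⟨zero_mem_energies_iff.2 h, fun _ hE => nonneg_of_mem_energies hP hE⟩

theorem frustrationFree_iff {P : TwoQubitOp} (hP : IsStarProjection P) {n : ℕ} :
    FrustrationFree P n ↔ nullSpace P n ≠ ⊥ :=
  ⟨fun h => zero_mem_energies_iff.1 h.1.1,
    fun h => ⟨isLeast_energies_zero hP h, fun _ hv => (mem_nullSpace_iff hP).1 hv⟩⟩

theorem finite_energies (P : TwoQubitOp) (n : ℕ) : (energies P n).Finite := by
  have : {μ : ℂ | Module.End.HasEigenvalue (Matrix.toLin' (hamiltonian P n)) μ}.Finite :=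
    Module.End.finite_hasEigenvalue _
  exact this.preimage (Complex.ofReal_injective.injOn)

/-- The ground energy is `0`, a non-zero Hermitian matrix has a non-zero eigenvalue, and finitely
many energies have a least positive member. -/
theorem exists_isSpectralGap {P : TwoQubitOp} (hP : IsStarProjection P) {n : ℕ}
    (h0 : nullSpace P n ≠ ⊥) (h1 : nullSpace P n ≠ ⊤) :
    ∃ g, IsSpectralGap P n g ∧ 0 < g ∧ g ∈ energies P n ∧ ∀ E ∈ energies P n, 0 < E → g ≤ E := by
  have hH : hamiltonian P n ≠ 0 := by
    intro h
    apply h1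
    rw [eq_top_iff]
    intro v _
    rw [mem_nullSpace, h, Matrix.zero_mulVec]
  obtain ⟨v, t, ht, hv, hvt⟩ := (isHermitian_hamiltonian hP n).exists_eigenvector_of_ne_zero hH
  have hmem : t ∈ energies P n := mem_energies.2 ⟨v, hv, by rw [hvt]; ext; simp⟩
  have hpos : 0 < t := lt_of_le_of_ne (nonneg_of_mem_energies hP hmem) (Ne.symm ht)
  have hfin : {E | E ∈ energies P n ∧ 0 < E}.Finite :=
    (finite_energies P n).subset fun E hE => hE.1
  obtain ⟨g, hg, hgmin⟩ := hfin.exists_minimal ⟨t, hmem, hpos⟩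
  have hle : ∀ E ∈ energies P n, 0 < E → g ≤ E := fun E hE hE0 => by
    by_contra hlt
    exact hlt (hgmin ⟨hE, hE0⟩ (le_of_not_ge hlt))
  refine ⟨g, ⟨0, g, isLeast_energies_zero hP h0, ⟨hg, fun E hE => hle E hE.1 hE.2⟩, by ring⟩,
    hg.2, hg.1, hle⟩

theorem isSpectralGap_unique {P : TwoQubitOp} {n : ℕ} {g g' : ℝ} (h : IsSpectralGap P n g)
    (h' : IsSpectralGap P n g') : g = g' := by
  obtain ⟨a, b, h1, h2, rfl⟩ := h
  obtain ⟨a', b', h1', h2', rfl⟩ := h'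
  obtain rfl := h1.unique h1'
  rw [h2.unique h2']

/-! ### Restriction to blocks of consecutive qubits -/

section Blocks

/-- The inclusion of a block of `L` consecutive sites starting at the site `i`. -/
def blockEmb {L n : ℕ} (i : ℕ) (h : i + L ≤ n) (t : Fin L) : Fin n := ⟨i + t, by omega⟩

theorem blockEmb_injective {L n : ℕ} (i : ℕ) (h : i + L ≤ n) :
    Function.Injective (blockEmb (L := L) i h) := by
  intro s t hst
  simp only [blockEmb, Fin.ext_iff] at hst
  exact Fin.ext (by omega)

theorem embed_localTerm {L n : ℕ} (P : TwoQubitOp) (i : ℕ) (h : i + L ≤ n) (t : Fin (L - 1)) :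
    embed (blockEmb i h) (localTerm P L t) = localTerm P n ⟨i + t, by omega⟩ := by
  rw [localTerm, embed_onPair _ (blockEmb_injective i h)]
  rfl

theorem slice_mem_nullSpace {P : TwoQubitOp} (hP : IsStarProjection P) {L n : ℕ} (i : ℕ)
    (h : i + L ≤ n) {ψ : Vec n} (hψ : ψ ∈ nullSpace P n) (x : Fin n → Fin 2) :
    slice (blockEmb i h) ψ x ∈ nullSpace P L := by
  rw [mem_nullSpace_iff hP] at hψ ⊢
  intro t
  exact (embed_mulVec_eq_zero_iff (blockEmb_injective i h) _ ψ).1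
    (by rw [embed_localTerm]; exact hψ _) x

theorem nullSpace_eq_bot_of_le {P : TwoQubitOp} (hP : IsStarProjection P) {L n : ℕ} (h : L ≤ n)
    (hL : nullSpace P L = ⊥) : nullSpace P n = ⊥ := by
  rw [Submodule.eq_bot_iff]
  intro ψ hψ
  funext x
  have h0 : 0 + L ≤ n := by omega
  have h1 := slice_mem_nullSpace hP 0 h0 hψ x
  rw [hL, Submodule.mem_bot] at h1
  have h2 := congrFun h1 (x ∘ blockEmb 0 h0)
  rwa [slice, extend_self_comp (blockEmb_injective 0 h0)] at h2

end Blocks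

/-! ### Contraction of the last qubit bounds the dimension of the ground space -/

section Contraction

/-- Contraction of the last qubit with the functional `θ`. -/
def contractLast (θ : Qubit) (n : ℕ) : Vec (n + 1) →ₗ[ℂ] Vec n where
  toFun ψ := fun x => ∑ t, θ t * ψ (Fin.snoc (α := fun _ => Fin 2) x t)
  map_add' ψ χ := by
    funext x; simp [mul_add, Finset.sum_add_distrib]
  map_smul' c ψ := by
    funext x
    simp only [Pi.smul_apply, smul_eq_mul, RingHom.id_apply, Finset.mul_sum]
    exact Finset.sum_congr rfl fun _ _ => by ring

theorem update_snoc {n : ℕ} (x : Fin n → Fin 2) (t s : Fin 2) (i : Fin n) :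
    Function.update (Fin.snoc (α := fun _ => Fin 2) x t) i.castSucc s
      = Fin.snoc (α := fun _ => Fin 2) (Function.update x i s) t :=
  (Fin.snoc_update (α := fun _ => Fin 2) t x i s).symm

/-- The bonds among the first `n` qubits do not touch the last one, so the contraction commutes with
them. -/
theorem contractLast_mem {P : TwoQubitOp} (hP : IsStarProjection P) (θ : Qubit) {n : ℕ}
    {ψ : Vec (n + 1)} (hψ : ψ ∈ nullSpace P (n + 1)) : contractLast θ n ψ ∈ nullSpace P n := by
  rw [mem_nullSpace_iff hP] at hψ ⊢
  intro j
  rw [localTerm_mulVec_eq_zero_iff]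
  intro x
  have h := fun t => (localTerm_mulVec_eq_zero_iff P _ _).1 (hψ ⟨j, by omega⟩)
    (Fin.snoc (α := fun _ => Fin 2) x t)
  have e : pairSlice (⟨j, by omega⟩ : Fin n) ⟨j + 1, by omega⟩ (contractLast θ n ψ) x
      = ∑ t, θ t • pairSlice (⟨j, by omega⟩ : Fin (n + 1)) ⟨j + 1, by omega⟩ ψ
        (Fin.snoc (α := fun _ => Fin 2) x t) := by
    funext s
    rw [Finset.sum_apply]
    change ∑ t, θ t * ψ _ = _
    refine Finset.sum_congr rfl fun t _ => ?_
    rw [Pi.smul_apply, smul_eq_mul, pairSlice]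
    congr 2
    rw [← update_snoc, ← update_snoc]
    rfl
  rw [e, ← Matrix.mulVecLin_apply, map_sum]
  refine Finset.sum_eq_zero fun t _ => ?_
  rw [map_smul, Matrix.mulVecLin_apply, h t, smul_zero]

/-- `θ` separates the kernel of `P` when applied to the second qubit. -/
def Separating (P : TwoQubitOp) (θ : Qubit) : Prop :=
  ∀ s : Fin 2 × Fin 2 → ℂ, P *ᵥ s = 0 → (∀ i, ∑ j, θ j * s (i, j) = 0) → s = 0

/-- Every slice of `ψ` along the last bond lies in the kernel of `P`, and its contractions with `θ`
are entries of the contracted state. The condition `1 ≤ n` provides a last bond. -/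
theorem contractLast_injOn {P : TwoQubitOp} (hP : IsStarProjection P) {θ : Qubit}
    (hθ : Separating P θ) {n : ℕ} (hn : 1 ≤ n) {ψ : Vec (n + 1)}
    (hψ : ψ ∈ nullSpace P (n + 1)) (h0 : contractLast θ n ψ = 0) : ψ = 0 := by
  obtain ⟨m, rfl⟩ : ∃ m, n = m + 1 := ⟨n - 1, by omega⟩
  rw [mem_nullSpace_iff hP] at hψ
  have hlast := (localTerm_mulVec_eq_zero_iff P _ _).1 (hψ ⟨m, by omega⟩)
  funext x
  have key : ∀ i j, pairSlice (⟨m, by omega⟩ : Fin (m + 1 + 1)) ⟨m + 1, by omega⟩ ψ x (i, j)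
      = ψ (Fin.snoc (α := fun _ => Fin 2)
        (Function.update (Fin.init x) (Fin.last m) i) j) := by
    intro i j
    rw [pairSlice]
    congr 1
    conv_lhs => rw [← Fin.snoc_init_self x]
    have e1 : (⟨m, by omega⟩ : Fin (m + 1 + 1)) = (Fin.last m).castSucc := rfl
    have e2 : (⟨m + 1, by omega⟩ : Fin (m + 1 + 1)) = Fin.last (m + 1) := rfl
    rw [e1, e2, update_snoc, Fin.update_snoc_last]
  have hz := hθ _ (hlast x) (fun i => by
    simp only [key]
    exact congrFun h0 _)
  have := congrFun hz (x ⟨m, by omega⟩, x ⟨m + 1, by omega⟩)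
  simpa [pairSlice] using this

theorem finrank_nullSpace_succ_le {P : TwoQubitOp} (hP : IsStarProjection P) {θ : Qubit}
    (hθ : Separating P θ) {n : ℕ} (hn : 1 ≤ n) :
    Module.finrank ℂ (nullSpace P (n + 1)) ≤ Module.finrank ℂ (nullSpace P n) := by
  let T : nullSpace P (n + 1) →ₗ[ℂ] nullSpace P n :=
    (contractLast θ n).restrict fun ψ hψ => contractLast_mem hP θ hψ
  have hinj : Function.Injective T := by
    rw [← LinearMap.ker_eq_bot, Submodule.eq_bot_iff]
    rintro ⟨ψ, hψ⟩ h
    have h' : contractLast θ n ψ = 0 := congrArg Subtype.val h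
    exact Subtype.ext (contractLast_injOn hP hθ hn hψ h')
  exact LinearMap.finrank_le_finrank_of_injective hinj

theorem finrank_nullSpace_le_of_le {P : TwoQubitOp} (hP : IsStarProjection P) {θ : Qubit}
    (hθ : Separating P θ) {m n : ℕ} (hm : 1 ≤ m) (hmn : m ≤ n) :
    Module.finrank ℂ (nullSpace P n) ≤ Module.finrank ℂ (nullSpace P m) := by
  induction n, hmn using Nat.le_induction with
  | base => exact le_rfl
  | succ k hk ih => exact (finrank_nullSpace_succ_le hP hθ (hm.trans hk)).trans ih

/-- The contraction is iterated down to one qubit, where the whole space has dimension two. -/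
theorem finrank_nullSpace_le_two {P : TwoQubitOp} (hP : IsStarProjection P) {θ : Qubit}
    (hθ : Separating P θ) {n : ℕ} (hn : 1 ≤ n) : Module.finrank ℂ (nullSpace P n) ≤ 2 := by
  refine (finrank_nullSpace_le_of_le hP hθ le_rfl hn).trans ?_
  refine (Submodule.finrank_le _).trans ?_
  simp

theorem nullSpace_ne_top {P : TwoQubitOp} (hP : IsStarProjection P) {θ : Qubit}
    (hθ : Separating P θ) {n : ℕ} (hn : 2 ≤ n) : nullSpace P n ≠ ⊤ := by
  intro h
  have h1 := finrank_nullSpace_le_two hP hθ (by omega : 1 ≤ n)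
  rw [h, finrank_top, Module.finrank_fintype_fun_eq_card] at h1
  simp only [Fintype.card_fun, Fintype.card_fin] at h1
  have : 2 ^ 2 ≤ 2 ^ n := Nat.pow_le_pow_right (by norm_num) hn
  omega

end Contraction

/-! ### Uniform gap from overlapping blocks -/

/-- For a chain of projections in which only neighbours fail to commute, and neighbours have an
almost positive anticommutator, the sum `K` satisfies `K² ≥ (1 - 2δ) K`. -/
theorem sq_sum_projections {X : Type*} [Fintype X] {Q : ℕ → Matrix X X ℂ} {R : ℕ} {δ : ℝ}
    (hδ : 0 ≤ δ) (hQ : ∀ k < R, IsStarProjection (Q k))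
    (hadj : ∀ k, k + 1 < R → ∀ ψ, 0 ≤ qf (Q k * Q (k + 1) + Q (k + 1) * Q k
      + δ • (Q k + Q (k + 1))) ψ)
    (hcomm : ∀ k j, k + 2 ≤ j → j < R → Commute (Q k) (Q j)) (ψ : X → ℂ) :
    ∀ r, r < R → (1 - 2 * δ) * qf (∑ k ∈ Finset.range (r + 1), Q k) ψ + δ * qf (Q r) ψ
      ≤ qf ((∑ k ∈ Finset.range (r + 1), Q k) * ∑ k ∈ Finset.range (r + 1), Q k) ψ := by
  -- The summand `δ * qf (Q r) ψ` is a reserve: `Q r` has met only its left neighbour so far, and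
  -- the reserve pays for its share of the anticommutator with `Q (r + 1)`.
  intro r
  induction r with
  | zero =>
    intro h0
    simp only [zero_add, Finset.sum_range_one]
    rw [(hQ 0 h0).isIdempotentElem.eq]
    have h : 0 ≤ qf (Q 0) ψ := by rw [qf_proj (hQ 0 h0)]; exact sq_nonneg _
    nlinarith [mul_nonneg hδ h]
  | succ r ih =>
    intro hr
    have ih := ih (by omega)
    have hc : ∀ k ∈ Finset.range r, Commute (Q k) (Q (r + 1)) := fun k hk =>
      hcomm k (r + 1) (by have := Finset.mem_range.1 hk; omega) hr
    have hA := hadj r hr ψ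
    rw [qf_add, qf_smul, qf_add] at hA
    -- A product of commuting projections is again a projection, so distant pairs contribute
    -- non-negatively.
    have hpos : 0 ≤ qf ((∑ k ∈ Finset.range r, Q k) * Q (r + 1)) ψ := by
      rw [Finset.sum_mul, qf_sum]
      refine Finset.sum_nonneg fun k hk => ?_
      have hk' := Finset.mem_range.1 hk
      rw [qf_proj ((hQ k (by omega)).mul (hQ (r + 1) hr) (hc k hk))]
      exact sq_nonneg _
    have hcs : Q (r + 1) * (∑ k ∈ Finset.range r, Q k)
        = (∑ k ∈ Finset.range r, Q k) * Q (r + 1) := by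
      rw [Finset.mul_sum, Finset.sum_mul]
      exact Finset.sum_congr rfl fun k hk => (hc k hk).eq.symm
    set S := ∑ k ∈ Finset.range r, Q k with hS
    have e1 : ∑ k ∈ Finset.range (r + 1), Q k = S + Q r := Finset.sum_range_succ _ _
    have e2 : ∑ k ∈ Finset.range (r + 1 + 1), Q k = S + Q r + Q (r + 1) := by
      rw [Finset.sum_range_succ, e1]
    rw [e1] at ih
    rw [e2]
    have e3 : (S + Q r + Q (r + 1)) * (S + Q r + Q (r + 1))
        = (S + Q r) * (S + Q r) + (S * Q (r + 1) + S * Q (r + 1))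
          + (Q r * Q (r + 1) + Q (r + 1) * Q r) + Q (r + 1) := by
      have : (S + Q r + Q (r + 1)) * (S + Q r + Q (r + 1))
        = (S + Q r) * (S + Q r) + (S * Q (r + 1) + Q (r + 1) * S)
          + (Q r * Q (r + 1) + Q (r + 1) * Q r) + Q (r + 1) * Q (r + 1) := by
        noncomm_ring
      rw [this, hcs, (hQ (r + 1) hr).isIdempotentElem.eq]
    rw [e3]
    simp only [qf_add] at ih hA ⊢
    linarith

section Excited

variable {P : TwoQubitOp}

/-- The orthogonal projection onto the complement of the ground space of `L` qubits. -/
noncomputable def excited (P : TwoQubitOp) (L : ℕ) : Op L :=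
  Classical.choose (exists_isStarProjection_ker (nullSpace P L))

theorem isStarProjection_excited (P : TwoQubitOp) (L : ℕ) : IsStarProjection (excited P L) :=
  (Classical.choose_spec (exists_isStarProjection_ker (nullSpace P L))).1

theorem excited_mulVec_eq_zero_iff (P : TwoQubitOp) {L : ℕ} {v : Vec L} :
    excited P L *ᵥ v = 0 ↔ v ∈ nullSpace P L :=
  (Classical.choose_spec (exists_isStarProjection_ker (nullSpace P L))).2 v

/-- The ground spaces of two overlapping blocks, made of the first `p + m` and of the last `m + q`
qubits, are almost orthogonal modulo the common ground space. -/
def AngleBound (P : TwoQubitOp) (l : ℕ) (δ : ℝ) : Prop :=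
  ∀ p m q : ℕ, l ≤ p → l ≤ m → l ≤ q → ∀ φ χ : Vec (p + m + q),
    (∀ x, slice (blockEmb (L := p + m) 0 (by omega)) φ x ∈ nullSpace P (p + m)) →
    (∀ x, slice (blockEmb (L := m + q) p (by omega)) χ x ∈ nullSpace P (m + q)) →
    (∀ g ∈ nullSpace P (p + m + q), ip g φ = 0) →
    (∀ g ∈ nullSpace P (p + m + q), ip g χ = 0) →
    ‖ip φ χ‖ ≤ δ * (nrm φ * nrm χ)

/-- The operator `excited P L` acting on the block of `L` sites starting at `i`. -/
noncomputable def blockExcited (P : TwoQubitOp) (n i L : ℕ) : Op n :=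
  if h : i + L ≤ n then embed (blockEmb i h) (excited P L) else 0

theorem blockExcited_of_le (P : TwoQubitOp) {n i L : ℕ} (h : i + L ≤ n) :
    blockExcited P n i L = embed (blockEmb i h) (excited P L) := dif_pos h

theorem isStarProjection_blockExcited (P : TwoQubitOp) (n i L : ℕ) :
    IsStarProjection (blockExcited P n i L) := by
  by_cases h : i + L ≤ n
  · rw [blockExcited_of_le P h]
    exact embed_isStarProjection (blockEmb_injective i h) (isStarProjection_excited P L)
  · rw [blockExcited, dif_neg h]
    exact IsStarProjection.zero _

theorem blockExcited_commute (P : TwoQubitOp) (n : ℕ) {i L j M : ℕ} (hij : i + L ≤ j) :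
    Commute (blockExcited P n i L) (blockExcited P n j M) := by
  by_cases h : i + L ≤ n
  · by_cases h' : j + M ≤ n
    · rw [blockExcited_of_le P h, blockExcited_of_le P h']
      refine embed_commute (blockEmb_injective i h) (blockEmb_injective j h') ?_ _ _
      intro s t hst
      simp only [blockEmb, Fin.ext_iff] at hst
      omega
    · rw [blockExcited, blockExcited, dif_neg h']; exact Commute.zero_right _
  · rw [blockExcited, dif_neg h]; exact Commute.zero_left _

/-- Both blocks lie within `p + m + q` consecutive sites, where `two_projections_anticommutator`
applies; embedding preserves positivity of the form. -/
theorem blockExcited_anticommutator (hP : IsStarProjection P) {l : ℕ} {δ : ℝ} (hδ0 : 0 ≤ δ)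
    (hδ1 : δ < 1) (hang : AngleBound P l δ) {n i p m q : ℕ} (hp : l ≤ p) (hm : l ≤ m)
    (hq : l ≤ q) (hn : i + (p + m + q) ≤ n) (ψ : Vec n) :
    0 ≤ qf (blockExcited P n i (p + m) * blockExcited P n (i + p) (m + q)
      + blockExcited P n (i + p) (m + q) * blockExcited P n i (p + m)
      + δ • (blockExcited P n i (p + m) + blockExcited P n (i + p) (m + q))) ψ := by
  have h1 : 0 + (p + m) ≤ p + m + q := by omega
  have h2 : p + (m + q) ≤ p + m + q := by omega
  have hi := blockEmb_injective i hn
  have hb1 := blockEmb_injective 0 h1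
  have hb2 := blockEmb_injective p h2
  have e1 : blockExcited P n i (p + m)
      = embed (blockEmb i hn) (embed (blockEmb 0 h1) (excited P (p + m))) := by
    rw [blockExcited_of_le P (by omega), embed_embed _ hi]
    congr 1
    funext t
    simp [blockEmb]
  have e2 : blockExcited P n (i + p) (m + q)
      = embed (blockEmb i hn) (embed (blockEmb p h2) (excited P (m + q))) := by
    rw [blockExcited_of_le P (by omega), embed_embed _ hi]
    congr 1
    funext t
    simp [blockEmb, add_assoc]
  rw [e1, e2, ← embed_mul hi, ← embed_mul hi, ← embed_add, ← embed_add, ← embed_smul, ← embed_add]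
  refine qf_embed_nonneg hi (fun φ => ?_) ψ
  have hk1 : ∀ φ, embed (blockEmb 0 h1) (excited P (p + m)) *ᵥ φ = 0 ↔
      ∀ x, slice (blockEmb 0 h1) φ x ∈ nullSpace P (p + m) := fun φ => by
    simp only [embed_mulVec_eq_zero_iff hb1, excited_mulVec_eq_zero_iff]
  have hk2 : ∀ φ, embed (blockEmb p h2) (excited P (m + q)) *ᵥ φ = 0 ↔
      ∀ x, slice (blockEmb p h2) φ x ∈ nullSpace P (m + q) := fun φ => by
    simp only [embed_mulVec_eq_zero_iff hb2, excited_mulVec_eq_zero_iff]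
  refine two_projections_anticommutator
    (embed_isStarProjection hb1 (isStarProjection_excited P _))
    (embed_isStarProjection hb2 (isStarProjection_excited P _)) hδ0 hδ1 ?_ φ
  intro φ χ hφ hχ oφ oχ
  have hg : ∀ g ∈ nullSpace P (p + m + q), embed (blockEmb 0 h1) (excited P (p + m)) *ᵥ g = 0 ∧
      embed (blockEmb p h2) (excited P (m + q)) *ᵥ g = 0 := fun g hg =>
    ⟨(hk1 g).2 (slice_mem_nullSpace hP 0 h1 hg), (hk2 g).2 (slice_mem_nullSpace hP p h2 hg)⟩
  exact hang p m q hp hm hq φ χ ((hk1 φ).1 hφ) ((hk2 χ).1 hχ)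
    (fun g h => oφ g (hg g h).1 (hg g h).2) (fun g h => oχ g (hg g h).1 (hg g h).2)

/-- The energy of the `t`-th bond in the state `ψ`. -/
noncomputable def bondEnergy (P : TwoQubitOp) {n : ℕ} (ψ : Vec n) (t : ℕ) : ℝ :=
  if h : t < n - 1 then nrm (localTerm P n ⟨t, h⟩ *ᵥ ψ) ^ 2 else 0

theorem bondEnergy_nonneg (P : TwoQubitOp) {n : ℕ} (ψ : Vec n) (t : ℕ) :
    0 ≤ bondEnergy P ψ t := by
  rw [bondEnergy]; split_ifs
  · exact sq_nonneg _
  · exact le_rfl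

theorem qf_hamiltonian_eq_bondEnergy (hP : IsStarProjection P) {n : ℕ} (ψ : Vec n) :
    qf (hamiltonian P n) ψ = ∑ t ∈ Finset.range (n - 1), bondEnergy P ψ t := by
  rw [qf_hamiltonian hP, Finset.sum_range]
  exact Finset.sum_congr rfl fun j _ => by rw [bondEnergy, dif_pos j.2]

theorem qf_embed_hamiltonian (hP : IsStarProjection P) {n i L : ℕ} (h : i + L ≤ n)
    (ψ : Vec n) : qf (embed (blockEmb i h) (hamiltonian P L)) ψ
      = ∑ t ∈ Finset.range (L - 1), bondEnergy P ψ (i + t) := by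
  rw [hamiltonian, embed_sum, qf_sum, Finset.sum_range]
  refine Finset.sum_congr rfl fun j _ => ?_
  have hj : i + j < n - 1 := by omega
  rw [embed_localTerm, qf_proj (isStarProjection_localTerm hP _ _), bondEnergy, dif_pos hj]

/-- Each bond belongs to at most two of the blocks from `p k` to `p (k + 2)`. In terms of prefix
sums the left side telescopes, the middle value `S (p (k + 1))` being added and subtracted. -/
theorem sum_overlapping_blocks_le {h : ℕ → ℝ} (h0 : ∀ t, 0 ≤ h t) {p : ℕ → ℕ} {R N : ℕ}
    (hN : ∀ k ≤ R + 1, p k ≤ N) (hp : ∀ k < R, p k ≤ p (k + 2)) :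
    ∑ k ∈ Finset.range R, ∑ t ∈ Finset.range (p (k + 2) - p k), h (p k + t)
      ≤ 2 * ∑ t ∈ Finset.range N, h t := by
  set S : ℕ → ℝ := fun i => ∑ t ∈ Finset.range i, h t with hS
  have hmono : ∀ i, i ≤ N → S i ≤ S N := fun i hi =>
    Finset.sum_le_sum_of_subset_of_nonneg (Finset.range_mono hi) fun t _ _ => h0 t
  have hSn : ∀ i, 0 ≤ S i := fun i => Finset.sum_nonneg fun t _ => h0 t
  have hb : ∀ k ∈ Finset.range R, ∑ t ∈ Finset.range (p (k + 2) - p k), h (p k + t)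
      = (S (p (k + 2)) + S (p (k + 1))) - (S (p (k + 1)) + S (p k)) := by
    intro k hk
    have e : p (k + 2) = p k + (p (k + 2) - p k) := by
      have := hp k (Finset.mem_range.1 hk); omega
    have : S (p (k + 2)) = S (p k) + ∑ t ∈ Finset.range (p (k + 2) - p k), h (p k + t) := by
      conv_lhs => rw [e]
      exact Finset.sum_range_add _ _ _
    rw [this]; ring
  rw [Finset.sum_congr rfl hb, Finset.sum_range_sub fun k => S (p (k + 1)) + S (p k)]
  have := hmono _ (hN (R + 1) le_rfl)
  have := hmono _ (hN R (by omega))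
  linarith [hSn (p (0 + 1)), hSn (p 0)]

theorem exists_uniform_local_gap (hP : IsStarProjection P) (M : ℕ) :
    ∃ γ : ℝ, 0 < γ ∧ ∀ L ≤ M, ∀ φ : Vec L,
      γ * nrm (excited P L *ᵥ φ) ^ 2 ≤ qf (hamiltonian P L) φ := by
  have hone : ∀ L, ∃ γ : ℝ, 0 < γ ∧ ∀ φ : Vec L,
      γ * nrm (excited P L *ᵥ φ) ^ 2 ≤ qf (hamiltonian P L) φ := fun L =>
    exists_pos_mul_le_qf (isHermitian_hamiltonian hP L) (qf_hamiltonian_nonneg hP L)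
      (isStarProjection_excited P L) fun v => by
        rw [excited_mulVec_eq_zero_iff, mem_nullSpace]
  choose γ hγ hle using hone
  obtain ⟨L₀, -, hmin⟩ := Finset.exists_min_image (Finset.range (M + 1)) γ ⟨0, by simp⟩
  refine ⟨γ L₀, hγ L₀, fun L hL φ => le_trans ?_ (hle L φ)⟩
  exact mul_le_mul_of_nonneg_right (hmin L (by simpa using Nat.lt_succ_of_le hL)) (sq_nonneg _)

/-- The cut points `p k` are between `l` and `2 * l` apart and the `k`-th block runs from `p k` to
`p (k + 2)`. Neighbouring blocks share one interval, blocks with indices two or more apart are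
disjoint, and every block has at most `4 * l` sites. For the sum `K` of the block projections, `K² ≥
(1 - 2δ) K`, and `H ≥ (γ / 2) K`, where the factor `1 / 2` accounts for bonds lying in two blocks.
-/
theorem le_energy_of_blocks (hP : IsStarProjection P) {l : ℕ} (hl : 1 ≤ l) {δ : ℝ}
    (hδ0 : 0 ≤ δ) (hδ1 : δ < 1 / 2) (hang : AngleBound P l δ) {γ : ℝ} (hγ : 0 < γ)
    (hloc : ∀ L ≤ 4 * l, ∀ φ : Vec L,
      γ * nrm (excited P L *ᵥ φ) ^ 2 ≤ qf (hamiltonian P L) φ)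
    {n R : ℕ} {p : ℕ → ℕ} (hp0 : p 0 = 0) (hpn : p (R + 1) = n) (hR : 1 ≤ R)
    (hstep : ∀ k ≤ R, p k + l ≤ p (k + 1)) (hstep' : ∀ k ≤ R, p (k + 1) ≤ p k + 2 * l)
    {E : ℝ} (hE : E ∈ energies P n) (hE0 : 0 < E) : γ / 2 * (1 - 2 * δ) ≤ E := by
  have hmono : ∀ i j, i ≤ j → j ≤ R + 1 → p i ≤ p j := by
    intro i j hij
    induction j, hij using Nat.le_induction with
    | base => intro _; exact le_rfl
    | succ j hj ih => intro h; have := ih (by omega); have := hstep j (by omega); omega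
  set Q : ℕ → Op n := fun k => blockExcited P n (p k) (p (k + 2) - p k) with hQdef
  have hQ : ∀ k, IsStarProjection (Q k) := fun k => isStarProjection_blockExcited P n _ _
  have hfit : ∀ k < R, p k + (p (k + 2) - p k) ≤ n := by
    intro k hk
    have := hmono k (k + 2) (by omega) (by omega)
    have := hmono (k + 2) (R + 1) (by omega) le_rfl
    omega
  set K := ∑ k ∈ Finset.range R, Q k with hK
  have hKh : K.IsHermitian := by
    rw [Matrix.IsHermitian, hK, Matrix.conjTranspose_sum]
    exact Finset.sum_congr rfl fun k _ => proj_conjTranspose (hQ k)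
  have hqK : ∀ φ, qf K φ = ∑ k ∈ Finset.range R, nrm (Q k *ᵥ φ) ^ 2 := by
    intro φ
    rw [hK, qf_sum]
    exact Finset.sum_congr rfl fun k _ => qf_proj (hQ k) φ
  have hKpos : ∀ φ, 0 ≤ qf K φ := fun φ => by
    rw [hqK]; exact Finset.sum_nonneg fun _ _ => sq_nonneg _
  have hsq : ∀ φ, (1 - 2 * δ) * qf K φ ≤ nrm (K *ᵥ φ) ^ 2 := by
    intro φ
    have h := sq_sum_projections (Q := Q) (R := R) hδ0 (fun k _ => hQ k) ?_ ?_ φ (R - 1) (by omega)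
    · rw [show R - 1 + 1 = R by omega, ← hK, qf_mul_of_isHermitian hKh, ← nrm_sq_eq_re,
        qf_proj (hQ _)] at h
      have := mul_nonneg hδ0 (sq_nonneg (nrm (Q (R - 1) *ᵥ φ)))
      linarith
    · intro k hk ψ
      have s0 := hstep k (by omega)
      have s1 : p (k + 1) + l ≤ p (k + 2) := hstep (k + 1) (by omega)
      have s2 : p (k + 2) + l ≤ p (k + 3) := hstep (k + 2) (by omega)
      have s3 : p (k + 1) + (p (k + 3) - p (k + 1)) ≤ n := hfit (k + 1) hk
      have h := blockExcited_anticommutator hP hδ0 (by linarith) hang (n := n) (i := p k)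
        (p := p (k + 1) - p k) (m := p (k + 2) - p (k + 1)) (q := p (k + 3) - p (k + 2))
        (by omega) (by omega) (by omega) (by omega) ψ
      have e1 : p (k + 1) - p k + (p (k + 2) - p (k + 1)) = p (k + 2) - p k := by omega
      have e2 : p (k + 2) - p (k + 1) + (p (k + 3) - p (k + 2)) = p (k + 3) - p (k + 1) := by
        omega
      have e3 : p k + (p (k + 1) - p k) = p (k + 1) := by omega
      rw [e1, e2, e3] at h
      exact h
    · intro k j hkj hj
      refine blockExcited_commute P n ?_
      have := hmono k (k + 2) (by omega) (by omega)
      have := hmono (k + 2) j hkj (by omega)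
      omega
  have hle : ∀ φ, γ / 2 * qf K φ ≤ qf (hamiltonian P n) φ := by
    intro φ
    have hblock : ∀ k ∈ Finset.range R, γ * nrm (Q k *ᵥ φ) ^ 2
        ≤ ∑ t ∈ Finset.range (p (k + 2) - p k), bondEnergy P φ (p k + t) := by
      intro k hk
      have hk := Finset.mem_range.1 hk
      have hf := hfit k hk
      have s0 := hstep' k (by omega)
      have s1 : p (k + 2) ≤ p (k + 1) + 2 * l := hstep' (k + 1) (by omega)
      have h1 := qf_embed_nonneg (blockEmb_injective (p k) hf)
        (M := hamiltonian P (p (k + 2) - p k) - γ • excited P (p (k + 2) - p k)) (fun η => by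
          rw [qf_sub, qf_smul, qf_proj (isStarProjection_excited P _), sub_nonneg]
          exact hloc _ (by omega) η) φ
      rw [embed_sub, embed_smul, ← blockExcited_of_le, qf_sub, qf_smul, qf_proj (hQ k),
        qf_embed_hamiltonian hP, sub_nonneg] at h1
      refine h1.trans (Finset.sum_le_sum_of_subset_of_nonneg (Finset.range_mono (by omega)) ?_)
      exact fun t _ _ => bondEnergy_nonneg P φ _
    have h2 := sum_overlapping_blocks_le (bondEnergy_nonneg P φ) (p := p) (R := R) (N := n)
      (fun k hk => by have := hmono k (R + 1) hk le_rfl; omega)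
      (fun k hk => hmono k (k + 2) (by omega) (by omega))
    have h3 : ∑ t ∈ Finset.range n, bondEnergy P φ t = qf (hamiltonian P n) φ := by
      rw [qf_hamiltonian_eq_bondEnergy hP]
      refine (Finset.sum_subset (Finset.range_mono (by omega)) fun t _ ht => ?_).symm
      rw [bondEnergy, dif_neg (by simpa using ht)]
    have h4 := (Finset.sum_le_sum hblock).trans h2
    rw [← Finset.mul_sum, ← hqK, h3] at h4
    linarith
  have hker : ∀ v, K *ᵥ v = 0 → hamiltonian P n *ᵥ v = 0 := by
    intro v hv
    have h1 : qf K v = 0 := by rw [qf_eq, hv, ip_zero_right]; rfl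
    rw [hqK, Finset.sum_eq_zero_iff_of_nonneg fun _ _ => sq_nonneg _] at h1
    rw [← mem_nullSpace, mem_nullSpace_iff hP]
    rintro ⟨t, ht⟩
    -- The first block that ends beyond the site `t + 1` contains the bond `t`: by minimality it
    -- starts no later than `t`. So a vector annihilated by all block projections is annihilated by
    -- all bonds.
    have hex : ∃ k, t + 1 < p (k + 2) :=
      ⟨R - 1, by rw [show R - 1 + 2 = R + 1 by omega, hpn]; omega⟩
    classical
    let k := Nat.find hex
    have hk1 : t + 1 < p (k + 2) := Nat.find_spec hex
    have hkR : k ≤ R - 1 := Nat.find_min' hex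
      (by rw [show R - 1 + 2 = R + 1 by omega, hpn]; omega)
    have hk2 : p k ≤ t := by
      rcases Nat.eq_zero_or_pos k with h0 | h0
      · rw [h0, hp0]; omega
      · have h3 := Nat.find_min hex (m := k - 1) (by omega)
        have h4 := hstep k (by omega)
        rw [show k - 1 + 2 = k + 1 by omega] at h3
        omega
    have h5 : Q k *ᵥ v = 0 := nrm_eq_zero.1
      (pow_eq_zero_iff two_ne_zero |>.1 (h1 k (Finset.mem_range.2 (by omega))))
    have hf := hfit k (by omega)
    have h6 : ∀ x, slice (blockEmb (p k) hf) v x ∈ nullSpace P (p (k + 2) - p k) := by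
      intro x
      rw [← excited_mulVec_eq_zero_iff]
      refine (embed_mulVec_eq_zero_iff (blockEmb_injective _ hf) _ v).1 ?_ x
      rw [← blockExcited_of_le]
      exact h5
    have h7 := (embed_mulVec_eq_zero_iff (blockEmb_injective _ hf)
      (localTerm P (p (k + 2) - p k) ⟨t - p k, by omega⟩) v).2
        fun x => (mem_nullSpace_iff hP).1 (h6 x) _
    rw [embed_localTerm] at h7
    convert h7 using 4
    simp only
    omega
  obtain ⟨ψ, hψ, hev⟩ := mem_energies.1 hE
  exact le_eigenvalue_of_comparison (isHermitian_hamiltonian hP n) hKh (by positivity) hKpos hsq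
    hle hker hψ hE0.ne' hev

theorem gapped_of_angleBound (hP : IsStarProjection P) (hbot : ∀ n, 2 ≤ n → nullSpace P n ≠ ⊥)
    (htop : ∀ n, 2 ≤ n → nullSpace P n ≠ ⊤) {l : ℕ} (hl : 1 ≤ l) {δ : ℝ} (hδ0 : 0 ≤ δ)
    (hδ1 : δ < 1 / 2) (hang : AngleBound P l δ) : Gapped P := by
  obtain ⟨γ, hγ, hloc⟩ := exists_uniform_local_gap hP (4 * l)
  refine ⟨min γ (γ / 2 * (1 - 2 * δ)), lt_min hγ (mul_pos (by linarith) (by linarith)), ?_⟩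
  intro n hn
  obtain ⟨g, hg, hg0, hgmem, -⟩ := exists_isSpectralGap hP (hbot n hn) (htop n hn)
  refine ⟨g, hg, ?_⟩
  -- A short chain is a single block and has the local gap. A longer chain is cut at multiples of
  -- `l`, the last piece absorbing the remainder and so being shorter than `2 * l`.
  by_cases hnl : n < 2 * l
  · refine (min_le_left _ _).trans ?_
    obtain ⟨ψ, hψ, hev⟩ := mem_energies.1 hgmem
    have hex := isStarProjection_excited P n
    have h := le_eigenvalue_of_comparison (isHermitian_hamiltonian hP n) (proj_conjTranspose hex)
      (c := 1) hγ.le (fun φ => by rw [qf_proj hex]; exact sq_nonneg _)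
      (fun φ => by rw [qf_proj hex, one_mul])
      (fun φ => by rw [qf_proj hex]; exact hloc n (by omega) φ)
      (fun v hv => mem_nullSpace.1 ((excited_mulVec_eq_zero_iff P).1 hv)) hψ hg0.ne' hev
    linarith
  · refine (min_le_right _ _).trans ?_
    obtain ⟨q, r, hqr, hr⟩ : ∃ q r, n = q * l + r ∧ r < l :=
      ⟨n / l, n % l, by rw [Nat.div_add_mod' n l], Nat.mod_lt _ (by omega)⟩
    have hq : 2 ≤ q := by
      by_contra h
      have : q * l ≤ 1 * l := Nat.mul_le_mul_right l (by omega)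
      omega
    obtain ⟨R, rfl⟩ : ∃ R, q = R + 1 := ⟨q - 1, by omega⟩
    refine le_energy_of_blocks hP hl hδ0 hδ1 hang hγ hloc (R := R)
      (p := fun k => if k < R + 1 then k * l else n) (by simp) (by simp) (by omega) ?_ ?_ hgmem hg0
    · intro k hk
      have e : (k + 1) * l = k * l + l := by ring
      simp only [if_pos (show k < R + 1 by omega)]
      split_ifs with h
      · omega
      · obtain rfl : k = R := by omega
        omega
    · intro k hk
      have e : (k + 1) * l = k * l + l := by ring
      simp only [if_pos (show k < R + 1 by omega)]
      split_ifs with h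
      · omega
      · obtain rfl : k = R := by omega
        omega

end Excited

/-! ### Angle estimates for the three kinds of ground spaces -/

section Tensor

variable {X Y Z : Type*} [Fintype X] [Fintype Y] [Fintype Z]

/-- The elementary tensor of three coordinate vectors. -/
def tens (a : X → ℂ) (b : Y → ℂ) (c : Z → ℂ) : X × Y × Z → ℂ := fun t => a t.1 * b t.2.1 * c t.2.2

theorem ip_tens (a a' : X → ℂ) (b b' : Y → ℂ) (c c' : Z → ℂ) :
    ip (tens a b c) (tens a' b' c') = ip a a' * ip b b' * ip c c' := by
  simp only [ip, dotProduct, tens, Pi.star_apply, star_mul', Fintype.sum_prod_type]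
  rw [mul_assoc, Finset.sum_mul]
  refine Finset.sum_congr rfl fun x _ => ?_
  rw [Finset.sum_mul, Finset.mul_sum]
  refine Finset.sum_congr rfl fun y _ => ?_
  rw [Finset.mul_sum, Finset.mul_sum]
  exact Finset.sum_congr rfl fun z _ => by ring

theorem ip_self_of_nrm_one {a : X → ℂ} (h : nrm a = 1) : ip a a = 1 := by
  rw [ip_self, h]; simp

theorem norm_ip_comm (a b : X → ℂ) : ‖ip a b‖ = ‖ip b a‖ := by
  rw [← star_ip b a, norm_star]

/-- Orthogonality to the common ground state forces `u ⊥ a₃`, and `a₃` is a factor of the other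
vector. -/
theorem angle_of_one_product {a₁ : X → ℂ} {a₂ : Y → ℂ} {a₃ : Z → ℂ} (h₁ : nrm a₁ = 1)
    (h₂ : nrm a₂ = 1) (u : Z → ℂ) (r : X → ℂ)
    (ho : ip (tens a₁ a₂ a₃) (tens a₁ a₂ u) = 0) :
    ip (tens a₁ a₂ u) (tens r a₂ a₃) = 0 := by
  rw [ip_tens, ip_self_of_nrm_one h₁, ip_self_of_nrm_one h₂, one_mul, one_mul] at ho
  rw [ip_tens, ← star_ip a₃ u, ho]
  simp

theorem nrm_sq_add_ge {v w : X × Y × Z → ℂ} {A B ε : ℝ} (hA : nrm v = A) (hB : nrm w = B)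
    (hε : ‖ip v w‖ ≤ ε * (A * B)) (h0 : 0 ≤ ε) :
    (1 - ε) * (A ^ 2 + B ^ 2) ≤ nrm (v + w) ^ 2 := by
  rw [nrm_sq_eq_re]
  simp only [ip_add_left, ip_add_right, Complex.add_re]
  rw [re_ip_comm w v, ← nrm_sq_eq_re, ← nrm_sq_eq_re, hA, hB]
  have := (abs_le.1 ((Complex.abs_re_le_norm _).trans hε)).1
  nlinarith [sq_nonneg (A - B), mul_nonneg h0 (sq_nonneg (A - B))]

theorem nrm_tens (a : X → ℂ) (b : Y → ℂ) (c : Z → ℂ) :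
    nrm (tens a b c) = nrm a * nrm b * nrm c := by
  have h : nrm (tens a b c) ^ 2 = (nrm a * nrm b * nrm c) ^ 2 := by
    have := ip_tens a a b b c c
    rw [ip_self, ip_self, ip_self, ip_self] at this
    have h2 : nrm (tens a b c) ^ 2 = nrm a ^ 2 * nrm b ^ 2 * nrm c ^ 2 := by exact_mod_cast this
    rw [h2]; ring
  exact (sq_eq_sq₀ (nrm_nonneg _)
    (mul_nonneg (mul_nonneg (nrm_nonneg _) (nrm_nonneg _)) (nrm_nonneg _))).1 h

theorem norm_ip_le_one {a b : X → ℂ} (ha : nrm a = 1) (hb : nrm b = 1) : ‖ip a b‖ ≤ 1 := by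
  have := norm_ip_le a b
  rwa [ha, hb, one_mul] at this

/-- The orthogonality relations express each of `⟨v₃, u⟩`, `⟨w₃, u'⟩`, `⟨v₁, r⟩`, `⟨w₁, r'⟩` as a
multiple of the middle overlap (`c1` to `c4`). Each term of the inner product contains one of these
or the middle overlap itself. The two summands of either vector are nearly orthogonal, which bounds
`u, u', r, r'` by the norms of the sums. -/
theorem angle_of_two_products {v₁ w₁ : X → ℂ} {v₂ w₂ : Y → ℂ} {v₃ w₃ : Z → ℂ}
    (hv₁ : nrm v₁ = 1) (hw₁ : nrm w₁ = 1) (hv₂ : nrm v₂ = 1) (hw₂ : nrm w₂ = 1)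
    (hv₃ : nrm v₃ = 1) (hw₃ : nrm w₃ = 1) {ε : ℝ} (hε0 : 0 ≤ ε) (hε : ε ≤ 1 / 10)
    (hs : ‖ip v₂ w₂‖ ≤ ε) (u u' : Z → ℂ) (r r' : X → ℂ)
    (ov : ip (tens v₁ v₂ v₃) (tens v₁ v₂ u + tens w₁ w₂ u') = 0)
    (ow : ip (tens w₁ w₂ w₃) (tens v₁ v₂ u + tens w₁ w₂ u') = 0)
    (ov' : ip (tens v₁ v₂ v₃) (tens r v₂ v₃ + tens r' w₂ w₃) = 0)
    (ow' : ip (tens w₁ w₂ w₃) (tens r v₂ v₃ + tens r' w₂ w₃) = 0) :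
    ‖ip (tens v₁ v₂ u + tens w₁ w₂ u') (tens r v₂ v₃ + tens r' w₂ w₃)‖
      ≤ 1 / 4 * (nrm (tens v₁ v₂ u + tens w₁ w₂ u') * nrm (tens r v₂ v₃ + tens r' w₂ w₃)) := by
  have hs' : ‖ip w₂ v₂‖ ≤ ε := by rwa [norm_ip_comm]
  have b1 := norm_ip_le_one hv₁ hw₁
  have b1' := norm_ip_le_one hw₁ hv₁
  have b3 := norm_ip_le_one hv₃ hw₃
  have b3' := norm_ip_le_one hw₃ hv₃
  have small : ∀ {a b c : ℂ} {t : ℝ}, ‖a‖ ≤ 1 → ‖b‖ ≤ ε → ‖c‖ ≤ t → 0 ≤ t →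
      ‖a * b * c‖ ≤ ε * t := by
    intro a b c t ha hb hc ht
    rw [norm_mul, norm_mul]
    have h1 : ‖a‖ * ‖b‖ ≤ 1 * ε := mul_le_mul ha hb (norm_nonneg _) zero_le_one
    rw [one_mul] at h1
    exact mul_le_mul h1 hc (norm_nonneg _) hε0
  have lv (x : Z → ℂ) : ‖ip v₃ x‖ ≤ nrm x := by have := norm_ip_le v₃ x; rwa [hv₃, one_mul] at this
  have lw (x : Z → ℂ) : ‖ip w₃ x‖ ≤ nrm x := by have := norm_ip_le w₃ x; rwa [hw₃, one_mul] at this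
  have lv1 (x : X → ℂ) : ‖ip v₁ x‖ ≤ nrm x := by
    have := norm_ip_le v₁ x; rwa [hv₁, one_mul] at this
  have lw1 (x : X → ℂ) : ‖ip w₁ x‖ ≤ nrm x := by
    have := norm_ip_le w₁ x; rwa [hw₁, one_mul] at this
  have U := nrm_nonneg u
  have U' := nrm_nonneg u'
  have R := nrm_nonneg r
  have R' := nrm_nonneg r'
  rw [ip_add_right, ip_tens, ip_tens, ip_self_of_nrm_one hv₁, ip_self_of_nrm_one hv₂, one_mul,
    one_mul, add_eq_zero_iff_eq_neg] at ov
  have c1 : ‖ip v₃ u‖ ≤ ε * nrm u' := by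
    rw [ov, norm_neg]; exact small b1 hs (lv _) U'
  rw [ip_add_right, ip_tens, ip_tens, ip_self_of_nrm_one hw₁, ip_self_of_nrm_one hw₂, one_mul,
    one_mul, add_comm, add_eq_zero_iff_eq_neg] at ow
  have c2 : ‖ip w₃ u'‖ ≤ ε * nrm u := by
    rw [ow, norm_neg]; exact small b1' hs' (lw _) U
  rw [ip_add_right, ip_tens, ip_tens, ip_self_of_nrm_one hv₂, ip_self_of_nrm_one hv₃, mul_one,
    mul_one, add_eq_zero_iff_eq_neg] at ov'
  have c3 : ‖ip v₁ r‖ ≤ ε * nrm r' := by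
    rw [ov', norm_neg, show ip v₁ r' * ip v₂ w₂ * ip v₃ w₃ = ip v₃ w₃ * ip v₂ w₂ * ip v₁ r' by ring]
    exact small b3 hs (lv1 _) R'
  rw [ip_add_right, ip_tens, ip_tens, ip_self_of_nrm_one hw₂, ip_self_of_nrm_one hw₃, mul_one,
    mul_one, add_comm, add_eq_zero_iff_eq_neg] at ow'
  have c4 : ‖ip w₁ r'‖ ≤ ε * nrm r := by
    rw [ow', norm_neg, show ip w₁ r * ip w₂ v₂ * ip w₃ v₃ = ip w₃ v₃ * ip w₂ v₂ * ip w₁ r by ring]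
    exact small b3' hs' (lw1 _) R
  have mulb : ∀ {a b : ℂ} {s t : ℝ}, ‖a‖ ≤ s → ‖b‖ ≤ t → ‖a * b‖ ≤ s * t := by
    intro a b s t ha hb
    rw [norm_mul]
    exact mul_le_mul ha hb (norm_nonneg _) ((norm_nonneg _).trans ha)
  have main : ‖ip (tens v₁ v₂ u + tens w₁ w₂ u') (tens r v₂ v₃ + tens r' w₂ w₃)‖
      ≤ ε * ((nrm u + nrm u') * (nrm r + nrm r')) := by
    simp only [ip_add_left, ip_add_right, ip_tens]
    rw [ip_self_of_nrm_one hv₂, ip_self_of_nrm_one hw₂, mul_one, mul_one]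
    have d1 : ‖ip v₁ r * ip u v₃‖ ≤ ε * nrm r' * (ε * nrm u') :=
      mulb c3 (by rwa [norm_ip_comm])
    have d2 : ‖ip w₁ r * ip w₂ v₂ * ip u' v₃‖ ≤ nrm r * ε * nrm u' :=
      mulb (mulb (lw1 r) hs') (by rw [norm_ip_comm]; exact lv _)
    have d3 : ‖ip v₁ r' * ip v₂ w₂ * ip u w₃‖ ≤ nrm r' * ε * nrm u :=
      mulb (mulb (lv1 r') hs) (by rw [norm_ip_comm]; exact lw _)
    have d4 : ‖ip w₁ r' * ip u' w₃‖ ≤ ε * nrm r * (ε * nrm u) :=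
      mulb c4 (by rwa [norm_ip_comm])
    have n1 := norm_add_le (ip v₁ r * ip u v₃ + ip w₁ r * ip w₂ v₂ * ip u' v₃)
      (ip v₁ r' * ip v₂ w₂ * ip u w₃ + ip w₁ r' * ip u' w₃)
    have n2 := norm_add_le (ip v₁ r * ip u v₃) (ip w₁ r * ip w₂ v₂ * ip u' v₃)
    have n3 := norm_add_le (ip v₁ r' * ip v₂ w₂ * ip u w₃) (ip w₁ r' * ip u' w₃)
    have hεε : ε * ε ≤ ε := by nlinarith
    have f1 : ε * nrm r' * (ε * nrm u') ≤ ε * (nrm r' * nrm u') := by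
      calc ε * nrm r' * (ε * nrm u') = (ε * ε) * (nrm r' * nrm u') := by ring
        _ ≤ _ := mul_le_mul_of_nonneg_right hεε (by positivity)
    have f2 : ε * nrm r * (ε * nrm u) ≤ ε * (nrm r * nrm u) := by
      calc ε * nrm r * (ε * nrm u) = (ε * ε) * (nrm r * nrm u) := by ring
        _ ≤ _ := mul_le_mul_of_nonneg_right hεε (by positivity)
    linarith
  have hφ := nrm_sq_add_ge (v := tens v₁ v₂ u) (w := tens w₁ w₂ u') (A := nrm u) (B := nrm u')
    (ε := ε) (by rw [nrm_tens, hv₁, hv₂]; ring) (by rw [nrm_tens, hw₁, hw₂]; ring)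
    (by rw [ip_tens]; exact small b1 hs (norm_ip_le _ _) (by positivity)) hε0
  have hχ := nrm_sq_add_ge (v := tens r v₂ v₃) (w := tens r' w₂ w₃) (A := nrm r) (B := nrm r')
    (ε := ε) (by rw [nrm_tens, hv₃, hv₂]; ring) (by rw [nrm_tens, hw₃, hw₂]; ring)
    (by
      rw [ip_tens, show ip r r' * ip v₂ w₂ * ip v₃ w₃ = ip v₃ w₃ * ip v₂ w₂ * ip r r' by ring]
      exact small b3 hs (norm_ip_le _ _) (by positivity)) hε0
  refine main.trans ?_
  set φ := tens v₁ v₂ u + tens w₁ w₂ u'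
  set χ := tens r v₂ v₃ + tens r' w₂ w₃
  -- Here `(a + b)² ≤ 2 (a² + b²) ≤ (20 / 9) N² ≤ (3 / 2 · N)²`. In the end `1 / 10 · (3 / 2)² = 9 /
  -- 40 < 1 / 4`.
  have key : ∀ {a b N : ℝ}, 0 ≤ N → (1 - ε) * (a ^ 2 + b ^ 2) ≤ N ^ 2 → a + b ≤ 3 / 2 * N := by
    intro a b N hN h
    refine le_of_sq_le_sq ?_ (by positivity)
    nlinarith [sq_nonneg (a - b), sq_nonneg a, sq_nonneg b]
  have k1 := key (nrm_nonneg φ) hφ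
  have k2 := key (nrm_nonneg χ) hχ
  calc ε * ((nrm u + nrm u') * (nrm r + nrm r'))
      ≤ 1 / 10 * ((3 / 2 * nrm φ) * (3 / 2 * nrm χ)) := by
        refine mul_le_mul hε (mul_le_mul k1 k2 (by positivity) ?_) (by positivity) (by norm_num)
        exact mul_nonneg (by norm_num) (nrm_nonneg _)
    _ ≤ 1 / 4 * (nrm φ * nrm χ) := by
        have := mul_nonneg (nrm_nonneg φ) (nrm_nonneg χ)
        nlinarith

-- The shape comes from the splitting `W_{p+m} = W_p A_m + f^p A_p W_m` of the single-excitation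
-- state, with `fp = f^p` and `fm = f^m`. Orthogonality to the state without excitation gives `⟨u,
-- a₃⟩ = 0`, and orthogonality to the full excited state makes `⟨v, a₃⟩` of order `fm`. Every
-- remaining term of the inner product (`hval`) carries `fm` or `⟨v, a₃⟩`.
set_option maxHeartbeats 1000000 in
theorem angle_of_single_excitation {a₁ W₁ : X → ℂ} {a₂ W₂ : Y → ℂ} {a₃ W₃ : Z → ℂ}
    (h₁ : nrm a₁ = 1) (h₂ : nrm a₂ = 1) (h₃ : nrm a₃ = 1) (o₁ : ip a₁ W₁ = 0)
    (o₂ : ip a₂ W₂ = 0) (o₃ : ip a₃ W₃ = 0) {C ε : ℝ} (hC : 1 ≤ C) (hε0 : 0 ≤ ε)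
    (hε : 16 * C ^ 3 * ε ≤ 1 / 4) (l₁ : 1 ≤ nrm W₁) (u₁ : nrm W₁ ≤ C) (l₂ : 1 ≤ nrm W₂)
    (u₂ : nrm W₂ ≤ C) (u₃ : nrm W₃ ≤ C) {fp fm : ℂ} (hfp : ‖fp‖ ≤ 1) (hfm : ‖fm‖ ≤ ε)
    (u v : Z → ℂ) (w z : X → ℂ)
    (oa : ip (tens a₁ a₂ a₃) (tens a₁ a₂ u + (tens W₁ a₂ v + fp • tens a₁ W₂ v)) = 0)
    (oW : ip (tens W₁ a₂ a₃ + fp • tens a₁ W₂ a₃ + (fp * fm) • tens a₁ a₂ W₃)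
      (tens a₁ a₂ u + (tens W₁ a₂ v + fp • tens a₁ W₂ v)) = 0) :
    ‖ip (tens a₁ a₂ u + (tens W₁ a₂ v + fp • tens a₁ W₂ v))
        (tens w a₂ a₃ + (tens z W₂ a₃ + fm • tens z a₂ W₃))‖
      ≤ 1 / 4 * (nrm (tens a₁ a₂ u + (tens W₁ a₂ v + fp • tens a₁ W₂ v))
        * nrm (tens w a₂ a₃ + (tens z W₂ a₃ + fm • tens z a₂ W₃))) := by
  have o₁' : ip W₁ a₁ = 0 := by rw [← star_ip, o₁, star_zero]
  have o₂' : ip W₂ a₂ = 0 := by rw [← star_ip, o₂, star_zero]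
  have o₃' : ip W₃ a₃ = 0 := by rw [← star_ip, o₃, star_zero]
  have s₁ := ip_self_of_nrm_one h₁
  have s₂ := ip_self_of_nrm_one h₂
  have s₃ := ip_self_of_nrm_one h₃
  have U := nrm_nonneg u
  have V := nrm_nonneg v
  have W := nrm_nonneg w
  have Zn := nrm_nonneg z
  have mulb : ∀ {a b : ℂ} {s t : ℝ}, ‖a‖ ≤ s → ‖b‖ ≤ t → ‖a * b‖ ≤ s * t := by
    intro a b s t ha hb
    rw [norm_mul]
    exact mul_le_mul ha hb (norm_nonneg _) ((norm_nonneg _).trans ha)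
  have hua : ip u a₃ = 0 := by
    simp only [ip_add_right, ip_smul_right, ip_tens, s₁, s₂, o₁, o₂] at oa
    rw [← star_ip a₃ u]
    simpa using oa
  have hva : ‖ip v a₃‖ ≤ ε * (C * nrm u) := by
    simp only [ip_add_right, ip_add_left, ip_smul_left, ip_smul_right, ip_tens, s₁, s₂, o₁, o₂,
      o₁', o₂', ip_self W₁, ip_self W₂] at oW
    have e : ((nrm W₁ ^ 2 + ‖fp‖ ^ 2 * nrm W₂ ^ 2 : ℝ) : ℂ) * ip a₃ v
        = -(star fp * star fm * ip W₃ u) := by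
      have hf : star fp * fp = ((‖fp‖ ^ 2 : ℝ) : ℂ) := by
        rw [Complex.star_def, ← Complex.normSq_eq_conj_mul_self, Complex.normSq_eq_norm_sq]
      rw [Complex.ofReal_add, Complex.ofReal_mul, ← hf, eq_neg_iff_add_eq_zero, ← oW, star_mul']
      ring
    have e2 := congrArg norm e
    rw [norm_mul, norm_neg, Complex.norm_real, Real.norm_of_nonneg (by positivity)] at e2
    have e3 : ‖star fp * star fm * ip W₃ u‖ ≤ 1 * ε * (C * nrm u) :=
      mulb (mulb (by rwa [norm_star]) (by rwa [norm_star]))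
        ((norm_ip_le _ _).trans (mul_le_mul_of_nonneg_right u₃ U))
    rw [norm_ip_comm]
    have e4 : 1 * ‖ip a₃ v‖ ≤ (nrm W₁ ^ 2 + ‖fp‖ ^ 2 * nrm W₂ ^ 2) * ‖ip a₃ v‖ := by
      refine mul_le_mul_of_nonneg_right ?_ (norm_nonneg _)
      nlinarith [mul_nonneg (sq_nonneg ‖fp‖) (sq_nonneg (nrm W₂))]
    linarith
  have hφ : nrm u ^ 2 + nrm v ^ 2
      ≤ nrm (tens a₁ a₂ u + (tens W₁ a₂ v + fp • tens a₁ W₂ v)) ^ 2 := by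
    have e : ip (tens a₁ a₂ u + (tens W₁ a₂ v + fp • tens a₁ W₂ v))
        (tens a₁ a₂ u + (tens W₁ a₂ v + fp • tens a₁ W₂ v))
        = ((nrm u ^ 2 + (nrm W₁ ^ 2 + ‖fp‖ ^ 2 * nrm W₂ ^ 2) * nrm v ^ 2 : ℝ) : ℂ) := by
      have hf : star fp * fp = ((‖fp‖ ^ 2 : ℝ) : ℂ) := by
        rw [Complex.star_def, ← Complex.normSq_eq_conj_mul_self, Complex.normSq_eq_norm_sq]
      simp only [ip_add_right, ip_add_left, ip_smul_left, ip_smul_right, ip_tens, s₁, s₂, o₁, o₂,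
        o₁', o₂', ip_self W₁, ip_self W₂, ip_self u, ip_self v, Complex.ofReal_add, Complex.ofReal_mul, ← hf]
      ring
    rw [nrm_sq_eq_re (_ + _), e, Complex.ofReal_re]
    nlinarith [mul_nonneg (mul_nonneg (sq_nonneg ‖fp‖) (sq_nonneg (nrm W₂))) (sq_nonneg (nrm v)),
      mul_nonneg (sub_nonneg.2 (one_le_pow₀ l₁ (n := 2))) (sq_nonneg (nrm v))]
  have hχ : nrm w ^ 2 + nrm z ^ 2
      ≤ nrm (tens w a₂ a₃ + (tens z W₂ a₃ + fm • tens z a₂ W₃)) ^ 2 := by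
    have e : ip (tens w a₂ a₃ + (tens z W₂ a₃ + fm • tens z a₂ W₃))
        (tens w a₂ a₃ + (tens z W₂ a₃ + fm • tens z a₂ W₃))
        = ((nrm w ^ 2 + (nrm W₂ ^ 2 + ‖fm‖ ^ 2 * nrm W₃ ^ 2) * nrm z ^ 2 : ℝ) : ℂ) := by
      have hf : star fm * fm = ((‖fm‖ ^ 2 : ℝ) : ℂ) := by
        rw [Complex.star_def, ← Complex.normSq_eq_conj_mul_self, Complex.normSq_eq_norm_sq]
      simp only [ip_add_right, ip_add_left, ip_smul_left, ip_smul_right, ip_tens, s₃, s₂, o₃, o₂,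
        o₃', o₂', ip_self W₂, ip_self W₃, ip_self w, ip_self z, Complex.ofReal_add, Complex.ofReal_mul, ← hf]
      ring
    rw [nrm_sq_eq_re (_ + _), e, Complex.ofReal_re]
    nlinarith [mul_nonneg (mul_nonneg (sq_nonneg ‖fm‖) (sq_nonneg (nrm W₃))) (sq_nonneg (nrm z)),
      mul_nonneg (sub_nonneg.2 (one_le_pow₀ l₂ (n := 2))) (sq_nonneg (nrm z))]
  have bnd : ∀ {a b N : ℝ}, 0 ≤ N → a ^ 2 + b ^ 2 ≤ N ^ 2 → a ≤ N ∧ b ≤ N := by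
    intro a b N hN h
    constructor
    · exact le_of_sq_le_sq (by nlinarith [sq_nonneg b]) hN
    · exact le_of_sq_le_sq (by nlinarith [sq_nonneg a]) hN
  set φ := tens a₁ a₂ u + (tens W₁ a₂ v + fp • tens a₁ W₂ v) with hφd
  set χ := tens w a₂ a₃ + (tens z W₂ a₃ + fm • tens z a₂ W₃) with hχd
  obtain ⟨bu, bv⟩ := bnd (nrm_nonneg φ) hφ
  obtain ⟨bw, bz⟩ := bnd (nrm_nonneg χ) hχ
  have hval : ip φ χ = fm * (ip a₁ z * ip u W₃) + ip W₁ w * ip v a₃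
      + fm * (ip W₁ z * ip v W₃) + star fp * (((nrm W₂ ^ 2 : ℝ) : ℂ) * (ip a₁ z * ip v a₃)) := by
    rw [hφd, hχd]
    simp only [ip_add_right, ip_add_left, ip_smul_left, ip_smul_right, ip_tens, s₂, o₂, o₂',
      ip_self W₂, hua]
    ring
  clear_value φ χ
  have Φ := nrm_nonneg φ
  have Χ := nrm_nonneg χ
  have C0 : 0 ≤ C := by linarith
  have CW : nrm W₂ ^ 2 ≤ C ^ 2 := pow_le_pow_left₀ (nrm_nonneg _) u₂ 2
  have la : ∀ x : X → ℂ, nrm x ≤ nrm χ → ‖ip a₁ x‖ ≤ nrm χ := fun x hx => by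
    have := norm_ip_le a₁ x; rw [h₁, one_mul] at this; exact this.trans hx
  have lW : ∀ x : X → ℂ, nrm x ≤ nrm χ → ‖ip W₁ x‖ ≤ C * nrm χ := fun x hx =>
    (norm_ip_le W₁ x).trans (mul_le_mul u₁ hx (nrm_nonneg _) C0)
  have lr : ∀ x : Z → ℂ, nrm x ≤ nrm φ → ‖ip x W₃‖ ≤ nrm φ * C := fun x hx =>
    (norm_ip_le x W₃).trans (mul_le_mul hx u₃ (nrm_nonneg _) Φ)
  have hva' : ‖ip v a₃‖ ≤ ε * (C * nrm φ) :=
    hva.trans (mul_le_mul_of_nonneg_left (mul_le_mul_of_nonneg_left bu C0) hε0)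
  have t1 : ‖fm * (ip a₁ z * ip u W₃)‖ ≤ ε * (nrm χ * (nrm φ * C)) :=
    mulb hfm (mulb (la z bz) (lr u bu))
  have t2 : ‖ip W₁ w * ip v a₃‖ ≤ C * nrm χ * (ε * (C * nrm φ)) := mulb (lW w bw) hva'
  have t3 : ‖fm * (ip W₁ z * ip v W₃)‖ ≤ ε * (C * nrm χ * (nrm φ * C)) :=
    mulb hfm (mulb (lW z bz) (lr v bv))
  have t4 : ‖star fp * (((nrm W₂ ^ 2 : ℝ) : ℂ) * (ip a₁ z * ip v a₃))‖
      ≤ 1 * (C ^ 2 * (nrm χ * (ε * (C * nrm φ)))) := by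
    refine mulb (by rwa [norm_star]) (mulb ?_ (mulb (la z bz) hva'))
    rw [Complex.norm_real, Real.norm_of_nonneg (sq_nonneg _)]
    exact CW
  have n1 := norm_add_le (fm * (ip a₁ z * ip u W₃) + ip W₁ w * ip v a₃
      + fm * (ip W₁ z * ip v W₃)) (star fp * (((nrm W₂ ^ 2 : ℝ) : ℂ) * (ip a₁ z * ip v a₃)))
  have n2 := norm_add_le (fm * (ip a₁ z * ip u W₃) + ip W₁ w * ip v a₃)
    (fm * (ip W₁ z * ip v W₃))
  have n3 := norm_add_le (fm * (ip a₁ z * ip u W₃)) (ip W₁ w * ip v a₃)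
  rw [hval]
  have T := mul_nonneg Φ Χ
  -- The four bounds sum to `(C + 2C² + C³) ε`, for which `16 C³ ε` is a generous majorant.
  have total : ε * (nrm χ * (nrm φ * C)) + C * nrm χ * (ε * (C * nrm φ))
      + ε * (C * nrm χ * (nrm φ * C)) + 1 * (C ^ 2 * (nrm χ * (ε * (C * nrm φ))))
      = (C + 2 * C ^ 2 + C ^ 3) * ε * (nrm φ * nrm χ) := by ring
  have hC3 : C + 2 * C ^ 2 + C ^ 3 ≤ 16 * C ^ 3 := by
    have c2 : C ^ 2 ≤ C ^ 3 := pow_le_pow_right₀ hC (by norm_num)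
    have c1 : C ≤ C ^ 2 := by nlinarith
    nlinarith
  have fin : (C + 2 * C ^ 2 + C ^ 3) * ε * (nrm φ * nrm χ) ≤ 1 / 4 * (nrm φ * nrm χ) :=
    mul_le_mul_of_nonneg_right ((mul_le_mul_of_nonneg_right hC3 hε0).trans hε) T
  linarith

end Tensor

/-! ### Product states and single-excitation states -/

/-- The two-qubit product vector `a ⊗ b`. -/
def tp (a b : Qubit) : Fin 2 × Fin 2 → ℂ := fun s => a s.1 * b s.2

/-- The amplitude of a product vector on the sites other than `a`, `b`. -/
def restProd {n : ℕ} (a b : Fin n) (v : Fin n → Qubit) (x : Fin n → Fin 2) : ℂ :=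
  ∏ i ∈ (Finset.univ.erase a).erase b, v i (x i)

theorem prodState_eq_restProd {n : ℕ} {a b : Fin n} (hab : a ≠ b) (v : Fin n → Qubit)
    (x : Fin n → Fin 2) : prodState v x = restProd a b v x * tp (v a) (v b) (x a, x b) := by
  rw [prodState, ← Finset.mul_prod_erase _ _ (Finset.mem_univ a),
    ← Finset.mul_prod_erase _ _ (Finset.mem_erase.2 ⟨hab.symm, Finset.mem_univ b⟩), restProd, tp]
  ring

theorem restProd_congr {n : ℕ} {a b : Fin n} {v w : Fin n → Qubit} {x y : Fin n → Fin 2}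
    (hv : ∀ i, i ≠ a → i ≠ b → v i = w i) (hx : ∀ i, i ≠ a → i ≠ b → x i = y i) :
    restProd a b v x = restProd a b w y := by
  refine Finset.prod_congr rfl fun i hi => ?_
  simp only [Finset.mem_erase, Finset.mem_univ, and_true] at hi
  rw [hv i hi.2 hi.1, hx i hi.2 hi.1]

theorem onPair_mulVec_prodState {n : ℕ} (P : TwoQubitOp) {a b : Fin n} (hab : a ≠ b)
    (v : Fin n → Qubit) (x : Fin n → Fin 2) :
    (onPair P a b *ᵥ prodState v) x
      = restProd a b v x * (P *ᵥ tp (v a) (v b)) (x a, x b) := by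
  rw [onPair_mulVec P hab]
  have : pairSlice a b (prodState v) x = restProd a b v x • tp (v a) (v b) := by
    funext s
    rw [pairSlice, prodState_eq_restProd hab, Pi.smul_apply, smul_eq_mul,
      restProd_congr (w := v) (y := x) (fun _ _ _ => rfl)
        (fun i ha hb => by rw [Function.update_of_ne hb, Function.update_of_ne ha])]
    simp [hab]
  rw [this, Matrix.mulVec_smul]; rfl

theorem prodState_mem_nullSpace {P : TwoQubitOp} (hP : IsStarProjection P) {n : ℕ}
    {v : Fin n → Qubit}
    (h : ∀ j : Fin (n - 1), P *ᵥ tp (v ⟨j, by omega⟩) (v ⟨j + 1, by omega⟩) = 0) :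
    prodState v ∈ nullSpace P n := by
  rw [mem_nullSpace_iff hP]
  intro j
  funext x
  rw [localTerm, onPair_mulVec_prodState P (site_ne_succ j), h j]
  simp

theorem ip_prodState {n : ℕ} (v w : Fin n → Qubit) :
    ip (prodState v) (prodState w) = ∏ i, ip (v i) (w i) := by
  simp only [ip, dotProduct, prodState, Pi.star_apply, star_prod]
  rw [Finset.prod_univ_sum, Fintype.piFinset_univ]
  exact Finset.sum_congr rfl fun x _ => Finset.prod_mul_distrib.symm

theorem nrm_eq_one_iff {X : Type*} [Fintype X] {a : X → ℂ} : nrm a = 1 ↔ ip a a = 1 := by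
  rw [ip_self]
  constructor
  · intro h; rw [h]; simp
  · intro h
    have : nrm a ^ 2 = 1 := by exact_mod_cast h
    exact (pow_eq_one_iff_of_nonneg (nrm_nonneg a) two_ne_zero).1 this

theorem nrm_prodState {n : ℕ} {v : Fin n → Qubit} (h : ∀ i, nrm (v i) = 1) :
    nrm (prodState v) = 1 := by
  rw [nrm_eq_one_iff, ip_prodState]
  exact Finset.prod_eq_one fun i _ => ip_self_of_nrm_one (h i)

/-- The product state with the qubit states `v i, v (i + 1), …, v (i + n - 1)`. -/
def seqState (v : ℕ → Qubit) (i n : ℕ) : Vec n := prodState fun t => v (i + t)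

/-- The superposition with amplitudes `c` of the states with one `a'` among `a`s. -/
def excState (a a' : Qubit) {n : ℕ} (c : Fin n → ℂ) : Vec n :=
  ∑ k, c k • prodState (Function.update (fun _ => a) k a')

theorem seqState_mem_nullSpace {P : TwoQubitOp} (hP : IsStarProjection P) {v : ℕ → Qubit}
    (h : ∀ i, P *ᵥ tp (v i) (v (i + 1)) = 0) (i n : ℕ) : seqState v i n ∈ nullSpace P n :=
  prodState_mem_nullSpace hP fun j => h (i + j)

/-- If the excitation is at neither `i` nor `j`, the term acts on `a ⊗ a` and gives zero; only two
summands survive. -/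
theorem onPair_mulVec_excState {P : TwoQubitOp} {a : Qubit} (ha : P *ᵥ tp a a = 0) (a' : Qubit)
    {n : ℕ} (c : Fin n → ℂ) {i j : Fin n} (hij : i ≠ j) (x : Fin n → Fin 2) :
    (onPair P i j *ᵥ excState a a' c) x = restProd i j (fun _ => a) x *
      (P *ᵥ (c i • tp a' a + c j • tp a a')) (x i, x j) := by
  have h1 : (onPair P i j *ᵥ excState a a' c) x
      = ∑ k, c k * (onPair P i j *ᵥ prodState (Function.update (fun _ => a) k a')) x := by
    rw [excState, ← Matrix.mulVecLin_apply, map_sum, Finset.sum_apply]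
    exact Finset.sum_congr rfl fun k _ => by rw [map_smul]; rfl
  have h2 : ∀ k ∈ ({i, j} : Finset (Fin n)), restProd i j (Function.update (fun _ => a) k a') x
      = restProd i j (fun _ => a) x := by
    intro k hk
    refine restProd_congr (fun l hl hl' => Function.update_of_ne ?_ _ _) fun _ _ _ => rfl
    rintro rfl
    simp only [Finset.mem_insert, Finset.mem_singleton] at hk
    tauto
  rw [h1, ← Finset.sum_subset (Finset.subset_univ {i, j}), Finset.sum_pair hij]
  · rw [onPair_mulVec_prodState P hij, onPair_mulVec_prodState P hij, h2 i (by simp),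
      h2 j (by simp)]
    simp only [Function.update_self, Function.update_of_ne hij, Function.update_of_ne hij.symm,
      Matrix.mulVec_add, Matrix.mulVec_smul, Pi.add_apply, Pi.smul_apply, smul_eq_mul]
    ring
  · intro k _ hk
    simp only [Finset.mem_insert, Finset.mem_singleton, not_or] at hk
    rw [onPair_mulVec_prodState P hij, Function.update_of_ne (Ne.symm hk.1),
      Function.update_of_ne (Ne.symm hk.2), ha]
    simp

/-- With the amplitudes `f ^ k`, the `j`-th bond acts on `f ^ j` times `a' ⊗ a + f a ⊗ a'`. -/
theorem excState_mem_nullSpace {P : TwoQubitOp} (hP : IsStarProjection P) {a a' : Qubit}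
    {f : ℂ} (ha : P *ᵥ tp a a = 0) (hf : P *ᵥ (tp a' a + f • tp a a') = 0) (n : ℕ) :
    excState a a' (fun k : Fin n => f ^ (k : ℕ)) ∈ nullSpace P n := by
  rw [mem_nullSpace_iff hP]
  intro j
  funext x
  rw [localTerm, onPair_mulVec_excState ha a' _ (site_ne_succ j)]
  have : f ^ (j : ℕ) • tp a' a + f ^ ((j : ℕ) + 1) • tp a a'
      = f ^ (j : ℕ) • (tp a' a + f • tp a a') := by
    rw [smul_add, smul_smul, pow_succ]
  simp only [this, Matrix.mulVec_smul, hf]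
  simp

theorem ip_sum_right {X α : Type*} [Fintype X] (s : Finset α) (φ : X → ℂ) (χ : α → X → ℂ) :
    ip φ (∑ k ∈ s, χ k) = ∑ k ∈ s, ip φ (χ k) := by
  rw [ip]; exact dotProduct_sum _ _ _

theorem ip_seqState_excState {a a' : Qubit} (h : ip a a' = 0) {n : ℕ} (c : Fin n → ℂ) (i : ℕ) :
    ip (seqState (fun _ => a) i n) (excState a a' c) = 0 := by
  rw [excState, ip_sum_right]
  refine Finset.sum_eq_zero fun k _ => ?_
  rw [ip_smul_right, seqState, ip_prodState, Finset.prod_eq_zero (Finset.mem_univ k), mul_zero]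
  simpa using h

theorem nrm_sq_excState {a a' : Qubit} (ha : nrm a = 1) (ha' : nrm a' = 1) (h : ip a a' = 0)
    {n : ℕ} (c : Fin n → ℂ) : nrm (excState a a' c) ^ 2 = ∑ k, ‖c k‖ ^ 2 := by
  have hD : ∀ k, ip (prodState (Function.update (fun _ : Fin n => a) k a')) (excState a a' c)
      = c k := by
    intro k
    rw [excState, ip_sum_right, Finset.sum_eq_single k]
    · rw [ip_smul_right, ip_self_of_nrm_one, mul_one]
      refine nrm_prodState fun i => ?_
      by_cases hi : i = k
      · subst hi; simpa using ha'
      · rwa [Function.update_of_ne hi]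
    · intro j _ hj
      rw [ip_smul_right, ip_prodState, Finset.prod_eq_zero (Finset.mem_univ j), mul_zero]
      rw [Function.update_of_ne hj, Function.update_self]
      exact h
    · simp
  rw [nrm_sq_eq_re]
  conv_lhs => rw [← star_ip, excState, ip_sum_right]
  rw [star_sum, Complex.re_sum]
  refine Finset.sum_congr rfl fun k _ => ?_
  change (star (ip (excState a a' c) (c k • _))).re = _
  rw [ip_smul_right, star_mul', star_ip, hD, Complex.star_def, ← Complex.normSq_eq_conj_mul_self,
    Complex.normSq_eq_norm_sq, Complex.ofReal_re]

/-! ### Splitting the chain into three parts -/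

section Cat

/-- Splitting of a configuration into three consecutive parts. -/
def catEquiv (p m q : ℕ) :
    (Fin p → Fin 2) × (Fin m → Fin 2) × (Fin q → Fin 2) ≃ (Fin (p + m + q) → Fin 2) :=
  (Equiv.prodAssoc _ _ _).symm.trans
    (((Fin.appendEquiv p m).prodCongr (Equiv.refl _)).trans (Fin.appendEquiv (p + m) q))

theorem catEquiv_apply {p m q : ℕ} (x : Fin p → Fin 2) (y : Fin m → Fin 2) (z : Fin q → Fin 2) :
    catEquiv p m q (x, y, z) = Fin.append (Fin.append x y) z := rfl

theorem extend_left_cat {p m q : ℕ} (h : 0 + (p + m) ≤ p + m + q) (x x' : Fin p → Fin 2)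
    (y y' : Fin m → Fin 2) (z : Fin q → Fin 2) :
    Function.extend (blockEmb 0 h) (Fin.append x y) (catEquiv p m q (x', y', z))
      = catEquiv p m q (x, y, z) := by
  funext i
  refine Fin.addCases (fun i => ?_) (fun i => ?_) i
  · have e : Fin.castAdd q i = blockEmb 0 h i := by ext; simp [blockEmb]
    conv_lhs => rw [e, (blockEmb_injective 0 h).extend_apply]
    rw [catEquiv_apply, Fin.append_left]
  · rw [Function.extend_apply', catEquiv_apply, catEquiv_apply, Fin.append_right, Fin.append_right]
    rintro ⟨t, ht⟩
    simp only [blockEmb, Fin.ext_iff, Fin.val_natAdd] at ht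
    omega

theorem extend_right_cat {p m q : ℕ} (h : p + (m + q) ≤ p + m + q) (x : Fin p → Fin 2)
    (y y' : Fin m → Fin 2) (z z' : Fin q → Fin 2) :
    Function.extend (blockEmb p h) (Fin.append y z) (catEquiv p m q (x, y', z'))
      = catEquiv p m q (x, y, z) := by
  funext i
  induction i using Fin.addCases with
  | left i =>
    induction i using Fin.addCases with
    | left i =>
      rw [Function.extend_apply', catEquiv_apply, catEquiv_apply, Fin.append_left, Fin.append_left,
        Fin.append_left, Fin.append_left]
      rintro ⟨t, ht⟩
      simp only [blockEmb, Fin.ext_iff, Fin.val_castAdd] at ht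
      omega
    | right i =>
      have e : Fin.castAdd q (Fin.natAdd p i) = blockEmb p h (Fin.castAdd q i) := by
        ext; simp [blockEmb]
      conv_lhs => rw [e, (blockEmb_injective p h).extend_apply]
      rw [catEquiv_apply, Fin.append_left, Fin.append_left, Fin.append_right]
  | right i =>
    have e : Fin.natAdd (p + m) i = blockEmb p h (Fin.natAdd m i) := by
      ext; simp [blockEmb]; omega
    conv_lhs => rw [e, (blockEmb_injective p h).extend_apply]
    rw [catEquiv_apply, Fin.append_right, Fin.append_right]

theorem ip_comp_equiv {X Y : Type*} [Fintype X] [Fintype Y] (e : X ≃ Y) (φ χ : Y → ℂ) :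
    ip (φ ∘ e) (χ ∘ e) = ip φ χ :=
  e.sum_comp fun y => star (φ y) * χ y

theorem nrm_comp_equiv {X Y : Type*} [Fintype X] [Fintype Y] (e : X ≃ Y) (φ : Y → ℂ) :
    nrm (φ ∘ e) = nrm φ := by
  have := ip_comp_equiv e φ φ
  rw [ip_self, ip_self] at this
  have h : nrm (φ ∘ e) ^ 2 = nrm φ ^ 2 := by exact_mod_cast this
  exact (sq_eq_sq₀ (nrm_nonneg _) (nrm_nonneg _)).1 h

/-- It suffices to check the angle condition after splitting configurations into three parts. -/
theorem angleBound_of_split {P : TwoQubitOp} {l : ℕ} {δ : ℝ}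
    (H : ∀ p m q : ℕ, l ≤ p → l ≤ m → l ≤ q →
      ∀ φ χ : (Fin p → Fin 2) × (Fin m → Fin 2) × (Fin q → Fin 2) → ℂ,
      (∀ z, ∃ g ∈ nullSpace P (p + m), ∀ x y, φ (x, y, z) = g (Fin.append x y)) →
      (∀ x, ∃ g ∈ nullSpace P (m + q), ∀ y z, χ (x, y, z) = g (Fin.append y z)) →
      (∀ g ∈ nullSpace P (p + m + q), ip (g ∘ catEquiv p m q) φ = 0) →
      (∀ g ∈ nullSpace P (p + m + q), ip (g ∘ catEquiv p m q) χ = 0) →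
      ‖ip φ χ‖ ≤ δ * (nrm φ * nrm χ)) : AngleBound P l δ := by
  intro p m q hp hm hq φ χ hφ hχ oφ oχ
  have h := H p m q hp hm hq (φ ∘ catEquiv p m q) (χ ∘ catEquiv p m q) ?_ ?_ ?_ ?_
  · rwa [ip_comp_equiv, nrm_comp_equiv, nrm_comp_equiv] at h
  · intro z
    refine ⟨_, hφ (catEquiv p m q (0, 0, z)), fun x y => ?_⟩
    rw [slice, extend_left_cat]; rfl
  · intro x
    refine ⟨_, hχ (catEquiv p m q (x, 0, 0)), fun y z => ?_⟩
    rw [slice, extend_right_cat]; rfl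
  · intro g hg
    rw [ip_comp_equiv]; exact oφ g hg
  · intro g hg
    rw [ip_comp_equiv]; exact oχ g hg

theorem seqState_append (v : ℕ → Qubit) (i m n : ℕ) (x : Fin m → Fin 2) (y : Fin n → Fin 2) :
    seqState v i (m + n) (Fin.append x y) = seqState v i m x * seqState v (i + m) n y := by
  simp only [seqState, prodState]
  rw [Fin.prod_univ_add]
  simp [add_assoc]

theorem prodState_append {m n : ℕ} (v : Fin (m + n) → Qubit) (x : Fin m → Fin 2)
    (y : Fin n → Fin 2) : prodState v (Fin.append x y)
      = prodState (fun i => v (Fin.castAdd n i)) x * prodState (fun i => v (Fin.natAdd m i)) y := by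
  simp only [prodState]
  rw [Fin.prod_univ_add]
  simp

/-- The single excitation sits either in the left part or in the right part. -/
theorem excState_append (a a' : Qubit) {m n : ℕ} (c : Fin (m + n) → ℂ) (x : Fin m → Fin 2)
    (y : Fin n → Fin 2) : excState a a' c (Fin.append x y)
      = excState a a' (fun k => c (Fin.castAdd n k)) x * prodState (fun _ => a) y
        + prodState (fun _ => a) x * excState a a' (fun k => c (Fin.natAdd m k)) y := by
  simp only [excState, Finset.sum_apply, Pi.smul_apply, smul_eq_mul, Finset.sum_mul,
    Finset.mul_sum]
  rw [Fin.sum_univ_add]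
  congr 1
  · refine Finset.sum_congr rfl fun k _ => ?_
    rw [prodState_append, mul_assoc]
    congr 3
    · funext i
      by_cases hi : i = k
      · subst hi; simp
      · rw [Function.update_of_ne hi, Function.update_of_ne]
        simpa using hi
    · funext i
      rw [Function.update_of_ne]
      simp only [ne_eq, Fin.ext_iff, Fin.val_natAdd, Fin.val_castAdd]
      omega
  · refine Finset.sum_congr rfl fun k _ => ?_
    rw [prodState_append, mul_left_comm]
    congr 1
    · congr 2
      funext i
      rw [Function.update_of_ne]
      simp only [ne_eq, Fin.ext_iff, Fin.val_natAdd, Fin.val_castAdd]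
      omega
    · congr 2
      funext i
      by_cases hi : i = k
      · subst hi; simp
      · rw [Function.update_of_ne hi, Function.update_of_ne]
        simpa using hi

end Cat

/-! ### Ground spaces and gaps of the frustration-free normal forms -/

/-- Linear independence from the strict Cauchy-Schwarz inequality. -/
theorem span_pair_eq_of_finrank_le {X : Type*} [Fintype X] {N : Submodule ℂ (X → ℂ)}
    {v w : X → ℂ} (hv : v ∈ N) (hw : w ∈ N) (hN : Module.finrank ℂ N ≤ 2)
    (hvw : ‖ip v w‖ < nrm v * nrm w) :
    N = Submodule.span ℂ {v, w} ∧ Module.finrank ℂ N = 2 := by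
  have hli : LinearIndependent ℂ ![v, w] := by
    rw [LinearIndependent.pair_iff' (by rintro rfl; simp [ip_zero_left, nrm_eq_zero.2] at hvw)]
    rintro c rfl
    have : nrm (c • v) = ‖c‖ * nrm v := norm_smul c (WithLp.toLp 2 v)
    rw [this, ip_smul_right, norm_mul, ip_self, Complex.norm_real,
      Real.norm_of_nonneg (sq_nonneg _)] at hvw
    exact hvw.ne (by ring)
  have hfin : Module.finrank ℂ (Submodule.span ℂ (Set.range ![v, w])) = 2 := by
    rw [finrank_span_eq_card hli]; simp
  rw [Matrix.range_cons, Matrix.range_cons, Matrix.range_empty, Set.union_empty,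
    Set.singleton_union] at hfin
  have hle : Submodule.span ℂ {v, w} ≤ N := by
    rw [Submodule.span_le]
    rintro u (rfl | rfl)
    · exact hv
    · exact hw
  have := Submodule.eq_of_le_of_finrank_le hle (by rw [hfin]; exact hN)
  exact ⟨this.symm, by rw [← this, hfin]⟩

theorem norm_ip_lt_of_linearIndependent {X : Type*} [Fintype X] {a b : X → ℂ}
    (h : LinearIndependent ℂ ![a, b]) : ‖ip a b‖ < nrm a * nrm b := by
  refine lt_of_le_of_ne (norm_ip_le a b) fun heq => ?_
  have ha : a ≠ 0 := h.ne_zero 0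
  have hb : b ≠ 0 := h.ne_zero 1
  rw [ip_eq_inner, nrm, nrm, norm_inner_eq_norm_iff ((WithLp.toLp_eq_zero 2).not.2 ha)
    ((WithLp.toLp_eq_zero 2).not.2 hb)] at heq
  obtain ⟨r, -, hr⟩ := heq
  exact (LinearIndependent.pair_iff' ha).1 h r (congrArg WithLp.ofLp hr).symm

/-- Sequences `v`, `w` of qubit states treat the constant and the alternating products at once. The
two product states have overlap at most `s ^ n < 1`, so they are independent, and the dimension is
at most two. -/
theorem nullSpace_eq_span_of_products {P : TwoQubitOp} (hP : IsStarProjection P) {θ : Qubit}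
    (hθ : Separating P θ) {v w : ℕ → Qubit} (hv : ∀ i, nrm (v i) = 1) (hw : ∀ i, nrm (w i) = 1)
    {s : ℝ} (hs : ∀ i, ‖ip (v i) (w i)‖ ≤ s) (hs1 : s < 1)
    (hv2 : ∀ i, P *ᵥ tp (v i) (v (i + 1)) = 0) (hw2 : ∀ i, P *ᵥ tp (w i) (w (i + 1)) = 0)
    (i : ℕ) {n : ℕ} (hn : 1 ≤ n) :
    nullSpace P n = Submodule.span ℂ {seqState v i n, seqState w i n} ∧
      Module.finrank ℂ (nullSpace P n) = 2 := by
  refine span_pair_eq_of_finrank_le (seqState_mem_nullSpace hP hv2 i n)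
    (seqState_mem_nullSpace hP hw2 i n) (finrank_nullSpace_le_two hP hθ hn) ?_
  have hs0 : 0 ≤ s := (norm_nonneg _).trans (hs 0)
  rw [seqState, seqState, nrm_prodState fun _ => hv _, nrm_prodState fun _ => hw _, one_mul,
    ip_prodState, norm_prod]
  calc ∏ t : Fin n, ‖ip (v (i + t)) (w (i + t))‖ ≤ ∏ _t : Fin n, s :=
        Finset.prod_le_prod (fun _ _ => norm_nonneg _) fun _ _ => hs _
    _ = s ^ n := by simp
    _ < 1 := pow_lt_one₀ hs0 hs1 (by omega)

/-- The overlap of the two product states on the middle part is at most `s ^ m`, which is below `1 /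
10` as soon as the blocks overlap in enough sites. -/
theorem gapped_of_products {P : TwoQubitOp} (hP : IsStarProjection P) {θ : Qubit}
    (hθ : Separating P θ) {v w : ℕ → Qubit} (hv : ∀ i, nrm (v i) = 1) (hw : ∀ i, nrm (w i) = 1)
    {s : ℝ} (hs : ∀ i, ‖ip (v i) (w i)‖ ≤ s) (hs1 : s < 1)
    (hv2 : ∀ i, P *ᵥ tp (v i) (v (i + 1)) = 0) (hw2 : ∀ i, P *ᵥ tp (w i) (w (i + 1)) = 0) :
    Gapped P := by
  have hs0 : 0 ≤ s := (norm_nonneg _).trans (hs 0)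
  have hspan := fun i n hn => nullSpace_eq_span_of_products hP hθ hv hw hs hs1 hv2 hw2 i (n := n) hn
  have hbot : ∀ n, 2 ≤ n → nullSpace P n ≠ ⊥ := by
    intro n hn h
    have h2 := (hspan 0 n (by omega)).2
    rw [h, finrank_bot] at h2
    omega
  obtain ⟨k, hk⟩ := exists_pow_lt_of_lt_one (show (0 : ℝ) < 1 / 10 by norm_num) hs1
  refine gapped_of_angleBound hP hbot (fun n hn => nullSpace_ne_top hP hθ hn) (l := k + 1)
    (by omega) (δ := 1 / 4) (by norm_num) (by norm_num) (angleBound_of_split ?_)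
  intro p m q hp hm hq φ χ hφ hχ oφ oχ
  have hφ' : ∀ z, ∃ c c' : ℂ, ∀ x y, φ (x, y, z)
      = c * (seqState v 0 p x * seqState v p m y) + c' * (seqState w 0 p x * seqState w p m y) := by
    intro z
    obtain ⟨g, hg, hgz⟩ := hφ z
    rw [(hspan 0 (p + m) (by omega)).1, Submodule.mem_span_pair] at hg
    obtain ⟨c, c', rfl⟩ := hg
    refine ⟨c, c', fun x y => ?_⟩
    rw [hgz]
    simp only [Pi.add_apply, Pi.smul_apply, smul_eq_mul, seqState_append, zero_add]
  have hχ' : ∀ x, ∃ c c' : ℂ, ∀ y z, χ (x, y, z) = c * (seqState v p m y * seqState v (p + m) q z)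
      + c' * (seqState w p m y * seqState w (p + m) q z) := by
    intro x
    obtain ⟨g, hg, hgx⟩ := hχ x
    rw [(hspan p (m + q) (by omega)).1, Submodule.mem_span_pair] at hg
    obtain ⟨c, c', rfl⟩ := hg
    refine ⟨c, c', fun y z => ?_⟩
    rw [hgx]
    simp only [Pi.add_apply, Pi.smul_apply, smul_eq_mul, seqState_append]
  choose u u' hu using hφ'
  choose r r' hr using hχ'
  have eφ : φ = tens (seqState v 0 p) (seqState v p m) u + tens (seqState w 0 p) (seqState w p m) u' := by
    funext ⟨x, y, z⟩
    rw [hu]; simp only [Pi.add_apply, tens]; ring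
  have eχ : χ = tens r (seqState v p m) (seqState v (p + m) q)
      + tens r' (seqState w p m) (seqState w (p + m) q) := by
    funext ⟨x, y, z⟩
    rw [hr]; simp only [Pi.add_apply, tens]; ring
  have full : ∀ t : ℕ → Qubit, seqState t 0 (p + m + q) ∘ catEquiv p m q
      = tens (seqState t 0 p) (seqState t p m) (seqState t (p + m) q) := by
    intro t
    funext ⟨x, y, z⟩
    rw [Function.comp_apply, catEquiv_apply, seqState_append, seqState_append]
    simp only [zero_add, tens]
  have mv := seqState_mem_nullSpace hP hv2 0 (p + m + q)
  have mw := seqState_mem_nullSpace hP hw2 0 (p + m + q)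
  have ov := oφ _ mv
  have ow := oφ _ mw
  have ov' := oχ _ mv
  have ow' := oχ _ mw
  rw [full] at ov ow ov' ow'
  subst eφ eχ
  have n1 : ∀ {t : ℕ → Qubit}, (∀ i, nrm (t i) = 1) → ∀ i n, nrm (seqState t i n) = 1 :=
    fun ht i n => nrm_prodState fun _ => ht _
  refine angle_of_two_products (n1 hv _ _) (n1 hw _ _) (n1 hv _ _) (n1 hw _ _) (n1 hv _ _)
    (n1 hw _ _) (pow_nonneg hs0 k) hk.le ?_ u u' r r' ov ow ov' ow'
  rw [seqState, seqState, ip_prodState, norm_prod]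
  calc ∏ t : Fin m, ‖ip (v (p + t)) (w (p + t))‖ ≤ ∏ _t : Fin m, s :=
        Finset.prod_le_prod (fun _ _ => norm_nonneg _) fun _ _ => hs _
    _ = s ^ m := by simp
    _ ≤ s ^ k := pow_le_pow_of_le_one hs0 hs1.le (by omega)

theorem nullSpace_eq_span_of_one_product {P : TwoQubitOp} (hP : IsStarProjection P) {a : Qubit}
    (ha : nrm a = 1) (ha2 : P *ᵥ tp a a = 0) {n : ℕ}
    (hfin : Module.finrank ℂ (nullSpace P n) ≤ 1) (i : ℕ) :
    nullSpace P n = Submodule.span ℂ {seqState (fun _ => a) i n} ∧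
      Module.finrank ℂ (nullSpace P n) = 1 := by
  have h1 : nrm (seqState (fun _ => a) i n) = 1 := nrm_prodState fun _ => ha
  have h0 : seqState (fun _ => a) i n ≠ 0 := fun h => by
    rw [nrm_eq_zero.2 h] at h1; exact zero_ne_one h1
  have hle : Submodule.span ℂ {seqState (fun _ => a) i n} ≤ nullSpace P n := by
    rw [Submodule.span_singleton_le_iff_mem]
    exact seqState_mem_nullSpace hP (fun _ => ha2) i n
  have h := Submodule.eq_of_le_of_finrank_le hle (by rwa [finrank_span_singleton h0])
  exact ⟨h.symm, by rw [← h, finrank_span_singleton h0]⟩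

/-- The angle bound comes from a vanishing inner product. The choice `l = 4` ensures that all blocks
have at least four sites, where the ground space is one-dimensional. -/
theorem gapped_of_one_product {P : TwoQubitOp} (hP : IsStarProjection P) {θ : Qubit}
    (hθ : Separating P θ) {a : Qubit} (ha : nrm a = 1) (ha2 : P *ᵥ tp a a = 0)
    (hfin : Module.finrank ℂ (nullSpace P 4) ≤ 1) : Gapped P := by
  have hspan := fun i n (hn : 4 ≤ n) => (nullSpace_eq_span_of_one_product hP ha ha2 (n := n)
    ((finrank_nullSpace_le_of_le hP hθ (by omega) hn).trans hfin) i).1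
  have hmem := fun i n => seqState_mem_nullSpace hP (fun _ => ha2) i n
  have hone : ∀ i n, nrm (seqState (fun _ => a) i n) = 1 := fun i n => nrm_prodState fun _ => ha
  have hbot : ∀ n, 2 ≤ n → nullSpace P n ≠ ⊥ := by
    intro n _ h
    have h1 := hmem 0 n
    rw [h, Submodule.mem_bot] at h1
    have h2 := hone 0 n
    rw [nrm_eq_zero.2 h1] at h2
    exact zero_ne_one h2
  refine gapped_of_angleBound hP hbot (fun n hn => nullSpace_ne_top hP hθ hn) (l := 4)
    (by omega) (δ := 1 / 4) (by norm_num) (by norm_num) (angleBound_of_split ?_)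
  intro p m q hp hm hq φ χ hφ hχ oφ oχ
  have hφ' : ∀ z, ∃ c : ℂ, ∀ x y, φ (x, y, z)
      = c * (seqState (fun _ => a) 0 p x * seqState (fun _ => a) p m y) := by
    intro z
    obtain ⟨g, hg, hgz⟩ := hφ z
    rw [hspan 0 (p + m) (by omega), Submodule.mem_span_singleton] at hg
    obtain ⟨c, rfl⟩ := hg
    refine ⟨c, fun x y => ?_⟩
    rw [hgz]
    simp only [Pi.smul_apply, smul_eq_mul, seqState_append, zero_add]
  have hχ' : ∀ x, ∃ c : ℂ, ∀ y z, χ (x, y, z)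
      = c * (seqState (fun _ => a) p m y * seqState (fun _ => a) (p + m) q z) := by
    intro x
    obtain ⟨g, hg, hgx⟩ := hχ x
    rw [hspan p (m + q) (by omega), Submodule.mem_span_singleton] at hg
    obtain ⟨c, rfl⟩ := hg
    refine ⟨c, fun y z => ?_⟩
    rw [hgx]
    simp only [Pi.smul_apply, smul_eq_mul, seqState_append]
  choose u hu using hφ'
  choose r hr using hχ'
  have eφ : φ = tens (seqState (fun _ => a) 0 p) (seqState (fun _ => a) p m) u := by
    funext ⟨x, y, z⟩
    rw [hu]; simp only [tens]; ring
  have eχ : χ = tens r (seqState (fun _ => a) p m) (seqState (fun _ => a) (p + m) q) := by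
    funext ⟨x, y, z⟩
    rw [hr]; simp only [tens]; ring
  have full : seqState (fun _ => a) 0 (p + m + q) ∘ catEquiv p m q
      = tens (seqState (fun _ => a) 0 p) (seqState (fun _ => a) p m)
        (seqState (fun _ => a) (p + m) q) := by
    funext ⟨x, y, z⟩
    rw [Function.comp_apply, catEquiv_apply, seqState_append, seqState_append]
    simp only [zero_add, tens]
  have oa := oφ _ (hmem 0 (p + m + q))
  rw [full, eφ] at oa
  rw [eφ, eχ, angle_of_one_product (hone _ _) (hone _ _) u r oa, norm_zero]
  exact mul_nonneg (by norm_num) (mul_nonneg (nrm_nonneg _) (nrm_nonneg _))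

/-- The state `∑ f ^ k |a ⋯ a a' a ⋯ a⟩` with `a'` at the site `k`. -/
def wState (a a' : Qubit) (f : ℂ) (n : ℕ) : Vec n := excState a a' fun k : Fin n => f ^ (k : ℕ)

theorem excState_smul (a a' : Qubit) {n : ℕ} (t : ℂ) (c : Fin n → ℂ) :
    excState a a' (t • c) = t • excState a a' c := by
  simp [excState, Finset.smul_sum, smul_smul]

theorem wState_append (a a' : Qubit) (f : ℂ) {m n : ℕ} (x : Fin m → Fin 2) (y : Fin n → Fin 2) :
    wState a a' f (m + n) (Fin.append x y) = wState a a' f m x * prodState (fun _ => a) y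
      + f ^ m * (prodState (fun _ => a) x * wState a a' f n y) := by
  have : (fun k : Fin n => f ^ (Fin.natAdd m k : ℕ)) = f ^ m • fun k : Fin n => f ^ (k : ℕ) := by
    funext k
    simp [pow_add]
  rw [wState, excState_append, this, excState_smul, Pi.smul_apply, smul_eq_mul, mul_left_comm]
  rfl

theorem nrm_sq_wState {a a' : Qubit} (ha : nrm a = 1) (ha' : nrm a' = 1) (h : ip a a' = 0)
    (f : ℂ) (n : ℕ) : nrm (wState a a' f n) ^ 2 = ∑ k ∈ Finset.range n, (‖f‖ ^ 2) ^ k := by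
  rw [wState, nrm_sq_excState ha ha' h, Finset.sum_range]
  exact Finset.sum_congr rfl fun k _ => by rw [norm_pow, ← pow_mul, ← pow_mul, mul_comm]

theorem one_le_nrm_wState {a a' : Qubit} (ha : nrm a = 1) (ha' : nrm a' = 1) (h : ip a a' = 0)
    (f : ℂ) {n : ℕ} (hn : 1 ≤ n) : 1 ≤ nrm (wState a a' f n) := by
  refine le_of_sq_le_sq ?_ (nrm_nonneg _)
  rw [nrm_sq_wState ha ha' h, one_pow]
  have := Finset.single_le_sum (f := fun k => (‖f‖ ^ 2) ^ k) (s := Finset.range n)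
    (fun k _ => by positivity) (Finset.mem_range.2 (by omega : 0 < n))
  simpa using this

/-- The geometric series bounds the squared norm by a number `C ≥ 1`, and then `C ≤ C²`. -/
theorem nrm_wState_le {a a' : Qubit} (ha : nrm a = 1) (ha' : nrm a' = 1) (h : ip a a' = 0)
    {f : ℂ} (hf : ‖f‖ < 1) (n : ℕ) : nrm (wState a a' f n) ≤ 1 / (1 - ‖f‖ ^ 2) := by
  have hr : 0 < 1 - ‖f‖ ^ 2 := sub_pos.2 (pow_lt_one₀ (norm_nonneg _) hf two_ne_zero)
  have h1 : nrm (wState a a' f n) ^ 2 ≤ 1 / (1 - ‖f‖ ^ 2) := by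
    rw [nrm_sq_wState ha ha' h, le_div_iff₀ hr, mul_comm, mul_neg_geom_sum]
    have : 0 ≤ (‖f‖ ^ 2) ^ n := by positivity
    linarith
  have h2 : 1 ≤ 1 / (1 - ‖f‖ ^ 2) := by
    rw [le_div_iff₀ hr]; nlinarith [sq_nonneg ‖f‖]
  exact le_of_sq_le_sq (h1.trans (by nlinarith)) (by linarith)

theorem nullSpace_eq_span_wState {P : TwoQubitOp} (hP : IsStarProjection P) {θ : Qubit}
    (hθ : Separating P θ) {a a' : Qubit} (ha : nrm a = 1) (ha' : nrm a' = 1) (h : ip a a' = 0)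
    {f : ℂ} (ha2 : P *ᵥ tp a a = 0) (hf2 : P *ᵥ (tp a' a + f • tp a a') = 0) {n : ℕ}
    (hn : 1 ≤ n) : nullSpace P n = Submodule.span ℂ {prodState fun _ => a, wState a a' f n} ∧
      Module.finrank ℂ (nullSpace P n) = 2 := by
  refine span_pair_eq_of_finrank_le (seqState_mem_nullSpace hP (fun _ => ha2) 0 n)
    (excState_mem_nullSpace hP ha2 hf2 n) (finrank_nullSpace_le_two hP hθ hn) ?_
  have h0 : ip (prodState fun _ => a) (wState a a' f n) = 0 := ip_seqState_excState h _ 0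
  rw [h0, norm_zero, nrm_prodState fun _ => ha, one_mul]
  exact zero_lt_one.trans_le (one_le_nrm_wState ha ha' h f hn)

/-- For `‖f‖ < 1` the excitation is concentrated at the left end: the norms of all `wState`s are
between `1` and a fixed `C`, and `f ^ m` is small when the middle part is long. -/
theorem gapped_of_single_excitation {P : TwoQubitOp} (hP : IsStarProjection P) {θ : Qubit}
    (hθ : Separating P θ) {a a' : Qubit} (ha : nrm a = 1) (ha' : nrm a' = 1) (h : ip a a' = 0)
    {f : ℂ} (hf : ‖f‖ < 1) (ha2 : P *ᵥ tp a a = 0) (hf2 : P *ᵥ (tp a' a + f • tp a a') = 0) :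
    Gapped P := by
  have hspan := fun n hn => nullSpace_eq_span_wState hP hθ ha ha' h ha2 hf2 (n := n) hn
  have hbot : ∀ n, 2 ≤ n → nullSpace P n ≠ ⊥ := by
    intro n hn h
    have h2 := (hspan n (by omega)).2
    rw [h, finrank_bot] at h2
    omega
  have hr : 0 < 1 - ‖f‖ ^ 2 := sub_pos.2 (pow_lt_one₀ (norm_nonneg _) hf two_ne_zero)
  set C := 1 / (1 - ‖f‖ ^ 2) with hC
  have hC1 : 1 ≤ C := by
    rw [hC, le_div_iff₀ hr]; nlinarith [sq_nonneg ‖f‖]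
  have hC3 : 0 < 16 * C ^ 3 := by positivity
  obtain ⟨k, hk⟩ := exists_pow_lt_of_lt_one (show (0 : ℝ) < 1 / 4 / (16 * C ^ 3) by positivity) hf
  rw [lt_div_iff₀ hC3] at hk
  refine gapped_of_angleBound hP hbot (fun n hn => nullSpace_ne_top hP hθ hn) (l := k + 1)
    (by omega) (δ := 1 / 4) (by norm_num) (by norm_num) (angleBound_of_split ?_)
  intro p m q hp hm hq φ χ hφ hχ oφ oχ
  let A : ∀ n, Vec n := fun n => prodState fun _ => a
  let W : ∀ n, Vec n := fun n => wState a a' f n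
  have hA : ∀ i j (x : Fin i → Fin 2) (y : Fin j → Fin 2), A (i + j) (Fin.append x y) = A i x * A j y :=
    fun i j x y => prodState_append _ x y
  have hW : ∀ i j (x : Fin i → Fin 2) (y : Fin j → Fin 2), W (i + j) (Fin.append x y)
      = W i x * A j y + f ^ i * (A i x * W j y) := fun i j x y => wState_append a a' f x y
  have hφ' : ∀ z, ∃ c c' : ℂ, ∀ x y, φ (x, y, z)
      = c * (A p x * A m y) + c' * (W p x * A m y + f ^ p * (A p x * W m y)) := by
    intro z
    obtain ⟨g, hg, hgz⟩ := hφ z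
    rw [(hspan (p + m) (by omega)).1, Submodule.mem_span_pair] at hg
    obtain ⟨c, c', rfl⟩ := hg
    refine ⟨c, c', fun x y => ?_⟩
    rw [hgz, ← hA, ← hW]
    rfl
  have hχ' : ∀ x, ∃ c c' : ℂ, ∀ y z, χ (x, y, z)
      = c * (A m y * A q z) + c' * (W m y * A q z + f ^ m * (A m y * W q z)) := by
    intro x
    obtain ⟨g, hg, hgx⟩ := hχ x
    rw [(hspan (m + q) (by omega)).1, Submodule.mem_span_pair] at hg
    obtain ⟨c, c', rfl⟩ := hg
    refine ⟨c, c', fun y z => ?_⟩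
    rw [hgx, ← hA, ← hW]
    rfl
  choose u v hu using hφ'
  choose r r' hr using hχ'
  have eφ : φ = tens (A p) (A m) u + (tens (W p) (A m) v + f ^ p • tens (A p) (W m) v) := by
    funext ⟨x, y, z⟩
    rw [hu]; simp only [Pi.add_apply, Pi.smul_apply, smul_eq_mul, tens]; ring
  have eχ : χ = tens r (A m) (A q) + (tens r' (W m) (A q) + f ^ m • tens r' (A m) (W q)) := by
    funext ⟨x, y, z⟩
    rw [hr]; simp only [Pi.add_apply, Pi.smul_apply, smul_eq_mul, tens]; ring
  have fullA : A (p + m + q) ∘ catEquiv p m q = tens (A p) (A m) (A q) := by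
    funext ⟨x, y, z⟩
    rw [Function.comp_apply, catEquiv_apply, hA, hA]
    simp only [tens]
  have fullW : W (p + m + q) ∘ catEquiv p m q = tens (W p) (A m) (A q)
      + f ^ p • tens (A p) (W m) (A q) + (f ^ p * f ^ m) • tens (A p) (A m) (W q) := by
    funext ⟨x, y, z⟩
    rw [Function.comp_apply, catEquiv_apply, hW, hW, hA, pow_add]
    simp only [Pi.add_apply, Pi.smul_apply, smul_eq_mul, tens]; ring
  have oa := oφ _ (seqState_mem_nullSpace hP (fun _ => ha2) 0 (p + m + q))
  have oW := oφ _ (excState_mem_nullSpace hP ha2 hf2 (p + m + q))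
  change ip (A (p + m + q) ∘ catEquiv p m q) φ = 0 at oa
  change ip (W (p + m + q) ∘ catEquiv p m q) φ = 0 at oW
  rw [fullA] at oa
  rw [fullW] at oW
  subst eφ eχ
  have nA : ∀ n, nrm (A n) = 1 := fun n => nrm_prodState fun _ => ha
  have oAW : ∀ n, ip (A n) (W n) = 0 := fun n => ip_seqState_excState h _ 0
  refine angle_of_single_excitation (nA p) (nA m) (nA q) (oAW p) (oAW m) (oAW q) hC1
    (pow_nonneg (norm_nonneg f) k) (by linarith) (one_le_nrm_wState ha ha' h f (by omega))
    (nrm_wState_le ha ha' h hf _) (one_le_nrm_wState ha ha' h f (by omega))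
    (nrm_wState_le ha ha' h hf _) (nrm_wState_le ha ha' h hf _) ?_ ?_ u v r r' oa oW
  · rw [norm_pow]; exact pow_le_one₀ (norm_nonneg _) hf.le
  · rw [norm_pow]; exact pow_le_pow_of_le_one (norm_nonneg _) hf.le (by omega)

/-! ### Reflection of the chain -/

section Reversal

/-- The two-qubit operator with the roles of the qubits exchanged. -/
def swapOp (P : TwoQubitOp) : TwoQubitOp := P.submatrix Prod.swap Prod.swap

/-- Reversal of bit strings. -/
def revEquiv (n : ℕ) : (Fin n → Fin 2) ≃ (Fin n → Fin 2) := Fin.revPerm.arrowCongr (Equiv.refl _)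

theorem revEquiv_apply {n : ℕ} (x : Fin n → Fin 2) (i : Fin n) : revEquiv n x i = x i.rev := rfl

theorem localTerm_swapOp (P : TwoQubitOp) (n : ℕ) (j : Fin (n - 1)) (x y : Fin n → Fin 2) :
    localTerm (swapOp P) n j x y = localTerm P n j.rev (revEquiv n x) (revEquiv n y) := by
  have e1 : Fin.rev (⟨j.rev, by omega⟩ : Fin n) = ⟨j + 1, by omega⟩ := by
    ext; simp only [Fin.val_rev]; omega
  have e2 : Fin.rev (⟨j.rev + 1, by omega⟩ : Fin n) = ⟨j, by omega⟩ := by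
    ext; simp only [Fin.val_rev]; omega
  have key : (∀ k : Fin n, k ≠ ⟨j, by omega⟩ → k ≠ ⟨j + 1, by omega⟩ → x k = y k) ↔
      ∀ k : Fin n, k ≠ ⟨j.rev, by omega⟩ → k ≠ ⟨j.rev + 1, by omega⟩ →
        revEquiv n x k = revEquiv n y k := by
    rw [← e1, ← e2]
    simp only [revEquiv_apply]
    constructor
    · intro h k h1 h2
      exact h _ (fun h' => h2 (Fin.rev_injective h')) (fun h' => h1 (Fin.rev_injective h'))
    · intro h k h1 h2
      have := h k.rev (fun h' => h2 (by rw [← h', Fin.rev_rev]))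
        (fun h' => h1 (by rw [← h', Fin.rev_rev]))
      rwa [Fin.rev_rev] at this
  simp only [localTerm, onPair, Matrix.of_apply, swapOp, Matrix.submatrix_apply,
    Prod.swap]
  by_cases hc : ∀ k : Fin n, k ≠ ⟨j, by omega⟩ → k ≠ ⟨j + 1, by omega⟩ → x k = y k
  · rw [if_pos hc, if_pos (key.1 hc)]
    simp only [revEquiv_apply, e1, e2]
  · rw [if_neg hc, if_neg fun h => hc (key.2 h)]

theorem hamiltonian_swapOp (P : TwoQubitOp) (n : ℕ) : hamiltonian (swapOp P) n
    = (hamiltonian P n).submatrix (revEquiv n) (revEquiv n) := by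
  ext x y
  rw [Matrix.submatrix_apply, hamiltonian, hamiltonian, Matrix.sum_apply, Matrix.sum_apply]
  rw [← Equiv.sum_comp Fin.revPerm]
  refine Finset.sum_congr rfl fun j _ => ?_
  rw [localTerm_swapOp]
  simp

theorem energies_swapOp (P : TwoQubitOp) (n : ℕ) : energies (swapOp P) n = energies P n := by
  have key : ∀ (v : Vec n), hamiltonian (swapOp P) n *ᵥ (v ∘ revEquiv n)
      = (hamiltonian P n *ᵥ v) ∘ revEquiv n := by
    intro v
    rw [hamiltonian_swapOp, Matrix.submatrix_mulVec_equiv, Function.comp_assoc,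
      Equiv.self_comp_symm, Function.comp_id]
  ext E
  rw [mem_energies, mem_energies]
  constructor
  · rintro ⟨ψ, h0, h1⟩
    have e : ψ = (ψ ∘ (revEquiv n).symm) ∘ revEquiv n := by
      rw [Function.comp_assoc, Equiv.symm_comp_self, Function.comp_id]
    refine ⟨ψ ∘ (revEquiv n).symm, fun h => h0 (by rw [e, h]; rfl), ?_⟩
    rw [e, key] at h1
    funext x
    have := congrFun h1 ((revEquiv n).symm x)
    simpa using this
  · rintro ⟨ψ, h0, h1⟩
    refine ⟨ψ ∘ revEquiv n, fun h => h0 ?_, by rw [key, h1]; rfl⟩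
    funext x
    have := congrFun h ((revEquiv n).symm x)
    simpa using this

/-- Reversing the order of the qubits conjugates one Hamiltonian into the other, so the energies
coincide. This reduces `‖f‖ > 1` to `‖f‖ < 1`. -/
theorem gapped_swapOp {P : TwoQubitOp} (h : Gapped (swapOp P)) : Gapped P := by
  simpa only [Gapped, IsSpectralGap, energies_swapOp] using h

theorem isStarProjection_swapOp {P : TwoQubitOp} (hP : IsStarProjection P) :
    IsStarProjection (swapOp P) := by
  constructor
  · rw [IsIdempotentElem, swapOp, ← Equiv.coe_prodComm, Matrix.submatrix_mul_equiv,
      hP.isIdempotentElem.eq]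
  · rw [IsSelfAdjoint, swapOp, Matrix.star_eq_conjTranspose, Matrix.conjTranspose_submatrix,
      ← Matrix.star_eq_conjTranspose, hP.isSelfAdjoint.star_eq]

theorem swapOp_mulVec (P : TwoQubitOp) (s : Fin 2 × Fin 2 → ℂ) :
    swapOp P *ᵥ s = (P *ᵥ (s ∘ Prod.swap)) ∘ Prod.swap := by
  rw [swapOp, ← Equiv.coe_prodComm, Matrix.submatrix_mulVec_equiv]
  rfl

theorem tp_comp_swap (a b : Qubit) : tp a b ∘ Prod.swap = tp b a := by
  funext s; simp [tp, mul_comm]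

end Reversal

/-! ### Determinants of qubit vectors and functionals on pairs -/

/-- The determinant of two qubit vectors. -/
def qdet (a b : Qubit) : ℂ := a 0 * b 1 - a 1 * b 0

theorem qdet_self (a : Qubit) : qdet a a = 0 := by simp [qdet, mul_comm]

theorem qdet_comm (a b : Qubit) : qdet a b = -qdet b a := by simp [qdet]; ring

theorem qdet_eq_zero_comm {a b : Qubit} : qdet a b = 0 ↔ qdet b a = 0 := by
  rw [qdet_comm, neg_eq_zero]

theorem qdet_smul_left (t : ℂ) (a b : Qubit) : qdet (t • a) b = t * qdet a b := by
  simp [qdet]; ring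

theorem qdet_smul_right (t : ℂ) (a b : Qubit) : qdet a (t • b) = t * qdet a b := by
  simp [qdet]; ring

theorem qdet_add_right (a b c : Qubit) : qdet a (b + c) = qdet a b + qdet a c := by
  simp [qdet]; ring

/-- Cramer's rule for the coordinates of `v` with respect to `a, b`. -/
theorem qdet_expand (a b v : Qubit) : qdet a b • v = qdet v b • a + qdet a v • b := by
  funext i
  fin_cases i <;> simp [qdet] <;> ring

theorem ne_zero_of_qdet_left {a b : Qubit} (h : qdet a b ≠ 0) : a ≠ 0 := by
  rintro rfl; simp [qdet] at h

theorem ne_zero_of_qdet_right {a b : Qubit} (h : qdet a b ≠ 0) : b ≠ 0 := by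
  rintro rfl; simp [qdet] at h

/-- A vanishing `qdet` expresses proportionality, which is transitive only through a non-zero
vector. -/
theorem qdet_trans {a b c : Qubit} (ha : a ≠ 0) (hb : qdet a b = 0) (hc : qdet a c = 0) :
    qdet b c = 0 := by
  have h : ∀ i, a i * qdet b c = 0 := by
    simp only [qdet] at *
    intro i
    fin_cases i
    · change a 0 * _ = 0
      linear_combination b 0 * hc - c 0 * hb
    · change a 1 * _ = 0
      linear_combination b 1 * hc - c 1 * hb
  by_contra hne
  exact ha (funext fun i => (mul_eq_zero.1 (h i)).resolve_right hne)

theorem exists_smul_of_qdet {a b : Qubit} (ha : a ≠ 0) (h : qdet a b = 0) : ∃ t : ℂ, b = t • a := by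
  obtain ⟨i, hi⟩ := Function.ne_iff.1 ha
  refine ⟨b i / a i, ?_⟩
  rw [Pi.zero_apply] at hi
  simp only [qdet] at h
  funext k
  rw [Pi.smul_apply, smul_eq_mul, div_mul_eq_mul_div, eq_div_iff hi]
  fin_cases i <;> fin_cases k <;> simp only [Fin.zero_eta, Fin.mk_one, Fin.isValue] <;>
    first | ring1 | linear_combination h | linear_combination -h

theorem eq_zero_of_qdet {a b v : Qubit} (hab : qdet a b ≠ 0) (ha : qdet a v = 0)
    (hb : qdet b v = 0) : v = 0 := by
  have h := qdet_expand a b v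
  rw [ha, qdet_eq_zero_comm.1 hb, zero_smul, zero_smul, add_zero] at h
  exact (smul_eq_zero.1 h).resolve_left hab

theorem linearIndependent_iff_qdet {a b : Qubit} :
    LinearIndependent ℂ ![a, b] ↔ qdet a b ≠ 0 := by
  constructor
  · intro h h0
    obtain ⟨t, ht⟩ := exists_smul_of_qdet (h.ne_zero 0) h0
    exact (LinearIndependent.pair_iff' (h.ne_zero 0)).1 h t ht.symm
  · intro h
    rw [LinearIndependent.pair_iff' (ne_zero_of_qdet_left h)]
    rintro t rfl
    rw [qdet_smul_right, qdet_self, mul_zero] at h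
    exact h rfl

theorem tp_add_left (a b c : Qubit) : tp (a + b) c = tp a c + tp b c := by
  funext s; simp [tp]; ring

theorem tp_add_right (a b c : Qubit) : tp a (b + c) = tp a b + tp a c := by
  funext s; simp [tp]; ring

theorem tp_smul_left (t : ℂ) (a b : Qubit) : tp (t • a) b = t • tp a b := by
  funext s; simp [tp]; ring

theorem tp_smul_right (t : ℂ) (a b : Qubit) : tp a (t • b) = t • tp a b := by
  funext s; simp [tp]; ring

theorem tp_eq_zero {a b : Qubit} : tp a b = 0 ↔ a = 0 ∨ b = 0 := by
  constructor
  · intro h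
    by_contra hne
    push Not at hne
    obtain ⟨i, hi⟩ := Function.ne_iff.1 hne.1
    obtain ⟨j, hj⟩ := Function.ne_iff.1 hne.2
    exact mul_ne_zero hi hj (congrFun h (i, j))
  · rintro (rfl | rfl) <;> (funext s; simp [tp])

/-- The product of the functionals `qdet a` and `qdet b` on two qubits. -/
def pairing (a b : Qubit) (s : Fin 2 × Fin 2 → ℂ) : ℂ :=
  a 0 * b 0 * s (1, 1) - a 0 * b 1 * s (1, 0) - a 1 * b 0 * s (0, 1) + a 1 * b 1 * s (0, 0)

theorem pairing_tp (a b p q : Qubit) : pairing a b (tp p q) = qdet a p * qdet b q := by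
  simp [pairing, tp, qdet]; ring

theorem pairing_add (a b : Qubit) (s t : Fin 2 × Fin 2 → ℂ) :
    pairing a b (s + t) = pairing a b s + pairing a b t := by
  simp [pairing]; ring

theorem pairing_smul (a b : Qubit) (c : ℂ) (s : Fin 2 × Fin 2 → ℂ) :
    pairing a b (c • s) = c * pairing a b s := by
  simp [pairing]; ring

/-! ### The kernel of `P` and its product vectors -/

theorem isStarProjection_eq_of_ker {X : Type*} [Fintype X] [DecidableEq X] {P Q : Matrix X X ℂ}
    (hP : IsStarProjection P) (hQ : IsStarProjection Q) (h : ∀ v, P *ᵥ v = 0 ↔ Q *ᵥ v = 0) :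
    P = Q := by
  have h1 : P = P * Q := by
    rw [Matrix.ext_iff_mulVec]
    intro v
    have : P *ᵥ (v - Q *ᵥ v) = 0 := by
      rw [h, Matrix.mulVec_sub, proj_mulVec_mulVec hQ, sub_self]
    rwa [Matrix.mulVec_sub, sub_eq_zero, Matrix.mulVec_mulVec] at this
  have h2 : Q = Q * P := by
    rw [Matrix.ext_iff_mulVec]
    intro v
    have : Q *ᵥ (v - P *ᵥ v) = 0 := by
      rw [← h, Matrix.mulVec_sub, proj_mulVec_mulVec hP, sub_self]
    rwa [Matrix.mulVec_sub, sub_eq_zero, Matrix.mulVec_mulVec] at this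
  have h3 := congrArg Matrix.conjTranspose h1
  rw [Matrix.conjTranspose_mul, proj_conjTranspose hP, proj_conjTranspose hQ, ← h2] at h3
  exact h3

theorem one_kronecker_mulVec (Q : Matrix (Fin 2) (Fin 2) ℂ) (s : Fin 2 × Fin 2 → ℂ)
    (i j : Fin 2) : (((1 : Matrix (Fin 2) (Fin 2) ℂ) ⊗ₖ Q) *ᵥ s) (i, j)
      = (Q *ᵥ fun k => s (i, k)) j := by
  simp only [Matrix.mulVec, dotProduct, Fintype.sum_prod_type, Matrix.kroneckerMap_apply,
    Matrix.one_apply, ite_mul, one_mul, zero_mul]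
  rw [Finset.sum_eq_single i]
  · simp
  · intro k _ hk; simp [hk.symm]
  · simp

theorem kronecker_one_mulVec (Q : Matrix (Fin 2) (Fin 2) ℂ) (s : Fin 2 × Fin 2 → ℂ)
    (i j : Fin 2) : ((Q ⊗ₖ (1 : Matrix (Fin 2) (Fin 2) ℂ)) *ᵥ s) (i, j)
      = (Q *ᵥ fun k => s (k, j)) i := by
  simp only [Matrix.mulVec, dotProduct, Fintype.sum_prod_type, Matrix.kroneckerMap_apply,
    Matrix.one_apply, mul_ite, mul_one, mul_zero, ite_mul, zero_mul]
  refine Finset.sum_congr rfl fun k _ => ?_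
  simp

/-- The operator `1 ⊗ Q`, with `Q` projecting onto the complement of `b`, has the kernel `ℂ² ⊗ b`,
and an orthogonal projection is determined by its kernel. -/
theorem isOneLocal_of_ker_right {P : TwoQubitOp} (hP : IsStarProjection P) {b : Qubit}
    (h : ∀ s, P *ᵥ s = 0 ↔ ∃ c, s = tp c b) : IsOneLocal P := by
  obtain ⟨Q, hQ, hk⟩ := exists_isStarProjection_ker (Submodule.span ℂ {b})
  refine ⟨Q, hQ, Or.inr (isStarProjection_eq_of_ker hP ?_ fun s => ?_)⟩
  · constructor
    · rw [IsIdempotentElem, ← Matrix.mul_kronecker_mul, hQ.isIdempotentElem.eq, one_mul]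
    · rw [IsSelfAdjoint, Matrix.star_eq_conjTranspose, Matrix.conjTranspose_kronecker,
        proj_conjTranspose hQ, Matrix.conjTranspose_one]
  · rw [h]
    have h2 : (1 : Matrix (Fin 2) (Fin 2) ℂ) ⊗ₖ Q *ᵥ s = 0 ↔ ∀ i, Q *ᵥ (fun k => s (i, k)) = 0 := by
      constructor
      · intro h0 i
        funext j
        rw [← one_kronecker_mulVec, h0]; rfl
      · intro h0
        funext ⟨i, j⟩
        rw [one_kronecker_mulVec, h0]; rfl
    rw [h2]
    simp only [hk, Submodule.mem_span_singleton]
    constructor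
    · rintro ⟨c, rfl⟩ i
      exact ⟨c i, rfl⟩
    · intro h0
      choose c hc using h0
      refine ⟨c, ?_⟩
      funext ⟨i, j⟩
      exact (congrFun (hc i) j).symm

theorem isOneLocal_of_ker_left {P : TwoQubitOp} (hP : IsStarProjection P) {a : Qubit}
    (h : ∀ s, P *ᵥ s = 0 ↔ ∃ c, s = tp a c) : IsOneLocal P := by
  obtain ⟨Q, hQ, hk⟩ := exists_isStarProjection_ker (Submodule.span ℂ {a})
  refine ⟨Q, hQ, Or.inl (isStarProjection_eq_of_ker hP ?_ fun s => ?_)⟩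
  · constructor
    · rw [IsIdempotentElem, ← Matrix.mul_kronecker_mul, hQ.isIdempotentElem.eq, one_mul]
    · rw [IsSelfAdjoint, Matrix.star_eq_conjTranspose, Matrix.conjTranspose_kronecker,
        proj_conjTranspose hQ, Matrix.conjTranspose_one]
  · rw [h]
    have h2 : Q ⊗ₖ (1 : Matrix (Fin 2) (Fin 2) ℂ) *ᵥ s = 0 ↔ ∀ j, Q *ᵥ (fun k => s (k, j)) = 0 := by
      constructor
      · intro h0 j
        funext i
        rw [← kronecker_one_mulVec, h0]; rfl
      · intro h0
        funext ⟨i, j⟩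
        rw [kronecker_one_mulVec, h0]; rfl
    rw [h2]
    simp only [hk, Submodule.mem_span_singleton]
    constructor
    · rintro ⟨c, rfl⟩ j
      exact ⟨c j, by funext i; simp [tp, mul_comm]⟩
    · intro h0
      choose c hc using h0
      refine ⟨c, ?_⟩
      funext ⟨i, j⟩
      rw [tp, mul_comm]
      exact (congrFun (hc j) i).symm

/-- The space of two-qubit vectors annihilated by `P`. -/
def kerSpace (P : TwoQubitOp) : Submodule ℂ (Fin 2 × Fin 2 → ℂ) := LinearMap.ker (Matrix.toLin' P)

theorem mem_kerSpace {P : TwoQubitOp} {s : Fin 2 × Fin 2 → ℂ} :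
    s ∈ kerSpace P ↔ P *ᵥ s = 0 := by
  rw [kerSpace, LinearMap.mem_ker, Matrix.toLin'_apply]

theorem finrank_kerSpace {P : TwoQubitOp} (hrank : P.rank = 2) :
    Module.finrank ℂ (kerSpace P) = 2 := by
  have h := LinearMap.finrank_range_add_finrank_ker (Matrix.toLin' P)
  have hr : Module.finrank ℂ (LinearMap.range (Matrix.toLin' P)) = 2 := hrank
  rw [hr, Module.finrank_fintype_fun_eq_card] at h
  simp only [Fintype.card_prod, Fintype.card_fin] at h
  rw [kerSpace]
  omega

theorem exists_basis_kerSpace {P : TwoQubitOp} (hrank : P.rank = 2) :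
    ∃ s₁ s₂ : Fin 2 × Fin 2 → ℂ, (∀ t r : ℂ, t • s₁ + r • s₂ = 0 → t = 0 ∧ r = 0) ∧
      ∀ s, P *ᵥ s = 0 ↔ ∃ t r : ℂ, s = t • s₁ + r • s₂ := by
  let B := Module.finBasisOfFinrankEq ℂ (kerSpace P) (finrank_kerSpace hrank)
  refine ⟨B 0, B 1, ?_, ?_⟩
  · intro t r h
    have hli := Fintype.linearIndependent_iff.1 B.linearIndependent ![t, r] (by
      rw [Fin.sum_univ_two]
      exact Subtype.ext h)
    exact ⟨hli 0, hli 1⟩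
  · intro s
    rw [← mem_kerSpace]
    constructor
    · intro hs
      have h := B.sum_repr ⟨s, hs⟩
      rw [Fin.sum_univ_two] at h
      exact ⟨_, _, (congrArg Subtype.val h).symm⟩
    · rintro ⟨t, r, rfl⟩
      exact Submodule.add_mem _ (Submodule.smul_mem _ _ (B 0).2) (Submodule.smul_mem _ _ (B 1).2)

theorem exists_tp_of_det {e : Fin 2 × Fin 2 → ℂ} (he : e ≠ 0)
    (h : e (0, 0) * e (1, 1) - e (0, 1) * e (1, 0) = 0) : ∃ a b : Qubit, e = tp a b := by
  obtain ⟨⟨i, j⟩, hij⟩ := Function.ne_iff.1 he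
  rw [Pi.zero_apply] at hij
  refine ⟨fun k => e (k, j), fun l => e (i, l) / e (i, j), ?_⟩
  funext ⟨k, l⟩
  rw [tp, mul_div_assoc', eq_div_iff hij]
  fin_cases i <;> fin_cases j <;> fin_cases k <;> fin_cases l <;>
    simp only [Fin.zero_eta, Fin.mk_one, Fin.isValue] <;>
    first | ring1 | linear_combination h | linear_combination -h

/-- A non-zero two-qubit vector is a product when its determinant `d` vanishes. Either `d s₂ = 0`,
or `d (s₁ + x s₂)` is a quadratic polynomial in `x` with leading coefficient `d s₂` and has a
complex root. -/
theorem exists_product_basis {P : TwoQubitOp} (hrank : P.rank = 2) :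
    ∃ (a b : Qubit) (g : Fin 2 × Fin 2 → ℂ), a ≠ 0 ∧ b ≠ 0 ∧
      (∀ t r : ℂ, t • tp a b + r • g = 0 → t = 0 ∧ r = 0) ∧
      ∀ s, P *ᵥ s = 0 ↔ ∃ t r : ℂ, s = t • tp a b + r • g := by
  obtain ⟨s₁, s₂, hli, hs⟩ := exists_basis_kerSpace hrank
  set d : (Fin 2 × Fin 2 → ℂ) → ℂ := fun e => e (0, 0) * e (1, 1) - e (0, 1) * e (1, 0) with hd
  suffices H : ∃ e g : Fin 2 × Fin 2 → ℂ, d e = 0 ∧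
      (∀ t r : ℂ, t • e + r • g = 0 → t = 0 ∧ r = 0) ∧
      ∀ s, P *ᵥ s = 0 ↔ ∃ t r : ℂ, s = t • e + r • g by
    obtain ⟨e, g, he, hli', hs'⟩ := H
    have he0 : e ≠ 0 := fun h0 => one_ne_zero (hli' 1 0 (by rw [h0]; simp)).1
    obtain ⟨a, b, rfl⟩ := exists_tp_of_det he0 he
    exact ⟨a, b, g, fun h => he0 (tp_eq_zero.2 (Or.inl h)),
      fun h => he0 (tp_eq_zero.2 (Or.inr h)), hli', hs'⟩
  by_cases h2 : d s₂ = 0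
  · refine ⟨s₂, s₁, h2, fun t r h => (hli r t (by rw [add_comm, h])).symm, fun s => ?_⟩
    rw [hs]
    constructor
    · rintro ⟨t, r, rfl⟩; exact ⟨r, t, add_comm _ _⟩
    · rintro ⟨t, r, rfl⟩; exact ⟨r, t, add_comm _ _⟩
  · set β := s₁ (0, 0) * s₂ (1, 1) + s₂ (0, 0) * s₁ (1, 1) - s₁ (0, 1) * s₂ (1, 0)
      - s₂ (0, 1) * s₁ (1, 0) with hβ
    obtain ⟨z, hz⟩ := IsAlgClosed.exists_pow_nat_eq (discrim (d s₂) β (d s₁)) (n := 2) (by norm_num)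
    obtain ⟨x, hx⟩ := exists_quadratic_eq_zero h2 ⟨z, by rw [← hz, sq]⟩
    refine ⟨s₁ + x • s₂, s₂, ?_, ?_, ?_⟩
    · rw [← hx, hβ]
      simp only [hd, Pi.add_apply, Pi.smul_apply, smul_eq_mul]
      ring
    · intro t r h
      have h' := hli t (t * x + r) (by rw [← h]; module)
      refine ⟨h'.1, ?_⟩
      have := h'.2
      rwa [h'.1, zero_mul, zero_add] at this
    · intro s
      rw [hs]
      constructor
      · rintro ⟨t, r, rfl⟩; exact ⟨t, r - t * x, by module⟩
      · rintro ⟨t, r, rfl⟩; exact ⟨t, t * x + r, by module⟩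

theorem exists_qdet_ne_zero {a : Qubit} (ha : a ≠ 0) : ∃ a', qdet a a' ≠ 0 := by
  obtain ⟨i, hi⟩ := Function.ne_iff.1 ha
  rw [Pi.zero_apply] at hi
  fin_cases i
  · exact ⟨![0, 1], by simpa [qdet] using hi⟩
  · exact ⟨![1, 0], by simpa [qdet] using hi⟩

theorem exists_tp_add_tp {a a' : Qubit} (h : qdet a a' ≠ 0) (g : Fin 2 × Fin 2 → ℂ) :
    ∃ u v : Qubit, g = tp a u + tp a' v := by
  refine ⟨fun j => qdet (fun i => g (i, j)) a' / qdet a a',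
    fun j => qdet a (fun i => g (i, j)) / qdet a a', ?_⟩
  funext ⟨i, j⟩
  have := congrFun (qdet_expand a a' fun i => g (i, j)) i
  simp only [Pi.smul_apply, Pi.add_apply, smul_eq_mul] at this
  simp only [Pi.add_apply, tp]
  field_simp
  linear_combination this

/-- The kernel of a rank two projector which is not one-local meets the set of product vectors in
two lines or is tangent to it. -/
theorem kernel_form {P : TwoQubitOp} (hP : IsStarProjection P) (hrank : P.rank = 2)
    (hloc : ¬ IsOneLocal P) :
    (∃ a b c d : Qubit, qdet a c ≠ 0 ∧ qdet b d ≠ 0 ∧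
      ∀ s, P *ᵥ s = 0 ↔ ∃ t r : ℂ, s = t • tp a b + r • tp c d) ∨
    ∃ a b x y : Qubit, qdet a y ≠ 0 ∧ qdet b x ≠ 0 ∧
      ∀ s, P *ᵥ s = 0 ↔ ∃ t r : ℂ, s = t • tp a b + r • (tp a x + tp y b) := by
  obtain ⟨a, b, g, ha, hb, hli, hs⟩ := exists_product_basis hrank
  obtain ⟨a', ha'⟩ := exists_qdet_ne_zero ha
  obtain ⟨u, v, rfl⟩ := exists_tp_add_tp ha' g
  -- Write `g = a ⊗ u + a' ⊗ v`. If `v = 0` the kernel is `a ⊗ ℂ²`; if `u` and `v ≠ 0` are both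
  -- along `b` it is `ℂ² ⊗ b`; if only `v ≠ 0` is along `b` the line is tangent. If `v` is not along
  -- `b`, subtracting a multiple of `a ⊗ b` from `g` leaves a second product with right factor `v`.
  by_cases hv : qdet b v = 0
  · obtain ⟨ν, rfl⟩ := exists_smul_of_qdet hb hv
    by_cases hν : ν = 0
    · refine (hloc (isOneLocal_of_ker_left hP (a := a) fun s => ?_)).elim
      have hu : qdet b u ≠ 0 := by
        intro h0
        obtain ⟨μ, rfl⟩ := exists_smul_of_qdet hb h0
        refine one_ne_zero (hli (-μ) 1 ?_).2
        rw [hν, tp_smul_right, zero_smul, tp_eq_zero.2 (Or.inr rfl)]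
        module
      rw [hs, hν]
      constructor
      · rintro ⟨t, r, rfl⟩
        refine ⟨t • b + r • u, ?_⟩
        rw [zero_smul, tp_eq_zero.2 (Or.inr rfl), tp_add_right, tp_smul_right, tp_smul_right,
          add_zero]
      · rintro ⟨c, rfl⟩
        have hc : c = (qdet c u / qdet b u) • b + (qdet b c / qdet b u) • u := by
          have := qdet_expand b u c
          rw [div_eq_inv_mul, div_eq_inv_mul, mul_smul, mul_smul, ← smul_add, ← this, smul_smul,
            inv_mul_cancel₀ hu, one_smul]
        refine ⟨qdet c u / qdet b u, qdet b c / qdet b u, ?_⟩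
        conv_lhs => rw [hc]
        rw [zero_smul, tp_eq_zero.2 (Or.inr rfl), tp_add_right, tp_smul_right, tp_smul_right,
          add_zero]
    · by_cases hu : qdet b u = 0
      · obtain ⟨μ, rfl⟩ := exists_smul_of_qdet hb hu
        refine (hloc (isOneLocal_of_ker_right hP (b := b) fun s => ?_)).elim
        rw [hs]
        constructor
        · rintro ⟨t, r, rfl⟩
          refine ⟨(t + r * μ) • a + (r * ν) • a', ?_⟩
          simp only [tp_add_left, tp_smul_left, tp_smul_right]
          module
        · rintro ⟨c, rfl⟩
          have hc : c = (qdet c a' / qdet a a') • a + (qdet a c / qdet a a') • a' := by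
            have := qdet_expand a a' c
            rw [div_eq_inv_mul, div_eq_inv_mul, mul_smul, mul_smul, ← smul_add, ← this, smul_smul,
              inv_mul_cancel₀ ha', one_smul]
          set x := qdet c a' / qdet a a'
          set y := qdet a c / qdet a a'
          refine ⟨x - y / ν * μ, y / ν, ?_⟩
          rw [hc]
          simp only [tp_add_left, tp_smul_left, tp_smul_right]
          have : y / ν * ν = y := by field_simp
          rw [smul_add, smul_smul, smul_smul, this]
          module
      · refine Or.inr ⟨a, b, u, ν • a', ?_, hu, fun s => ?_⟩
        · rw [qdet_smul_right]; exact mul_ne_zero hν ha'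
        · rw [hs, tp_smul_left, tp_smul_right]
  · refine Or.inl ⟨a, b, (qdet b u / qdet b v) • a + a', v, ?_, hv, fun s => ?_⟩
    · rw [qdet_add_right, qdet_smul_right, qdet_self, mul_zero, zero_add]; exact ha'
    · have hu : u = (qdet u v / qdet b v) • b + (qdet b u / qdet b v) • v := by
        have := qdet_expand b v u
        rw [div_eq_inv_mul, div_eq_inv_mul, mul_smul, mul_smul, ← smul_add, ← this, smul_smul,
          inv_mul_cancel₀ hv, one_smul]
      set μ := qdet u v / qdet b v
      set κ := qdet b u / qdet b v
      rw [hs, hu]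
      simp only [tp_add_left, tp_add_right, tp_smul_left, tp_smul_right]
      constructor
      · rintro ⟨t, r, rfl⟩; exact ⟨t + r * μ, r, by module⟩
      · rintro ⟨t, r, rfl⟩; exact ⟨t - r * μ, r, by module⟩

theorem exists_separating {P : TwoQubitOp} (hP : IsStarProjection P) (hrank : P.rank = 2)
    (hloc : ¬ IsOneLocal P) : ∃ θ, Separating P θ := by
  have ind : ∀ {a c : Qubit} {t r : ℂ}, qdet a c ≠ 0 → (∀ i, t * a i + r * c i = 0) →
      t = 0 ∧ r = 0 := by
    intro a c t r h hi
    have h0 := hi 0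
    have h1 := hi 1
    constructor
    · refine (mul_eq_zero.1 (?_ : t * qdet a c = 0)).resolve_right h
      simp only [qdet]; linear_combination c 1 * h0 - c 0 * h1
    · refine (mul_eq_zero.1 (?_ : r * qdet a c = 0)).resolve_right h
      simp only [qdet]; linear_combination a 0 * h1 - a 1 * h0
  rcases kernel_form hP hrank hloc with ⟨a, b, c, d, hac, hbd, hs⟩ | ⟨a, b, x, y, hay, hbx, hs⟩
  -- This functional takes the same non-zero value `qdet b d` on `b` and on `d`, so the contraction
  -- is `qdet b d` times `t a + r c`.
  · refine ⟨![d 1 - b 1, b 0 - d 0], fun s h0 h => ?_⟩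
    obtain ⟨t, r, rfl⟩ := (hs s).1 h0
    have := ind (t := t * qdet b d) (r := r * qdet b d) hac fun i => by
      have := h i
      simp only [Fin.sum_univ_two, tp, Pi.add_apply, Pi.smul_apply, smul_eq_mul,
        Matrix.cons_val_zero, Matrix.cons_val_one] at this
      simp only [qdet]
      linear_combination this
    rw [(mul_eq_zero.1 this.1).resolve_right hbd, (mul_eq_zero.1 this.2).resolve_right hbd]
    simp
  -- This functional is `qdet · x`: it kills `x`, and the contraction is `qdet b x` times `t a + r
  -- y`.
  · refine ⟨![x 1, -x 0], fun s h0 h => ?_⟩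
    obtain ⟨t, r, rfl⟩ := (hs s).1 h0
    have := ind (t := t * qdet b x) (r := r * qdet b x) hay fun i => by
      have := h i
      simp only [Fin.sum_univ_two, tp, Pi.add_apply, Pi.smul_apply, smul_eq_mul,
        Matrix.cons_val_zero, Matrix.cons_val_one] at this
      simp only [qdet]
      linear_combination this
    rw [(mul_eq_zero.1 this.1).resolve_right hbx, (mul_eq_zero.1 this.2).resolve_right hbx]
    simp

/-! ### Zero-energy states of four qubits -/

section FourSites

variable {P : TwoQubitOp} {ψ : Vec 4}

theorem slice_zero_one (hP : IsStarProjection P) (hψ : ψ ∈ nullSpace P 4) (k l : Fin 2) :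
    P *ᵥ (fun s => ψ ![s.1, s.2, k, l]) = 0 := by
  have h := (localTerm_mulVec_eq_zero_iff P _ _).1 ((mem_nullSpace_iff hP).1 hψ 0) ![0, 0, k, l]
  rw [← h]
  congr 1
  funext s
  rw [pairSlice]
  congr 1
  funext i
  fin_cases i <;> simp [Function.update]

theorem slice_one_two (hP : IsStarProjection P) (hψ : ψ ∈ nullSpace P 4) (i l : Fin 2) :
    P *ᵥ (fun s => ψ ![i, s.1, s.2, l]) = 0 := by
  have h := (localTerm_mulVec_eq_zero_iff P _ _).1 ((mem_nullSpace_iff hP).1 hψ 1) ![i, 0, 0, l]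
  rw [← h]
  congr 1
  funext s
  rw [pairSlice]
  congr 1
  funext i
  fin_cases i <;> simp [Function.update]

theorem slice_two_three (hP : IsStarProjection P) (hψ : ψ ∈ nullSpace P 4) (i j : Fin 2) :
    P *ᵥ (fun s => ψ ![i, j, s.1, s.2]) = 0 := by
  have h := (localTerm_mulVec_eq_zero_iff P _ _).1 ((mem_nullSpace_iff hP).1 hψ 2) ![i, j, 0, 0]
  rw [← h]
  congr 1
  funext s
  rw [pairSlice]
  congr 1
  funext i
  fin_cases i <;> simp [Function.update]

theorem mulVec_pairing_eq_zero {T : Fin 2 → Fin 2 → Fin 2 × Fin 2 → ℂ}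
    (h : ∀ i j, P *ᵥ T i j = 0) (p q : Qubit) :
    P *ᵥ (fun s => pairing p q fun r => T r.1 r.2 s) = 0 := by
  have : (fun s => pairing p q fun r => T r.1 r.2 s) = (p 0 * q 0) • T 1 1 - (p 0 * q 1) • T 1 0
      - (p 1 * q 0) • T 0 1 + (p 1 * q 1) • T 0 0 := by
    funext s
    simp only [pairing, Pi.add_apply, Pi.sub_apply, Pi.smul_apply, smul_eq_mul]
  rw [this]
  simp only [Matrix.mulVec_add, Matrix.mulVec_sub, Matrix.mulVec_smul, h]
  simp

theorem eq_of_apply_four {φ : Vec 4} (h : ∀ i j k l, ψ ![i, j, k, l] = φ ![i, j, k, l]) :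
    ψ = φ := by
  funext x
  have : x = ![x 0, x 1, x 2, x 3] := by
    funext i
    fin_cases i <;> rfl
  rw [this]
  exact h _ _ _ _

theorem prodState_four (a b c d : Qubit) (i j k l : Fin 2) :
    prodState ![a, b, c, d] ![i, j, k, l] = a i * b j * c k * d l := by
  simp [prodState, Fin.prod_univ_four]

/-- If the kernel of `P` is spanned by `g` and `e`, then the four-qubit zero energy states are
spanned by the four products of these. -/
theorem exists_coeff_of_mem_nullSpace {g e : Fin 2 × Fin 2 → ℂ} {p q p' q' : Qubit}
    (hP : IsStarProjection P)
    (hs : ∀ s, P *ᵥ s = 0 ↔ ∃ t r : ℂ, s = t • g + r • e)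
    (hg : pairing p q g ≠ 0) (he : pairing p q e = 0)
    (he' : pairing p' q' e ≠ 0) (hg' : pairing p' q' g = 0) (hψ : ψ ∈ nullSpace P 4) :
    ∃ t r t' r' : ℂ, ∀ i j k l, ψ ![i, j, k, l] =
      t * (g (i, j) * g (k, l)) + r * (g (i, j) * e (k, l)) + t' * (e (i, j) * g (k, l))
        + r' * (e (i, j) * e (k, l)) := by
  have h1 := slice_zero_one hP hψ
  choose u w huw using fun k l => (hs _).1 (h1 k l)
  have huw' : ∀ i j k l, ψ ![i, j, k, l] = u k l * g (i, j) + w k l * e (i, j) :=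
    fun i j k l => congrFun (huw k l) (i, j)
  have h3 := fun p q => mulVec_pairing_eq_zero (slice_two_three hP hψ) p q
  -- The functional `pairing p q` on the first two qubits kills `e` but not `g`. It isolates the
  -- coefficient of `g`, which the last bond places in the kernel of `P`.
  have hu : P *ᵥ (fun s => u s.1 s.2) = 0 := by
    have h := h3 p q
    have e1 : (fun s : Fin 2 × Fin 2 => pairing p q fun r => ψ ![r.1, r.2, s.1, s.2])
        = pairing p q g • fun s => u s.1 s.2 := by
      funext s
      have : (fun r : Fin 2 × Fin 2 => ψ ![r.1, r.2, s.1, s.2]) = u s.1 s.2 • g + w s.1 s.2 • e :=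
        huw s.1 s.2
      rw [this, pairing_add, pairing_smul, pairing_smul, he, mul_zero, add_zero, mul_comm]
      rfl
    rw [e1, Matrix.mulVec_smul] at h
    exact (smul_eq_zero.1 h).resolve_left hg
  have hw : P *ᵥ (fun s => w s.1 s.2) = 0 := by
    have h := h3 p' q'
    have e1 : (fun s : Fin 2 × Fin 2 => pairing p' q' fun r => ψ ![r.1, r.2, s.1, s.2])
        = pairing p' q' e • fun s => w s.1 s.2 := by
      funext s
      have : (fun r : Fin 2 × Fin 2 => ψ ![r.1, r.2, s.1, s.2]) = u s.1 s.2 • g + w s.1 s.2 • e :=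
        huw s.1 s.2
      rw [this, pairing_add, pairing_smul, pairing_smul, hg', mul_zero, zero_add, mul_comm]
      rfl
    rw [e1, Matrix.mulVec_smul] at h
    exact (smul_eq_zero.1 h).resolve_left he'
  obtain ⟨t, r, h⟩ := (hs _).1 hu
  obtain ⟨t', r', h'⟩ := (hs _).1 hw
  refine ⟨t, r, t', r', fun i j k l => ?_⟩
  rw [huw', show u k l = _ from congrFun h (k, l), show w k l = _ from congrFun h' (k, l)]
  simp only [Pi.add_apply, Pi.smul_apply, smul_eq_mul]
  ring

theorem mulVec_middle_eq_zero (hP : IsStarProjection P) (hψ : ψ ∈ nullSpace P 4) (p q : Qubit) :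
    P *ᵥ (fun s => pairing p q fun r => ψ ![r.1, s.1, s.2, r.2]) = 0 :=
  mulVec_pairing_eq_zero (T := fun i l s => ψ ![i, s.1, s.2, l]) (slice_one_two hP hψ) p q

end FourSites

section TwoPoint

variable {P : TwoQubitOp} {a b c d : Qubit}

theorem pairing_eq_zero_of_two_point
    (hs : ∀ s, P *ᵥ s = 0 ↔ ∃ t r : ℂ, s = t • tp a b + r • tp c d) {s : Fin 2 × Fin 2 → ℂ}
    (h : P *ᵥ s = 0) : pairing a d s = 0 ∧ pairing c b s = 0 := by
  obtain ⟨t, r, rfl⟩ := (hs s).1 h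
  simp [pairing_add, pairing_smul, pairing_tp, qdet_self]

/-- A ground state combines `abab`, `abcd`, `cdab` and `cdcd`. A pairing of the outer qubits
isolates one of these and leaves the product of its two middle factors, which the middle bond must
annihilate. Testing with `pairing a d` and `pairing c b`, which vanish on the kernel, excludes
`abcd` and `cdab` outright and allows the other two only under the stated coincidences of
directions. -/
theorem nullSpace_four_of_two_point (hP : IsStarProjection P) (hac : qdet a c ≠ 0)
    (hbd : qdet b d ≠ 0) (hs : ∀ s, P *ᵥ s = 0 ↔ ∃ t r : ℂ, s = t • tp a b + r • tp c d)
    {ψ : Vec 4} (hψ : ψ ∈ nullSpace P 4) :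
    ∃ t r : ℂ, ψ = t • prodState ![a, b, a, b] + r • prodState ![c, d, c, d] ∧
      (t = 0 ∨ qdet a b = 0 ∨ qdet d a = 0 ∧ qdet c b = 0) ∧
      (r = 0 ∨ qdet d c = 0 ∨ qdet d a = 0 ∧ qdet c b = 0) := by
  have hca : qdet c a ≠ 0 := fun h => hac (qdet_eq_zero_comm.1 h)
  have hdb : qdet d b ≠ 0 := fun h => hbd (qdet_eq_zero_comm.1 h)
  have ha := ne_zero_of_qdet_left hac
  have hb := ne_zero_of_qdet_left hbd
  have hc := ne_zero_of_qdet_right hac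
  have hd := ne_zero_of_qdet_right hbd
  obtain ⟨t, r, t', r', hT⟩ := exists_coeff_of_mem_nullSpace (p := c) (q := d) (p' := a) (q' := b)
    hP hs (by rw [pairing_tp]; exact mul_ne_zero hca hdb)
    (by rw [pairing_tp, qdet_self, zero_mul]) (by rw [pairing_tp]; exact mul_ne_zero hac hbd)
    (by rw [pairing_tp, qdet_self, zero_mul]) hψ
  have hm := mulVec_middle_eq_zero hP hψ
  simp only [hT] at hm
  have key : ∀ {z : ℂ} {x y : Qubit} {S : Fin 2 × Fin 2 → ℂ}, P *ᵥ S = 0 → S = z • tp x y →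
      z ≠ 0 → qdet a x * qdet d y = 0 ∧ qdet c x * qdet b y = 0 := by
    intro z x y S h h1 hz
    rw [h1, Matrix.mulVec_smul] at h
    rw [← pairing_tp, ← pairing_tp]
    exact pairing_eq_zero_of_two_point hs ((smul_eq_zero.1 h).resolve_left hz)
  have hr : r = 0 := by
    by_contra hr
    obtain ⟨h1, h2⟩ := key (hm c b) (z := r * (qdet c a * qdet b d)) (x := b) (y := c)
      (by funext s; simp [pairing, qdet, tp]; ring)
      (mul_ne_zero hr (mul_ne_zero hca hbd))
    have hbc : qdet b c = 0 := by
      rcases mul_eq_zero.1 h2 with h | h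
      · exact qdet_eq_zero_comm.1 h
      · exact h
    rcases mul_eq_zero.1 h1 with h | h
    · exact hac (qdet_trans hb (qdet_eq_zero_comm.1 h) hbc)
    · exact hbd (qdet_trans hc (qdet_eq_zero_comm.1 hbc) (qdet_eq_zero_comm.1 h))
  have ht' : t' = 0 := by
    by_contra hr
    obtain ⟨h1, h2⟩ := key (hm a d) (z := t' * (qdet a c * qdet d b)) (x := d) (y := a)
      (by funext s; simp [pairing, qdet, tp]; ring)
      (mul_ne_zero hr (mul_ne_zero hac hdb))
    have had : qdet a d = 0 := by
      rcases mul_eq_zero.1 h1 with h | h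
      · exact h
      · exact qdet_eq_zero_comm.1 h
    rcases mul_eq_zero.1 h2 with h | h
    · exact hac (qdet_trans hd (qdet_eq_zero_comm.1 had) (qdet_eq_zero_comm.1 h))
    · exact hbd (qdet_trans ha (qdet_eq_zero_comm.1 h) had)
  refine ⟨t, r', ?_, ?_, ?_⟩
  · refine eq_of_apply_four fun i j k l => ?_
    rw [hT, hr, ht']
    simp only [Pi.add_apply, Pi.smul_apply, smul_eq_mul, prodState_four, tp]
    ring
  · by_contra hne
    push Not at hne
    obtain ⟨h0, h1, h2⟩ := hne
    obtain ⟨h3, h4⟩ := key (hm c d) (z := t * (qdet c a * qdet d b)) (x := b) (y := a)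
      (by funext s; simp [pairing, qdet, tp]; ring)
      (mul_ne_zero h0 (mul_ne_zero hca hdb))
    refine h2 ((mul_eq_zero.1 h3).resolve_left h1) ((mul_eq_zero.1 h4).resolve_right fun h => ?_)
    exact h1 (qdet_eq_zero_comm.1 h)
  · by_contra hne
    push Not at hne
    obtain ⟨h0, h1, h2⟩ := hne
    obtain ⟨h3, h4⟩ := key (hm a b) (z := r' * (qdet a c * qdet b d)) (x := d) (y := c)
      (by funext s; simp [pairing, qdet, tp]; ring)
      (mul_ne_zero h0 (mul_ne_zero hac hbd))
    have h1' : qdet c d ≠ 0 := fun h => h1 (qdet_eq_zero_comm.1 h)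
    refine h2 (qdet_eq_zero_comm.1 ((mul_eq_zero.1 h3).resolve_right h1))
      (qdet_eq_zero_comm.1 ((mul_eq_zero.1 h4).resolve_left h1'))

end TwoPoint

/-- The functional `pairing a b` vanishes on the kernel but not on `b ⊗ a`, so no non-zero multiple
of `b ⊗ a` is allowed on the middle bond. Suitable pairings of the outer qubits produce exactly such
multiples and remove the four coefficients one after the other. -/
theorem nullSpace_four_of_tangent {P : TwoQubitOp} (hP : IsStarProjection P) {a b x y : Qubit}
    (hay : qdet a y ≠ 0) (hbx : qdet b x ≠ 0) (hab : qdet a b ≠ 0)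
    (hs : ∀ s, P *ᵥ s = 0 ↔ ∃ t r : ℂ, s = t • tp a b + r • (tp a x + tp y b)) :
    nullSpace P 4 = ⊥ := by
  rw [Submodule.eq_bot_iff]
  intro ψ hψ
  have hya : qdet y a ≠ 0 := fun h => hay (qdet_eq_zero_comm.1 h)
  have hxb : qdet x b ≠ 0 := fun h => hbx (qdet_eq_zero_comm.1 h)
  have hba : qdet b a ≠ 0 := fun h => hab (qdet_eq_zero_comm.1 h)
  obtain ⟨t, r, t', r', hT⟩ := exists_coeff_of_mem_nullSpace (p := y) (q := x) (p' := a) (q' := x)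
    hP hs (by rw [pairing_tp]; exact mul_ne_zero hya hxb)
    (by simp [pairing_add, pairing_tp, qdet_self])
    (by simp [pairing_add, pairing_tp, qdet_self, hay, hxb])
    (by rw [pairing_tp, qdet_self, zero_mul]) hψ
  have hm := mulVec_middle_eq_zero hP hψ
  simp only [hT] at hm
  have key : ∀ {z : ℂ} {S : Fin 2 × Fin 2 → ℂ}, P *ᵥ S = 0 → S = z • tp b a → z = 0 := by
    intro z S h h1
    obtain ⟨τ, ρ, h2⟩ := (hs _).1 h
    have h3 := congrArg (pairing a b) (h1.symm.trans h2)
    simp only [pairing_add, pairing_smul, pairing_tp, qdet_self, zero_mul, mul_zero,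
      add_zero] at h3
    exact (mul_eq_zero.1 h3).resolve_right (mul_ne_zero hab hba)
  have hr' : r' = 0 := by
    refine (mul_eq_zero.1 (key (hm a b) (z := r' * (qdet a y * qdet b x)) ?_)).resolve_right
      (mul_ne_zero hay hbx)
    funext s; simp [pairing, qdet, tp]; ring
  simp only [hr', zero_mul, add_zero] at hm
  have ht' : t' = 0 := by
    refine (mul_eq_zero.1 (key (hm a x) (z := t' * (qdet a y * qdet x b)) ?_)).resolve_right
      (mul_ne_zero hay hxb)
    funext s; simp [pairing, qdet, tp]; ring
  simp only [ht', zero_mul, add_zero] at hm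
  have hr : r = 0 := by
    refine (mul_eq_zero.1 (key (hm y b) (z := r * (qdet y a * qdet b x)) ?_)).resolve_right
      (mul_ne_zero hya hbx)
    funext s; simp [pairing, qdet, tp]; ring
  simp only [hr, zero_mul, add_zero] at hm
  have ht : t = 0 := by
    refine (mul_eq_zero.1 (key (hm y x) (z := t * (qdet y a * qdet x b)) ?_)).resolve_right
      (mul_ne_zero hya hxb)
    funext s; simp [pairing, qdet, tp]; ring
  refine eq_of_apply_four fun i j k l => ?_
  rw [hT, hr, ht, hr', ht']
  simp

/-! ### Normal forms and classification -/

/-- `P` annihilates `|αα⟩`, and there is at most one zero energy state of four qubits. -/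
def OneProduct (P : TwoQubitOp) : Prop :=
  ∃ a : Qubit, nrm a = 1 ∧ P *ᵥ tp a a = 0 ∧ Module.finrank ℂ (nullSpace P 4) ≤ 1

/-- `P` annihilates `|αα⟩` and `|ββ⟩`. -/
def TwoProducts (P : TwoQubitOp) : Prop :=
  ∃ a b : Qubit, nrm a = 1 ∧ nrm b = 1 ∧ qdet a b ≠ 0 ∧ P *ᵥ tp a a = 0 ∧ P *ᵥ tp b b = 0

/-- `P` annihilates `|αβ⟩` and `|βα⟩`. -/
def AlternatingProducts (P : TwoQubitOp) : Prop :=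
  ∃ a b : Qubit, nrm a = 1 ∧ nrm b = 1 ∧ qdet a b ≠ 0 ∧ P *ᵥ tp a b = 0 ∧ P *ᵥ tp b a = 0

/-- `P` annihilates `|αα⟩` and `|α'α⟩ + f |αα'⟩`. -/
def SingleExcitation (P : TwoQubitOp) (f : ℂ) : Prop :=
  f ≠ 0 ∧ ∃ a a' : Qubit, nrm a = 1 ∧ nrm a' = 1 ∧ ip a a' = 0 ∧ P *ᵥ tp a a = 0 ∧
    P *ᵥ (tp a' a + f • tp a a') = 0

theorem exists_nrm_smul_eq_one {a : Qubit} (ha : a ≠ 0) : ∃ t : ℂ, t ≠ 0 ∧ nrm (t • a) = 1 := by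
  have h : nrm a ≠ 0 := fun h => ha (nrm_eq_zero.1 h)
  refine ⟨((nrm a)⁻¹ : ℝ), by simpa using h, ?_⟩
  rw [nrm_eq_one_iff, ip_smul_left, ip_smul_right, ip_self]
  simp only [Complex.star_def, Complex.conj_ofReal]
  norm_cast
  field_simp

theorem finrank_le_one_of_forall {P : TwoQubitOp} {n : ℕ} (v : Vec n)
    (h : ∀ ψ ∈ nullSpace P n, ∃ t : ℂ, ψ = t • v) : Module.finrank ℂ (nullSpace P n) ≤ 1 := by
  refine (Submodule.finrank_mono (t := Submodule.span ℂ {v}) fun ψ hψ => ?_).trans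
    ((finrank_span_le_card ({v} : Set (Vec n))).trans (by simp))
  obtain ⟨t, rfl⟩ := h ψ hψ
  exact Submodule.smul_mem _ _ (Submodule.mem_span_singleton_self v)

theorem exists_orthonormal {a : Qubit} (ha : nrm a = 1) :
    ∃ a' : Qubit, nrm a' = 1 ∧ ip a a' = 0 ∧ qdet a a' ≠ 0 := by
  have h1 := nrm_eq_one_iff.1 ha
  simp only [ip, dotProduct, Fin.sum_univ_two, Pi.star_apply] at h1
  refine ⟨![-star (a 1), star (a 0)], nrm_eq_one_iff.2 ?_, ?_, ?_⟩
  · simp only [ip, dotProduct, Fin.sum_univ_two, Pi.star_apply, Matrix.cons_val_zero,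
      Matrix.cons_val_one, star_neg, star_star]
    linear_combination h1
  · simp only [ip, dotProduct, Fin.sum_univ_two, Pi.star_apply, Matrix.cons_val_zero,
      Matrix.cons_val_one]
    ring
  · have : qdet a ![-star (a 1), star (a 0)] = 1 := by
      simp only [qdet, Matrix.cons_val_zero, Matrix.cons_val_one]
      linear_combination h1
    rw [this]; exact one_ne_zero

theorem mulVec_tp_smul {P : TwoQubitOp} {a b : Qubit} (h : P *ᵥ tp a b = 0) (t r : ℂ) :
    P *ᵥ tp (t • a) (r • b) = 0 := by
  rw [tp_smul_left, tp_smul_right, Matrix.mulVec_smul, Matrix.mulVec_smul, h, smul_zero, smul_zero]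

theorem oneProduct_of_smul {P : TwoQubitOp} {a b : Qubit} (ha : a ≠ 0) (hb : b ≠ 0)
    (h : qdet a b = 0) (hP : P *ᵥ tp a b = 0) :
    ∃ t : ℂ, t ≠ 0 ∧ nrm (t • a) = 1 ∧ P *ᵥ tp (t • a) (t • a) = 0 := by
  obtain ⟨t, ht, h1⟩ := exists_nrm_smul_eq_one ha
  obtain ⟨s, rfl⟩ := exists_smul_of_qdet hb (qdet_eq_zero_comm.1 h)
  refine ⟨t, ht, h1, ?_⟩
  have := mulVec_tp_smul hP t (t * s)
  rwa [mul_smul] at this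

/-- For two product points the outcome depends on which of the proportionalities `a ∥ b`, `c ∥ d`,
or jointly `a ∥ d` and `b ∥ c`, hold. In the tangent case it depends on whether `a ∥ b`. -/
theorem classification {P : TwoQubitOp} (hP : IsStarProjection P) (hrank : P.rank = 2)
    (hloc : ¬ IsOneLocal P) :
    OneProduct P ∨ TwoProducts P ∨ AlternatingProducts P ∨ (∃ f, SingleExcitation P f) ∨
      Case5 P := by
  rcases kernel_form hP hrank hloc with ⟨a, b, c, d, hac, hbd, hs⟩ | ⟨a, b, x, y, hay, hbx, hs⟩
  · have hnull := fun ψ hψ => nullSpace_four_of_two_point hP hac hbd hs (ψ := ψ) hψ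
    have ha := ne_zero_of_qdet_left hac
    have hb := ne_zero_of_qdet_left hbd
    have hc := ne_zero_of_qdet_right hac
    have hd := ne_zero_of_qdet_right hbd
    have hPab : P *ᵥ tp a b = 0 := (hs _).2 ⟨1, 0, by simp⟩
    have hPcd : P *ᵥ tp c d = 0 := (hs _).2 ⟨0, 1, by simp⟩
    by_cases h3 : qdet d a = 0 ∧ qdet c b = 0
    · obtain ⟨t, ht, ht1⟩ := exists_nrm_smul_eq_one ha
      obtain ⟨r, hr, hr1⟩ := exists_nrm_smul_eq_one hc
      obtain ⟨β, rfl⟩ := exists_smul_of_qdet hc h3.2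
      obtain ⟨δ, rfl⟩ := exists_smul_of_qdet ha (qdet_eq_zero_comm.1 h3.1)
      have hβ : β ≠ 0 := by rintro rfl; simp at hb
      have hδ : δ ≠ 0 := by rintro rfl; simp at hd
      refine Or.inr (Or.inr (Or.inl ⟨t • a, r • c, ht1, hr1, ?_, ?_, ?_⟩))
      · rw [qdet_smul_left, qdet_smul_right]; exact mul_ne_zero ht (mul_ne_zero hr hac)
      · have := mulVec_tp_smul hPab t (r / β)
        rwa [smul_smul, div_mul_cancel₀ _ hβ] at this
      · have := mulVec_tp_smul hPcd r (t / δ)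
        rwa [smul_smul, div_mul_cancel₀ _ hδ] at this
    by_cases h1 : qdet a b = 0
    · obtain ⟨t, ht, ht1, ht2⟩ := oneProduct_of_smul ha hb h1 hPab
      by_cases h2 : qdet d c = 0
      · obtain ⟨r, hr, hr1, hr2⟩ := oneProduct_of_smul hc hd (qdet_eq_zero_comm.1 h2) hPcd
        refine Or.inr (Or.inl ⟨t • a, r • c, ht1, hr1, ?_, ht2, hr2⟩)
        rw [qdet_smul_left, qdet_smul_right]; exact mul_ne_zero ht (mul_ne_zero hr hac)
      · refine Or.inl ⟨t • a, ht1, ht2, finrank_le_one_of_forall (prodState ![a, b, a, b])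
          fun ψ hψ => ?_⟩
        obtain ⟨τ, ρ, h, -, h'⟩ := hnull ψ hψ
        simp only [h2, h3, or_false] at h'
        exact ⟨τ, by rw [h, h', zero_smul, add_zero]⟩
    · by_cases h2 : qdet d c = 0
      · obtain ⟨r, hr, hr1, hr2⟩ := oneProduct_of_smul hc hd (qdet_eq_zero_comm.1 h2) hPcd
        refine Or.inl ⟨r • c, hr1, hr2, finrank_le_one_of_forall (prodState ![c, d, c, d])
          fun ψ hψ => ?_⟩
        obtain ⟨τ, ρ, h, h', -⟩ := hnull ψ hψ
        simp only [h1, h3, or_false] at h'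
        exact ⟨ρ, by rw [h, h', zero_smul, zero_add]⟩
      · refine Or.inr (Or.inr (Or.inr (Or.inr ((Submodule.eq_bot_iff _).2 fun ψ hψ => ?_))))
        obtain ⟨τ, ρ, h, h', h''⟩ := hnull ψ hψ
        simp only [h1, h2, h3, or_false] at h' h''
        rw [h, h', h'', zero_smul, zero_smul, add_zero]
  · by_cases hab : qdet a b = 0
    · refine Or.inr (Or.inr (Or.inr (Or.inl ?_)))
      have ha := ne_zero_of_qdet_left hay
      have hb := ne_zero_of_qdet_left hbx
      obtain ⟨t, ht, ht1, ht2⟩ := oneProduct_of_smul ha hb hab ((hs _).2 ⟨1, 0, by simp⟩)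
      obtain ⟨a', ha', h0, hd⟩ := exists_orthonormal ht1
      obtain ⟨β, rfl⟩ := exists_smul_of_qdet ha hab
      have hβ : β ≠ 0 := by rintro rfl; simp at hb
      rw [qdet_smul_left] at hd hbx
      have hd' := right_ne_zero_of_mul hd
      have hx' := right_ne_zero_of_mul hbx
      have expand : ∀ v, v = (qdet v a' / qdet a a') • a + (qdet a v / qdet a a') • a' := by
        intro v
        rw [div_eq_inv_mul, div_eq_inv_mul, mul_smul, mul_smul, ← smul_add, ← qdet_expand, smul_smul,
          inv_mul_cancel₀ hd', one_smul]
      have hx := expand x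
      have hy := expand y
      set x1 := qdet x a' / qdet a a'
      set y1 := qdet y a' / qdet a a'
      have hx2 : qdet a x / qdet a a' ≠ 0 := div_ne_zero hx' hd'
      have hy2 : qdet a y / qdet a a' ≠ 0 := div_ne_zero hay hd'
      set x2 := qdet a x / qdet a a'
      set y2 := qdet a y / qdet a a'
      -- With `b = β a`, the tangent vector `a ⊗ x + y ⊗ b` equals `x2 a ⊗ a' + y2 β a' ⊗ a` modulo
      -- `a ⊗ a`; `f` is the ratio of these coefficients.
      refine ⟨x2 / (y2 * β), div_ne_zero hx2 (mul_ne_zero hy2 hβ), t • a, a', ht1, ha', h0, ht2, ?_⟩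
      rw [hs]
      refine ⟨-(t / (y2 * β)) * (x1 / β + y1), t / (y2 * β), ?_⟩
      conv_rhs => rw [hx, hy]
      funext s
      simp only [tp, Pi.add_apply, Pi.smul_apply, smul_eq_mul]
      field_simp
      ring
    · exact Or.inr (Or.inr (Or.inr (Or.inr (nullSpace_four_of_tangent hP hay hbx hab hs))))

/-! ### Equivalence of cases and normal forms, exclusivity, dimensions and gaps -/

section Normal

variable {P : TwoQubitOp}

theorem ne_zero_of_nrm_eq_one {X : Type*} [Fintype X] {a : X → ℂ} (h : nrm a = 1) : a ≠ 0 := by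
  intro h0
  rw [nrm_eq_zero.2 h0] at h
  exact zero_ne_one h

theorem norm_ip_lt_one {a b : Qubit} (ha : nrm a = 1) (hb : nrm b = 1) (hab : qdet a b ≠ 0) :
    ‖ip a b‖ < 1 := by
  have := norm_ip_lt_of_linearIndependent (linearIndependent_iff_qdet.2 hab)
  rwa [ha, hb, one_mul] at this

theorem qdet_ne_zero_of_ip {a a' : Qubit} (ha : nrm a = 1) (ha' : nrm a' = 1) (h : ip a a' = 0) :
    qdet a a' ≠ 0 := by
  intro h0
  obtain ⟨t, rfl⟩ := exists_smul_of_qdet (ne_zero_of_nrm_eq_one ha) h0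
  rw [ip_smul_right, nrm_eq_one_iff.1 ha, mul_one] at h
  rw [h, zero_smul] at ha'
  exact ne_zero_of_nrm_eq_one ha' rfl

theorem seqState_four (v : ℕ → Qubit) : seqState v 0 4 = prodState ![v 0, v 1, v 2, v 3] := by
  rw [seqState]
  congr 1
  funext i
  fin_cases i <;> rfl

theorem wState_four (a a' : Qubit) (f : ℂ) : wState a a' f 4 = prodState ![a', a, a, a]
    + f • prodState ![a, a', a, a] + f ^ 2 • prodState ![a, a, a', a]
    + f ^ 3 • prodState ![a, a, a, a'] := by
  have e0 : Function.update (fun _ : Fin 4 => a) 0 a' = ![a', a, a, a] := by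
    funext i; fin_cases i <;> rfl
  have e1 : Function.update (fun _ : Fin 4 => a) 1 a' = ![a, a', a, a] := by
    funext i; fin_cases i <;> rfl
  have e2 : Function.update (fun _ : Fin 4 => a) 2 a' = ![a, a, a', a] := by
    funext i; fin_cases i <;> rfl
  have e3 : Function.update (fun _ : Fin 4 => a) 3 a' = ![a, a, a, a'] := by
    funext i; fin_cases i <;> rfl
  rw [wState, excState, Fin.sum_univ_four, e0, e1, e2, e3]
  simp

theorem prodState_const_four (a : Qubit) :
    (prodState fun _ : Fin 4 => a) = prodState ![a, a, a, a] := by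
  congr 1
  funext i
  fin_cases i <;> rfl

theorem OneProduct.case1 (hP : IsStarProjection P) (h : OneProduct P) : Case1 P := by
  obtain ⟨a, ha, ha2, hf⟩ := h
  refine ⟨a, nrm_eq_one_iff.1 ha, ?_⟩
  rw [(nullSpace_eq_span_of_one_product hP ha ha2 hf 0).1, seqState_four]

theorem TwoProducts.nullSpace_eq (hP : IsStarProjection P) {θ : Qubit} (hθ : Separating P θ)
    {a b : Qubit} (ha : nrm a = 1) (hb : nrm b = 1) (hab : qdet a b ≠ 0) (ha2 : P *ᵥ tp a a = 0)
    (hb2 : P *ᵥ tp b b = 0) {n : ℕ} (hn : 1 ≤ n) :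
    nullSpace P n = Submodule.span ℂ {seqState (fun _ => a) 0 n, seqState (fun _ => b) 0 n} ∧
      Module.finrank ℂ (nullSpace P n) = 2 :=
  nullSpace_eq_span_of_products hP hθ (fun _ => ha) (fun _ => hb) (fun _ => le_rfl)
    (norm_ip_lt_one ha hb hab) (fun _ => ha2) (fun _ => hb2) 0 hn

theorem TwoProducts.case2 (hP : IsStarProjection P) {θ : Qubit} (hθ : Separating P θ)
    (h : TwoProducts P) : Case2 P := by
  obtain ⟨a, b, ha, hb, hab, ha2, hb2⟩ := h
  refine ⟨a, b, nrm_eq_one_iff.1 ha, nrm_eq_one_iff.1 hb, linearIndependent_iff_qdet.2 hab, ?_⟩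
  rw [(TwoProducts.nullSpace_eq hP hθ ha hb hab ha2 hb2 (by norm_num)).1, seqState_four,
    seqState_four]

/-- The sequence alternating between two qubit vectors. -/
def alternate (a b : Qubit) (i : ℕ) : Qubit := if Even i then a else b

theorem forall_alternate {a b : Qubit} {p : Qubit → Qubit → Qubit → Qubit → Prop}
    (h1 : p a b b a) (h2 : p b a a b) (i : ℕ) :
    p (alternate a b i) (alternate a b (i + 1)) (alternate b a i) (alternate b a (i + 1)) := by
  by_cases h : Even i
  · simpa [alternate, h, Nat.even_add_one] using h1
  · simpa [alternate, h, Nat.even_add_one] using h2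

theorem AlternatingProducts.properties {a b : Qubit} (ha : nrm a = 1) (hb : nrm b = 1)
    (ha2 : P *ᵥ tp a b = 0) (hb2 : P *ᵥ tp b a = 0) (i : ℕ) :
    nrm (alternate a b i) = 1 ∧ nrm (alternate b a i) = 1 ∧
      ‖ip (alternate a b i) (alternate b a i)‖ ≤ ‖ip a b‖ ∧
      P *ᵥ tp (alternate a b i) (alternate a b (i + 1)) = 0 ∧
      P *ᵥ tp (alternate b a i) (alternate b a (i + 1)) = 0 := by
  refine forall_alternate (p := fun x y z w => nrm x = 1 ∧ nrm z = 1 ∧ ‖ip x z‖ ≤ ‖ip a b‖ ∧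
    P *ᵥ tp x y = 0 ∧ P *ᵥ tp z w = 0) ⟨ha, hb, le_rfl, ha2, hb2⟩ ⟨hb, ha, ?_, hb2, ha2⟩ i
  rw [← star_ip, norm_star]

theorem AlternatingProducts.nullSpace_eq (hP : IsStarProjection P) {θ : Qubit}
    (hθ : Separating P θ) {a b : Qubit} (ha : nrm a = 1) (hb : nrm b = 1) (hab : qdet a b ≠ 0)
    (ha2 : P *ᵥ tp a b = 0) (hb2 : P *ᵥ tp b a = 0) {n : ℕ} (hn : 1 ≤ n) :
    nullSpace P n = Submodule.span ℂ {seqState (alternate a b) 0 n, seqState (alternate b a) 0 n} ∧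
      Module.finrank ℂ (nullSpace P n) = 2 := by
  have H := AlternatingProducts.properties (P := P) ha hb ha2 hb2
  exact nullSpace_eq_span_of_products hP hθ (fun i => (H i).1) (fun i => (H i).2.1)
    (fun i => (H i).2.2.1) (norm_ip_lt_one ha hb hab) (fun i => (H i).2.2.2.1)
    (fun i => (H i).2.2.2.2) 0 hn

theorem AlternatingProducts.case3 (hP : IsStarProjection P) {θ : Qubit} (hθ : Separating P θ)
    (h : AlternatingProducts P) : Case3 P := by
  obtain ⟨a, b, ha, hb, hab, ha2, hb2⟩ := h
  refine ⟨a, b, nrm_eq_one_iff.1 ha, nrm_eq_one_iff.1 hb, linearIndependent_iff_qdet.2 hab, ?_⟩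
  rw [(AlternatingProducts.nullSpace_eq hP hθ ha hb hab ha2 hb2 (by norm_num)).1, seqState_four,
    seqState_four]
  simp [alternate, Nat.even_iff]

theorem SingleExcitation.case4 (hP : IsStarProjection P) {θ : Qubit} (hθ : Separating P θ) {f : ℂ}
    (h : SingleExcitation P f) : Case4 P f := by
  obtain ⟨hf, a, a', ha, ha', h0, ha2, hf2⟩ := h
  refine ⟨hf, a, a', nrm_eq_one_iff.1 ha, nrm_eq_one_iff.1 ha', h0, ?_⟩
  rw [(nullSpace_eq_span_wState hP hθ ha ha' h0 ha2 hf2 (by norm_num)).1, wState_four,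
    prodState_const_four]

/-- Freezing the other two qubits at non-zero coordinates leaves a non-zero multiple of the product
on the bond. -/
theorem mulVec_tp_of_prodState_mem (hP : IsStarProjection P) {a b c d : Qubit} (ha : a ≠ 0)
    (hc : c ≠ 0) (hd : d ≠ 0) (h : prodState ![a, b, c, d] ∈ nullSpace P 4) :
    P *ᵥ tp a b = 0 ∧ P *ᵥ tp b c = 0 := by
  obtain ⟨i, hi⟩ := Function.ne_iff.1 ha
  obtain ⟨k, hk⟩ := Function.ne_iff.1 hc
  obtain ⟨l, hl⟩ := Function.ne_iff.1 hd
  constructor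
  · have h1 := slice_zero_one hP h k l
    have e : (fun s : Fin 2 × Fin 2 => prodState ![a, b, c, d] ![s.1, s.2, k, l])
        = (c k * d l) • tp a b := by
      funext s
      rw [prodState_four, Pi.smul_apply, tp, smul_eq_mul]
      ring
    rw [e, Matrix.mulVec_smul] at h1
    exact (smul_eq_zero.1 h1).resolve_left (mul_ne_zero hk hl)
  · have h1 := slice_one_two hP h i l
    have e : (fun s : Fin 2 × Fin 2 => prodState ![a, b, c, d] ![i, s.1, s.2, l])
        = (a i * d l) • tp b c := by
      funext s
      rw [prodState_four, Pi.smul_apply, tp, smul_eq_mul]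
      ring
    rw [e, Matrix.mulVec_smul] at h1
    exact (smul_eq_zero.1 h1).resolve_left (mul_ne_zero hi hl)

theorem Case1.oneProduct (hP : IsStarProjection P) (h : Case1 P) : OneProduct P := by
  obtain ⟨a, ha, h⟩ := h
  have ha := nrm_eq_one_iff.2 ha
  have ha0 := ne_zero_of_nrm_eq_one ha
  refine ⟨a, ha, (mulVec_tp_of_prodState_mem hP ha0 ha0 ha0 ?_).1, ?_⟩
  · rw [h]; exact Submodule.mem_span_singleton_self _
  · refine finrank_le_one_of_forall (prodState ![a, a, a, a]) fun ψ hψ => ?_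
    rw [h, Submodule.mem_span_singleton] at hψ
    obtain ⟨t, rfl⟩ := hψ
    exact ⟨t, rfl⟩

theorem Case2.twoProducts (hP : IsStarProjection P) (h : Case2 P) : TwoProducts P := by
  obtain ⟨a, b, ha, hb, hab, h⟩ := h
  have ha := nrm_eq_one_iff.2 ha
  have hb := nrm_eq_one_iff.2 hb
  have ha0 := ne_zero_of_nrm_eq_one ha
  have hb0 := ne_zero_of_nrm_eq_one hb
  refine ⟨a, b, ha, hb, linearIndependent_iff_qdet.1 hab,
    (mulVec_tp_of_prodState_mem hP ha0 ha0 ha0 ?_).1,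
    (mulVec_tp_of_prodState_mem hP hb0 hb0 hb0 ?_).1⟩
  · rw [h]; exact Submodule.subset_span (by simp)
  · rw [h]; exact Submodule.subset_span (by simp)

theorem Case3.alternatingProducts (hP : IsStarProjection P) (h : Case3 P) :
    AlternatingProducts P := by
  obtain ⟨a, b, ha, hb, hab, h⟩ := h
  have ha := nrm_eq_one_iff.2 ha
  have hb := nrm_eq_one_iff.2 hb
  have ha0 := ne_zero_of_nrm_eq_one ha
  have hb0 := ne_zero_of_nrm_eq_one hb
  have := mulVec_tp_of_prodState_mem hP (P := P) (b := b) ha0 ha0 hb0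
    (by rw [h]; exact Submodule.subset_span (by simp))
  exact ⟨a, b, ha, hb, linearIndependent_iff_qdet.1 hab, this.1, this.2⟩

theorem Case4.singleExcitation (hP : IsStarProjection P) {f : ℂ} (h : Case4 P f) :
    SingleExcitation P f := by
  obtain ⟨hf, a, a', ha, ha', h0, h⟩ := h
  have ha := nrm_eq_one_iff.2 ha
  have ha' := nrm_eq_one_iff.2 ha'
  have ha0 := ne_zero_of_nrm_eq_one ha
  have h2 : P *ᵥ tp a a = 0 := (mulVec_tp_of_prodState_mem hP ha0 ha0 ha0
    (by rw [h]; exact Submodule.subset_span (by simp))).1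
  refine ⟨hf, a, a', ha, ha', h0, h2, ?_⟩
  obtain ⟨k, hk⟩ := Function.ne_iff.1 ha0
  have h1 := slice_zero_one hP (P := P)
    (by rw [h]; exact Submodule.subset_span (Set.mem_insert_of_mem _ rfl)) k k
  -- With the last two qubits frozen at a coordinate where `a` is non-zero, excitations on those
  -- qubits contribute only multiples of `a ⊗ a`, which `P` kills.
  have e : (fun s : Fin 2 × Fin 2 => (prodState ![a', a, a, a] + f • prodState ![a, a', a, a]
      + f ^ 2 • prodState ![a, a, a', a] + f ^ 3 • prodState ![a, a, a, a']) ![s.1, s.2, k, k])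
      = (a k * a k) • (tp a' a + f • tp a a')
        + (f ^ 2 * a' k * a k + f ^ 3 * a k * a' k) • tp a a := by
    funext s
    simp only [Pi.add_apply, Pi.smul_apply, prodState_four, tp, smul_eq_mul]
    ring
  rw [e, Matrix.mulVec_add, Matrix.mulVec_smul, Matrix.mulVec_smul, h2, smul_zero, add_zero] at h1
  exact (smul_eq_zero.1 h1).resolve_left (mul_ne_zero hk hk)

theorem exists_combination_of_ker (hrank : P.rank = 2) {p q : Qubit}
    {s₁ s₂ : Fin 2 × Fin 2 → ℂ} (h1 : P *ᵥ s₁ = 0) (h2 : P *ᵥ s₂ = 0) (h0 : s₁ ≠ 0)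
    (hp1 : pairing p q s₁ = 0) (hp2 : pairing p q s₂ ≠ 0) {s : Fin 2 × Fin 2 → ℂ}
    (hs : P *ᵥ s = 0) : ∃ t r : ℂ, s = t • s₁ + r • s₂ := by
  have hli : LinearIndependent ℂ ![s₁, s₂] := by
    rw [LinearIndependent.pair_iff' h0]
    rintro t rfl
    rw [pairing_smul, hp1, mul_zero] at hp2
    exact hp2 rfl
  have hspan := (span_pair_eq_of_finrank_le (mem_kerSpace.2 h1) (mem_kerSpace.2 h2)
    (finrank_kerSpace hrank).le (norm_ip_lt_of_linearIndependent hli)).1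
  rw [← mem_kerSpace, hspan, Submodule.mem_span_pair] at hs
  obtain ⟨t, r, h⟩ := hs
  exact ⟨t, r, h.symm⟩

theorem ker_of_two_products (hrank : P.rank = 2) {a b : Qubit} (hab : qdet a b ≠ 0)
    (ha2 : P *ᵥ tp a a = 0) (hb2 : P *ᵥ tp b b = 0) {s : Fin 2 × Fin 2 → ℂ} (hs : P *ᵥ s = 0) :
    pairing a b s = 0 ∧ pairing b a s = 0 := by
  have ha := ne_zero_of_qdet_left hab
  obtain ⟨t, r, rfl⟩ := exists_combination_of_ker hrank (p := a) (q := a) ha2 hb2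
    (by rw [Ne, tp_eq_zero, or_self]; exact ha) (by rw [pairing_tp, qdet_self, mul_zero])
    (by rw [pairing_tp]; exact mul_ne_zero hab hab) hs
  simp [pairing_add, pairing_smul, pairing_tp, qdet_self]

theorem ker_of_alternating_products (hrank : P.rank = 2) {a b : Qubit} (hab : qdet a b ≠ 0)
    (ha2 : P *ᵥ tp a b = 0) (hb2 : P *ᵥ tp b a = 0) {s : Fin 2 × Fin 2 → ℂ} (hs : P *ᵥ s = 0) :
    pairing a a s = 0 ∧ pairing b b s = 0 := by
  have ha := ne_zero_of_qdet_left hab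
  have hb := ne_zero_of_qdet_right hab
  obtain ⟨t, r, rfl⟩ := exists_combination_of_ker hrank (p := a) (q := b) ha2 hb2
    (by rw [Ne, tp_eq_zero, not_or]; exact ⟨ha, hb⟩) (by rw [pairing_tp, qdet_self, zero_mul])
    (by rw [pairing_tp]; exact mul_ne_zero hab fun h => hab (qdet_eq_zero_comm.1 h)) hs
  simp [pairing_add, pairing_smul, pairing_tp, qdet_self]

/-- On the span of `a ⊗ a` and `b ⊗ b` both `pairing a b` and `pairing b a` vanish; for `c ⊗ d` this
forces either `c ∥ d` or `a ∥ b`. -/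
theorem not_twoProducts_and_alternatingProducts (hrank : P.rank = 2) :
    ¬ (TwoProducts P ∧ AlternatingProducts P) := by
  rintro ⟨⟨a, b, ha, hb, hab, ha2, hb2⟩, c, d, hc, hd, hcd, hc2, hd2⟩
  have h1 := ker_of_two_products hrank hab ha2 hb2 hc2
  simp only [pairing_tp, mul_eq_zero] at h1
  have ha0 := ne_zero_of_qdet_left hab
  have hb0 := ne_zero_of_qdet_right hab
  have hc0 := ne_zero_of_qdet_left hcd
  have hd0 := ne_zero_of_qdet_right hcd
  obtain ⟨h1 | h1, h2 | h2⟩ := h1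
  · exact hab (qdet_trans hc0 (qdet_eq_zero_comm.1 h1) (qdet_eq_zero_comm.1 h2))
  · exact hcd (qdet_trans ha0 h1 h2)
  · exact hcd (qdet_trans hb0 h2 h1)
  · exact hab (qdet_trans hd0 (qdet_eq_zero_comm.1 h2) (qdet_eq_zero_comm.1 h1))

/-- Since `e ⊗ e` is in the kernel, `e` is along `a` or `b`; then `pairing a b` on the other kernel
vector forces `e'` to be along `e`. -/
theorem not_twoProducts_and_singleExcitation (hrank : P.rank = 2) (f : ℂ) :
    ¬ (TwoProducts P ∧ SingleExcitation P f) := by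
  rintro ⟨⟨a, b, ha, hb, hab, ha2, hb2⟩, hf, e, e', he, he', h0, he2, hf2⟩
  have hee := qdet_ne_zero_of_ip he he' h0
  have ha0 := ne_zero_of_qdet_left hab
  have hb0 := ne_zero_of_qdet_right hab
  have he0 := ne_zero_of_qdet_left hee
  have h1 := (ker_of_two_products hrank hab ha2 hb2 he2).1
  have h2 := (ker_of_two_products hrank hab ha2 hb2 hf2).1
  rw [pairing_tp] at h1
  rw [pairing_add, pairing_smul, pairing_tp, pairing_tp] at h2
  rcases mul_eq_zero.1 h1 with h | h
  · have hb' : qdet b e ≠ 0 := fun h' =>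
      hab (qdet_trans he0 (qdet_eq_zero_comm.1 h) (qdet_eq_zero_comm.1 h'))
    rw [h, zero_mul, mul_zero, add_zero] at h2
    exact hee (qdet_trans ha0 h ((mul_eq_zero.1 h2).resolve_right hb'))
  · have ha' : qdet a e ≠ 0 := fun h' =>
      hab (qdet_trans he0 (qdet_eq_zero_comm.1 h') (qdet_eq_zero_comm.1 h))
    rw [h, mul_zero, zero_add] at h2
    exact hee (qdet_trans hb0 h
      ((mul_eq_zero.1 ((mul_eq_zero.1 h2).resolve_left hf)).resolve_left ha'))

/-- The functionals `pairing a a` and `pairing b b` vanish on the kernel, so `e ⊗ e` in it would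
make `e` proportional to both `a` and `b`. -/
theorem not_alternatingProducts_and_singleExcitation (hrank : P.rank = 2) (f : ℂ) :
    ¬ (AlternatingProducts P ∧ SingleExcitation P f) := by
  rintro ⟨⟨a, b, ha, hb, hab, ha2, hb2⟩, hf, e, e', he, he', h0, he2, hf2⟩
  have h1 := ker_of_alternating_products hrank hab ha2 hb2 he2
  rw [pairing_tp, pairing_tp, mul_self_eq_zero, mul_self_eq_zero] at h1
  exact ne_zero_of_nrm_eq_one he (eq_zero_of_qdet hab h1.1 h1.2)

theorem OneProduct.nullSpace_ne_bot (hP : IsStarProjection P) (h : OneProduct P) (n : ℕ) :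
    nullSpace P n ≠ ⊥ := by
  obtain ⟨a, ha, ha2, -⟩ := h
  exact (Submodule.ne_bot_iff _).2 ⟨_, seqState_mem_nullSpace hP (fun _ => ha2) 0 n,
    ne_zero_of_nrm_eq_one (nrm_prodState fun _ => ha)⟩

theorem OneProduct.finrank_nullSpace (hP : IsStarProjection P) {θ : Qubit} (hθ : Separating P θ)
    (h : OneProduct P) {n : ℕ} (hn : 4 ≤ n) : Module.finrank ℂ (nullSpace P n) = 1 := by
  obtain ⟨a, ha, ha2, h1⟩ := h
  exact (nullSpace_eq_span_of_one_product hP ha ha2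
    ((finrank_nullSpace_le_of_le hP hθ (by norm_num) hn).trans h1) 0).2

theorem TwoProducts.finrank_nullSpace (hP : IsStarProjection P) {θ : Qubit} (hθ : Separating P θ)
    (h : TwoProducts P) {n : ℕ} (hn : 1 ≤ n) : Module.finrank ℂ (nullSpace P n) = 2 := by
  obtain ⟨a, b, ha, hb, hab, ha2, hb2⟩ := h
  exact (TwoProducts.nullSpace_eq hP hθ ha hb hab ha2 hb2 hn).2

theorem AlternatingProducts.finrank_nullSpace (hP : IsStarProjection P) {θ : Qubit}
    (hθ : Separating P θ) (h : AlternatingProducts P) {n : ℕ} (hn : 1 ≤ n) :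
    Module.finrank ℂ (nullSpace P n) = 2 := by
  obtain ⟨a, b, ha, hb, hab, ha2, hb2⟩ := h
  exact (AlternatingProducts.nullSpace_eq hP hθ ha hb hab ha2 hb2 hn).2

theorem SingleExcitation.finrank_nullSpace (hP : IsStarProjection P) {θ : Qubit}
    (hθ : Separating P θ) {f : ℂ} (h : SingleExcitation P f) {n : ℕ} (hn : 1 ≤ n) :
    Module.finrank ℂ (nullSpace P n) = 2 := by
  obtain ⟨hf, a, a', ha, ha', h0, ha2, hf2⟩ := h
  exact (nullSpace_eq_span_wState hP hθ ha ha' h0 ha2 hf2 hn).2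

theorem Case5.finrank_nullSpace (hP : IsStarProjection P) (h : Case5 P) {n : ℕ} (hn : 4 ≤ n) :
    Module.finrank ℂ (nullSpace P n) = 0 := by
  rw [nullSpace_eq_bot_of_le hP hn h, finrank_bot]

theorem TwoProducts.gapped (hP : IsStarProjection P) {θ : Qubit} (hθ : Separating P θ)
    (h : TwoProducts P) : Gapped P := by
  obtain ⟨a, b, ha, hb, hab, ha2, hb2⟩ := h
  exact gapped_of_products hP hθ (fun _ => ha) (fun _ => hb) (fun _ => le_rfl)
    (norm_ip_lt_one ha hb hab) (fun _ => ha2) (fun _ => hb2)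

theorem AlternatingProducts.gapped (hP : IsStarProjection P) {θ : Qubit} (hθ : Separating P θ)
    (h : AlternatingProducts P) : Gapped P := by
  obtain ⟨a, b, ha, hb, hab, ha2, hb2⟩ := h
  have H := AlternatingProducts.properties (P := P) ha hb ha2 hb2
  exact gapped_of_products hP hθ (fun i => (H i).1) (fun i => (H i).2.1)
    (fun i => (H i).2.2.1) (norm_ip_lt_one ha hb hab) (fun i => (H i).2.2.2.1)
    (fun i => (H i).2.2.2.2)

theorem rank_swapOp : (swapOp P).rank = P.rank :=
  Matrix.rank_submatrix P (Equiv.prodComm (Fin 2) (Fin 2)) (Equiv.prodComm (Fin 2) (Fin 2))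

theorem isOneLocal_of_swapOp (h : IsOneLocal (swapOp P)) : IsOneLocal P := by
  have hpp : swapOp (swapOp P) = P := rfl
  obtain ⟨Q, hQ, h | h⟩ := h
  · refine ⟨Q, hQ, Or.inr ?_⟩
    rw [← hpp, h]
    ext ⟨i, j⟩ ⟨k, l⟩
    simp [swapOp, mul_comm]
  · refine ⟨Q, hQ, Or.inl ?_⟩
    rw [← hpp, h]
    ext ⟨i, j⟩ ⟨k, l⟩
    simp [swapOp, mul_comm]

theorem SingleExcitation.gapped (hP : IsStarProjection P) (hrank : P.rank = 2)
    (hloc : ¬ IsOneLocal P) {f : ℂ} (h : SingleExcitation P f) (h1 : ‖f‖ ≠ 1) : Gapped P := by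
  obtain ⟨hf, a, a', ha, ha', h0, ha2, hf2⟩ := h
  rcases lt_or_gt_of_ne h1 with hlt | hgt
  · obtain ⟨θ, hθ⟩ := exists_separating hP hrank hloc
    exact gapped_of_single_excitation hP hθ ha ha' h0 hlt ha2 hf2
  · have hP' := isStarProjection_swapOp hP
    obtain ⟨θ, hθ⟩ := exists_separating hP' (rank_swapOp.trans hrank)
      fun h => hloc (isOneLocal_of_swapOp h)
    refine gapped_swapOp (gapped_of_single_excitation hP' hθ ha ha' h0 (f := f⁻¹) ?_ ?_ ?_)
    · rw [norm_inv]; exact inv_lt_one_of_one_lt₀ hgt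
    · rw [swapOp_mulVec, tp_comp_swap, ha2]; rfl
    · have e : (tp a' a + f⁻¹ • tp a a') ∘ Prod.swap = f⁻¹ • (tp a' a + f • tp a a') := by
        rw [smul_add, smul_smul, inv_mul_cancel₀ hf, one_smul]
        funext s
        simp only [Function.comp, Pi.add_apply, Pi.smul_apply, smul_eq_mul, tp, Prod.swap]
        ring
      rw [swapOp_mulVec, e, Matrix.mulVec_smul, hf2, smul_zero]; rfl

end Normal

/-! ### The low-energy spin wave for `‖f‖ = 1` -/

section SpinWave

variable {P : TwoQubitOp}

theorem mulVec_eq_self_of_orthogonal {X : Type*} [Fintype X] [DecidableEq X] {Q : Matrix X X ℂ}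
    (hQ : IsStarProjection Q) {v : X → ℂ} (h : ∀ s, Q *ᵥ s = 0 → ip s v = 0) : Q *ᵥ v = v := by
  have h1 : Q *ᵥ (v - Q *ᵥ v) = 0 := by
    rw [Matrix.mulVec_sub, proj_mulVec_mulVec hQ, sub_self]
  have h2 : ip (v - Q *ᵥ v) (v - Q *ᵥ v) = 0 := by
    rw [ip_sub_right, h _ h1, ip_mulVec_right, proj_conjTranspose hQ, h1, ip_zero_left, sub_zero]
  rw [ip_self] at h2
  have h3 : nrm (v - Q *ᵥ v) ^ 2 = 0 := by exact_mod_cast h2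
  exact (sub_eq_zero.1 (nrm_eq_zero.1 (pow_eq_zero_iff two_ne_zero |>.1 h3))).symm

theorem ip_tp (a b c d : Qubit) : ip (tp a b) (tp c d) = ip a c * ip b d := by
  simp only [ip, dotProduct, Fintype.sum_prod_type, Fin.sum_univ_two, tp, Pi.star_apply, star_mul']
  ring

/-- For `‖f‖ = 1` the vector `a' ⊗ a - f a ⊗ a'` is orthogonal to the two vectors spanning the
kernel of `P`, hence is fixed by `P`. -/
theorem mulVec_single_excitation (hP : IsStarProjection P) (hrank : P.rank = 2) {a a' : Qubit}
    (ha : nrm a = 1) (ha' : nrm a' = 1) (h : ip a a' = 0) {f : ℂ} (hf : ‖f‖ = 1)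
    (ha2 : P *ᵥ tp a a = 0) (hf2 : P *ᵥ (tp a' a + f • tp a a') = 0) (x y : ℂ) :
    P *ᵥ (x • tp a' a + y • f • tp a a') = ((x - y) / 2) • (tp a' a - f • tp a a') := by
  have hq := qdet_ne_zero_of_ip ha ha' h
  have h' : ip a' a = 0 := by rw [← star_ip, h, star_zero]
  have hff : star f * f = 1 := by
    rw [Complex.star_def, Complex.conj_mul', hf]; simp
  have hv : P *ᵥ (tp a' a - f • tp a a') = tp a' a - f • tp a a' := by
    refine mulVec_eq_self_of_orthogonal hP fun s hs => ?_
    obtain ⟨t, r, rfl⟩ := exists_combination_of_ker hrank (p := a) (q := a') ha2 hf2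
      (by rw [Ne, tp_eq_zero, or_self]; exact ne_zero_of_nrm_eq_one ha)
      (by rw [pairing_tp, qdet_self, zero_mul])
      (by
        rw [pairing_add, pairing_smul, pairing_tp, pairing_tp, qdet_self, zero_mul, mul_zero,
          add_zero]
        exact mul_ne_zero hq fun h => hq (qdet_eq_zero_comm.1 h)) hs
    simp only [ip_add_left, ip_sub_right, ip_smul_left, ip_smul_right, ip_tp, h, h',
      nrm_eq_one_iff.1 ha, nrm_eq_one_iff.1 ha']
    linear_combination -star r * hff
  have e : x • tp a' a + y • f • tp a a' = ((x + y) / 2) • (tp a' a + f • tp a a')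
      + ((x - y) / 2) • (tp a' a - f • tp a a') := by module
  rw [e, Matrix.mulVec_add, Matrix.mulVec_smul, Matrix.mulVec_smul, hf2, hv, smul_zero, zero_add]

/-- After absorbing `f ^ k` into the state with the excitation at `k`, each bond acts as half the
Laplacian of one edge of a path. -/
theorem localTerm_mulVec_excState (hP : IsStarProjection P) (hrank : P.rank = 2) {a a' : Qubit}
    (ha : nrm a = 1) (ha' : nrm a' = 1) (h : ip a a' = 0) {f : ℂ} (hf : ‖f‖ = 1)
    (ha2 : P *ᵥ tp a a = 0) (hf2 : P *ᵥ (tp a' a + f • tp a a') = 0) (g : ℕ → ℂ) {n : ℕ}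
    (j : Fin (n - 1)) :
    localTerm P n j *ᵥ excState a a' (fun k : Fin n => g k * f ^ (k : ℕ))
      = ((g j - g (j + 1)) / 2) •
        (f ^ (j : ℕ) • prodState (fun i : Fin n => if (i : ℕ) = j then a' else a)
        - f ^ (j + 1 : ℕ) • prodState (fun i : Fin n => if (i : ℕ) = j + 1 then a' else a)) := by
  have hj := site_ne_succ j
  funext x
  rw [localTerm, onPair_mulVec_excState ha2 a' _ hj]
  simp only [Pi.smul_apply, Pi.sub_apply, smul_eq_mul]
  rw [prodState_eq_restProd hj, prodState_eq_restProd hj]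
  have e1 : ∀ m : ℕ, (m = j ∨ m = j + 1) →
      restProd (⟨j, by omega⟩ : Fin n) ⟨j + 1, by omega⟩
        (fun i : Fin n => if (i : ℕ) = m then a' else a) x
      = restProd (⟨j, by omega⟩ : Fin n) ⟨j + 1, by omega⟩ (fun _ => a) x := by
    intro m hm
    refine restProd_congr (fun i hi hi' => if_neg fun him => ?_) fun _ _ _ => rfl
    rcases hm with rfl | rfl
    · exact hi (Fin.ext him)
    · exact hi' (Fin.ext him)
  rw [e1 _ (Or.inl rfl), e1 _ (Or.inr rfl)]
  have e2 : (g j * f ^ (j : ℕ)) • tp a' a + (g (j + 1) * f ^ (j + 1 : ℕ)) • tp a a'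
      = (f ^ (j : ℕ)) • (g j • tp a' a + g (j + 1) • f • tp a a') := by
    rw [smul_add, smul_smul, smul_smul, smul_smul]
    congr 2 <;> ring
  rw [e2, Matrix.mulVec_smul, mulVec_single_excitation hP hrank ha ha' h hf ha2 hf2]
  simp only [Pi.smul_apply, Pi.sub_apply, smul_eq_mul, if_true, Nat.succ_ne_self, if_false,
    (Nat.succ_ne_self _).symm]
  ring

theorem sum_range_by_parts {M : Type*} [AddCommGroup M] [Module ℂ M] (B : ℕ → ℂ) (v : ℕ → M)
    (m : ℕ) : ∑ j ∈ Finset.range m, B (j + 1) • (v j - v (j + 1))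
      = ∑ k ∈ Finset.range (m + 1), (B (k + 1) - B k) • v k - B (m + 1) • v m + B 0 • v 0 := by
  induction m with
  | zero => simp [sub_smul]
  | succ m ih => rw [Finset.sum_range_succ, ih, Finset.sum_range_succ _ (m + 1)]; module

/-- The amplitudes `g` form the lowest non-constant mode of the path Laplacian with free ends. -/
theorem one_sub_cos_mem_energies (hP : IsStarProjection P) (hrank : P.rank = 2) {f : ℂ}
    (h : SingleExcitation P f) (hf : ‖f‖ = 1) {n : ℕ} (hn : 2 ≤ n) :
    1 - Real.cos (Real.pi / n) ∈ energies P n := by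
  obtain ⟨-, a, a', ha, ha', h0, ha2, hf2⟩ := h
  obtain ⟨m, rfl⟩ : ∃ m, n = m + 1 := ⟨n - 1, by omega⟩
  set θ : ℝ := Real.pi / (m + 1 : ℕ) with hθ
  have hm : ((m + 1 : ℕ) : ℝ) ≠ 0 := by positivity
  have hθm : ((m + 1 : ℕ) : ℝ) * θ = Real.pi := by rw [hθ]; field_simp
  let g : ℕ → ℂ := fun k => (Real.cos (k * θ + θ / 2) : ℝ)
  -- `B k` is half the drop of `g` from `k - 1` to `k`. It vanishes at `k = 0` and `k = n`, so
  -- summation by parts has no boundary terms.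
  let B : ℕ → ℂ := fun k => ((Real.cos (k * θ - θ / 2) - Real.cos (k * θ + θ / 2)) / 2 : ℝ)
  have hB : ∀ k : ℕ, (g k - g (k + 1)) / 2 = B (k + 1) := by
    intro k
    simp only [g, B]
    have : ((k + 1 : ℕ) : ℝ) * θ - θ / 2 = k * θ + θ / 2 := by push_cast; ring
    rw [this]
    push_cast
    rfl
  have hB0 : B 0 = 0 := by
    simp only [B]
    have : ((0 : ℕ) : ℝ) * θ - θ / 2 = -(((0 : ℕ) : ℝ) * θ + θ / 2) := by push_cast; ring
    rw [this, Real.cos_neg, sub_self]; simp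
  have hBn : B (m + 1) = 0 := by
    simp only [B]
    rw [hθm, Real.cos_pi_sub, Real.cos_add, Real.cos_pi, Real.sin_pi]
    simp
  have hBs : ∀ k, B (k + 1) - B k = ((1 - Real.cos θ : ℝ) : ℂ) * g k := by
    intro k
    simp only [B, g]
    rw [← Complex.ofReal_sub, ← Complex.ofReal_mul]
    congr 1
    have e1 : ((k + 1 : ℕ) : ℝ) * θ - θ / 2 = k * θ + θ / 2 := by push_cast; ring
    have e2 : ((k + 1 : ℕ) : ℝ) * θ + θ / 2 = (k * θ + θ / 2) + θ := by push_cast; ring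
    have e3 : (k : ℝ) * θ - θ / 2 = (k * θ + θ / 2) - θ := by ring
    rw [e1, e2, e3]
    generalize (k : ℝ) * θ + θ / 2 = u
    rw [Real.cos_add, Real.cos_sub]
    ring
  let v : ℕ → Vec (m + 1) := fun k =>
    f ^ k • prodState (fun i : Fin (m + 1) => if (i : ℕ) = k then a' else a)
  have hψ : excState a a' (fun k : Fin (m + 1) => g k * f ^ (k : ℕ))
      = ∑ k ∈ Finset.range (m + 1), g k • v k := by
    rw [excState, Finset.sum_range]
    refine Finset.sum_congr rfl fun k _ => ?_
    rw [mul_smul]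
    congr 3
    funext i
    simp [Function.update_apply, Fin.ext_iff]
  rw [mem_energies]
  refine ⟨excState a a' (fun k : Fin (m + 1) => g k * f ^ (k : ℕ)), ?_, ?_⟩
  · intro hz
    have h1 := nrm_sq_excState ha ha' h0 (fun k : Fin (m + 1) => g k * f ^ (k : ℕ))
    rw [hz, nrm_eq_zero.2 rfl, zero_pow two_ne_zero, eq_comm,
      Finset.sum_eq_zero_iff_of_nonneg fun _ _ => sq_nonneg _] at h1
    -- The first amplitude is `cos (θ / 2)` with `0 < θ / 2 < π / 2`, so the state is non-zero.
    have h2 := h1 0 (Finset.mem_univ _)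
    simp only [g, Fin.val_zero, pow_zero, mul_one, sq_eq_zero_iff, norm_eq_zero, Nat.cast_zero,
      zero_mul, zero_add, Complex.ofReal_eq_zero] at h2
    have hpos : 0 < θ := by rw [hθ]; positivity
    have hle : θ ≤ Real.pi := by
      rw [← hθm]
      exact le_mul_of_one_le_left hpos.le (by push_cast; linarith [(Nat.cast_nonneg m : (0:ℝ) ≤ m)])
    have hlt : θ / 2 < Real.pi / 2 := by
      have : (2 : ℝ) ≤ (m + 1 : ℕ) := by exact_mod_cast hn
      nlinarith
    exact (Real.cos_pos_of_mem_Ioo ⟨by linarith, hlt⟩).ne' h2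
  · have h1 : hamiltonian P (m + 1) *ᵥ excState a a' (fun k : Fin (m + 1) => g k * f ^ (k : ℕ))
        = ∑ j ∈ Finset.range m, B (j + 1) • (v j - v (j + 1)) := by
      rw [hamiltonian, Matrix.sum_mulVec, Finset.sum_range]
      refine Finset.sum_congr rfl fun j _ => ?_
      rw [localTerm_mulVec_excState hP hrank ha ha' h0 hf ha2 hf2, hB]
    rw [h1, sum_range_by_parts, hB0, hBn, zero_smul, zero_smul, add_zero, sub_zero, hψ,
      Finset.smul_sum]
    refine Finset.sum_congr rfl fun k _ => ?_
    rw [hBs, mul_smul]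

theorem SingleExcitation.gap_le (hP : IsStarProjection P) (hrank : P.rank = 2) {θ : Qubit}
    (hθ : Separating P θ) {f : ℂ} (h : SingleExcitation P f) (hf : ‖f‖ = 1) {n : ℕ} (hn : 2 ≤ n) :
    ∃ g : ℝ, IsSpectralGap P n g ∧ g ≤ 1 - Real.cos (Real.pi / n) := by
  have hbot : nullSpace P n ≠ ⊥ := by
    intro h0
    have := h.finrank_nullSpace hP hθ (show 1 ≤ n by omega)
    rw [h0, finrank_bot] at this
    omega
  obtain ⟨g, hg, -, -, hmin⟩ := exists_isSpectralGap hP hbot (nullSpace_ne_top hP hθ hn)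
  refine ⟨g, hg, hmin _ (one_sub_cos_mem_energies hP hrank h hf hn) ?_⟩
  have hn' : (1 : ℝ) ≤ n := by exact_mod_cast (by omega : 1 ≤ n)
  have h1 := Real.cos_lt_cos_of_nonneg_of_le_pi le_rfl
    (div_le_self Real.pi_pos.le hn') (div_pos Real.pi_pos (by linarith))
  rw [Real.cos_zero] at h1
  linarith

theorem SingleExcitation.not_gapped (hP : IsStarProjection P) (hrank : P.rank = 2) {θ : Qubit}
    (hθ : Separating P θ) {f : ℂ} (h : SingleExcitation P f) (hf : ‖f‖ = 1) : ¬ Gapped P := by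
  rintro ⟨c, hc, H⟩
  have hlim : Filter.Tendsto (fun n : ℕ => 1 - Real.cos (Real.pi / n)) Filter.atTop (nhds 0) := by
    have h1 := (Real.continuous_cos.tendsto 0).comp (tendsto_const_div_atTop_nhds_zero_nat Real.pi)
    have h2 := h1.const_sub 1
    rwa [Real.cos_zero, sub_self] at h2
  obtain ⟨n, hn1, hn2⟩ := ((hlim.eventually (gt_mem_nhds hc)).and
    (Filter.eventually_ge_atTop 2)).exists
  obtain ⟨g, hg, hgc⟩ := H n hn2
  obtain ⟨g', hg', hle⟩ := h.gap_le hP hrank hθ hf hn2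
  rw [isSpectralGap_unique hg hg'] at hgc
  linarith

end SpinWave

/-! ### Assembly -/

theorem existsUnique_fin_five {p : Fin 5 → Prop} (h : ∃ i, p i)
    (hne : ∀ i j, i < j → ¬ (p i ∧ p j)) : ∃! i, p i := by
  obtain ⟨i, hi⟩ := h
  refine ⟨i, hi, fun j hj => ?_⟩
  rcases lt_trichotomy i j with h | h | h
  · exact (hne _ _ h ⟨hi, hj⟩).elim
  · exact h.symm
  · exact (hne _ _ h ⟨hj, hi⟩).elim

theorem classification_and_gap (P : TwoQubitOp) (hproj : IsStarProjection P) (hrank : P.rank = 2)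
    (hloc : ¬ IsOneLocal P) :
    (∀ n : ℕ, 4 ≤ n → Module.finrank ℂ (nullSpace P n)
      = Module.finrank ℂ (nullSpace P 4)) ∧
    Module.finrank ℂ (nullSpace P 4) ∈ ({0, 1, 2} : Set ℕ) ∧
    (∃! k : Fin 5, (![Case1 P, Case2 P, Case3 P,
      ∃ f : ℂ, Case4 P f, Case5 P] : Fin 5 → Prop) k) ∧
    ((Case1 P ∨ Case2 P ∨ Case3 P ∨
      ∃ f : ℂ, Case4 P f) →
        ∀ n : ℕ, 2 ≤ n → FrustrationFree P n) ∧
    (Case5 P → ∀ n : ℕ, 4 ≤ n → ¬ FrustrationFree P n) ∧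
    ((Case1 P ∨ Case2 P ∨ Case3 P) → Gapped P) ∧
    (∀ f : ℂ, Case4 P f → ‖f‖ ≠ 1 → Gapped P) ∧
    (∀ f : ℂ, Case4 P f → ‖f‖ = 1 →
      ¬ Gapped P ∧
      ∀ n : ℕ, 2 ≤ n → ∃ g : ℝ, IsSpectralGap P n g ∧
        g ≤ 1 - Real.cos (Real.pi / n)) := by
  obtain ⟨θ, hθ⟩ := exists_separating hproj hrank hloc
  have d1 := fun (h : Case1 P) n hn => (h.oneProduct hproj).finrank_nullSpace hproj hθ (n := n) hn
  have d2 := fun (h : Case2 P) n hn => (h.twoProducts hproj).finrank_nullSpace hproj hθ (n := n) hn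
  have d3 := fun (h : Case3 P) n hn =>
    (h.alternatingProducts hproj).finrank_nullSpace hproj hθ (n := n) hn
  have d4 := fun (h : ∃ f, Case4 P f) n hn =>
    (h.choose_spec.singleExcitation hproj).finrank_nullSpace hproj hθ (n := n) hn
  have d5 := fun (h : Case5 P) n hn => h.finrank_nullSpace hproj (n := n) hn
  have hex : Case1 P ∨ Case2 P ∨ Case3 P ∨ (∃ f, Case4 P f) ∨ Case5 P := by
    rcases classification hproj hrank hloc with h | h | h | ⟨f, h⟩ | h
    · exact Or.inl (h.case1 hproj)
    · exact Or.inr (Or.inl (h.case2 hproj hθ))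
    · exact Or.inr (Or.inr (Or.inl (h.case3 hproj hθ)))
    · exact Or.inr (Or.inr (Or.inr (Or.inl ⟨f, h.case4 hproj hθ⟩)))
    · exact Or.inr (Or.inr (Or.inr (Or.inr h)))
  have ne_bot : ∀ {n}, Module.finrank ℂ (nullSpace P n) = 2 → nullSpace P n ≠ ⊥ := by
    intro n h h0
    rw [h0, finrank_bot] at h
    omega
  refine ⟨fun n hn => ?_, ?_, ?_, ?_, ?_, ?_, ?_, ?_⟩
  · rcases hex with h | h | h | h | h
    · rw [d1 h n hn, d1 h 4 le_rfl]
    · rw [d2 h n (by omega), d2 h 4 (by omega)]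
    · rw [d3 h n (by omega), d3 h 4 (by omega)]
    · rw [d4 h n (by omega), d4 h 4 (by omega)]
    · rw [d5 h n hn, d5 h 4 le_rfl]
  · rcases hex with h | h | h | h | h
    · rw [d1 h 4 le_rfl]; simp
    · rw [d2 h 4 (by omega)]; simp
    · rw [d3 h 4 (by omega)]; simp
    · rw [d4 h 4 (by omega)]; simp
    · rw [d5 h 4 le_rfl]; simp
  -- The dimensions `1` and `0` single out cases 1 and 5. Cases 2, 3 and 4 share the dimension `2`
  -- and are told apart by the kernel of `P`.
  · have n12 : ¬ (Case1 P ∧ Case2 P) := fun h => by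
      have := (d1 h.1 4 le_rfl).symm.trans (d2 h.2 4 (by omega)); omega
    have n13 : ¬ (Case1 P ∧ Case3 P) := fun h => by
      have := (d1 h.1 4 le_rfl).symm.trans (d3 h.2 4 (by omega)); omega
    have n14 : ¬ (Case1 P ∧ ∃ f, Case4 P f) := fun h => by
      have := (d1 h.1 4 le_rfl).symm.trans (d4 h.2 4 (by omega)); omega
    have n15 : ¬ (Case1 P ∧ Case5 P) := fun h => by
      have := (d1 h.1 4 le_rfl).symm.trans (d5 h.2 4 le_rfl); omega
    have n25 : ¬ (Case2 P ∧ Case5 P) := fun h => by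
      have := (d2 h.1 4 (by omega)).symm.trans (d5 h.2 4 le_rfl); omega
    have n35 : ¬ (Case3 P ∧ Case5 P) := fun h => by
      have := (d3 h.1 4 (by omega)).symm.trans (d5 h.2 4 le_rfl); omega
    have n45 : ¬ ((∃ f, Case4 P f) ∧ Case5 P) := fun h => by
      have := (d4 h.1 4 (by omega)).symm.trans (d5 h.2 4 le_rfl); omega
    have n23 : ¬ (Case2 P ∧ Case3 P) := fun h => not_twoProducts_and_alternatingProducts hrank
      ⟨h.1.twoProducts hproj, h.2.alternatingProducts hproj⟩
    have n24 : ¬ (Case2 P ∧ ∃ f, Case4 P f) := fun ⟨h, f, h'⟩ =>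
      not_twoProducts_and_singleExcitation hrank f
        ⟨h.twoProducts hproj, h'.singleExcitation hproj⟩
    have n34 : ¬ (Case3 P ∧ ∃ f, Case4 P f) := fun ⟨h, f, h'⟩ =>
      not_alternatingProducts_and_singleExcitation hrank f
        ⟨h.alternatingProducts hproj, h'.singleExcitation hproj⟩
    refine existsUnique_fin_five ?_ fun i j hij => ?_
    · rcases hex with h | h | h | h | h
      exacts [⟨0, h⟩, ⟨1, h⟩, ⟨2, h⟩, ⟨3, h⟩, ⟨4, h⟩]
    · fin_cases i <;> fin_cases j <;> first
        | exact absurd hij (by decide)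
        | exact n12
        | exact n13
        | exact n14
        | exact n15
        | exact n23
        | exact n24
        | exact n25
        | exact n34
        | exact n35
        | exact n45
  · intro h n hn
    rw [frustrationFree_iff hproj]
    rcases h with h | h | h | h
    · exact (h.oneProduct hproj).nullSpace_ne_bot hproj n
    · exact ne_bot (d2 h n (by omega))
    · exact ne_bot (d3 h n (by omega))
    · exact ne_bot (d4 h n (by omega))
  · intro h n hn
    rw [frustrationFree_iff hproj, not_not]
    exact nullSpace_eq_bot_of_le hproj hn h
  · rintro (h | h | h)
    · obtain ⟨a, ha, ha2, h1⟩ := h.oneProduct hproj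
      exact gapped_of_one_product hproj hθ ha ha2 h1
    · exact (h.twoProducts hproj).gapped hproj hθ
    · exact (h.alternatingProducts hproj).gapped hproj hθ
  · exact fun f h h1 => (h.singleExcitation hproj).gapped hproj hrank hloc h1
  · exact fun f h h1 => ⟨(h.singleExcitation hproj).not_gapped hproj hrank hθ h1,
      fun n hn => (h.singleExcitation hproj).gap_le hproj hrank hθ h1 hn⟩

end QubitChain

theorem theorem3 (P : QubitChain.TwoQubitOp) (hproj : IsStarProjection P) (hrank : P.rank = 2)
    (hloc : ¬ QubitChain.IsOneLocal P) :
    (∀ n : ℕ, 4 ≤ n → Module.finrank ℂ (QubitChain.nullSpace P n)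
      = Module.finrank ℂ (QubitChain.nullSpace P 4)) ∧
    Module.finrank ℂ (QubitChain.nullSpace P 4) ∈ ({0, 1, 2} : Set ℕ) ∧
    (∃! k : Fin 5, (![QubitChain.Case1 P, QubitChain.Case2 P, QubitChain.Case3 P,
      ∃ f : ℂ, QubitChain.Case4 P f, QubitChain.Case5 P] : Fin 5 → Prop) k) ∧
    ((QubitChain.Case1 P ∨ QubitChain.Case2 P ∨ QubitChain.Case3 P ∨
      ∃ f : ℂ, QubitChain.Case4 P f) →
        ∀ n : ℕ, 2 ≤ n → QubitChain.FrustrationFree P n) ∧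
    (QubitChain.Case5 P → ∀ n : ℕ, 4 ≤ n → ¬ QubitChain.FrustrationFree P n) ∧
    ((QubitChain.Case1 P ∨ QubitChain.Case2 P ∨ QubitChain.Case3 P) → QubitChain.Gapped P) ∧
    (∀ f : ℂ, QubitChain.Case4 P f → ‖f‖ ≠ 1 → QubitChain.Gapped P) ∧
    (∀ f : ℂ, QubitChain.Case4 P f → ‖f‖ = 1 →
      ¬ QubitChain.Gapped P ∧
      ∀ n : ℕ, 2 ≤ n → ∃ g : ℝ, QubitChain.IsSpectralGap P n g ∧
        g ≤ 1 - Real.cos (Real.pi / n)) :=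
  QubitChain.classification_and_gap P hproj hrank hloc
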